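/- Let $G=C_9=\langle\gamma\rangle$ be a cyclic group of order $9$, let $N=C_3=\langle\gamma^3\rangle\subseteq G$, let $R$ be a commutative ring and let $M$ be an $R[G]$-module. Let $F_\bullet\to R$ and $P_\bullet\to R$ be the $2$-periodic free resolutions of $R$ over $R[G]$ and over $R[G/N]$ given by the generator $\gamma$ and its image. Let ${}^S\!E_r^{p,q}$ be the Serre spectral sequence $H^p(G/N;H^q(N;M))\Rightarrow H^{p+q}(G;M)$, constructed as the spectral sequence of the double complex $\mathrm{Hom}_{R[G/N]}(P_p,\mathrm{Hom}_{R[N]}(F_q,M))$, $p,q\ge 0$, filtered by $p$. The periodicity $F_{q+2}=F_q$ gives multiplication by the inner periodicity class, $b\colon {}^S\!E_r^{p,q}\to{}^S\!E_r^{p,q+2}$ ($r\ge 2$), and $b\colon H^n(G;M)\to H^{n+2}(G;M)$ on the abutment. (1) There is a spectral sequence $E_r^{p,q}$ ($r\ge 2$; $p,q\in\mathbb Z$) of $R$-modules, with $d_r\colon E_r^{p,q}\to E_r^{p+r,q-r+1}$, obtained from ${}^S\!E$ by inverting $b$. That is, $E_r^{p,q}=\operatorname{colim}_k {}^S\!E_r^{p,q+2k}$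 along multiplication by $b$, with the induced differentials and the induced isomorphisms $H(E_r)\cong E_{r+1}$. (2) $E_2^{p,q}\cong H^p(G/N;\hat H^q(N;M))$ for $p\ge 0$ and $q\in\mathbb Z$, and $E_2^{p,q}=0$ for $p<0$. Here $G/N$ acts on $\hat H^q(N;M)$ by the action induced by that of $G$ on $M$. Under these isomorphisms $b$ corresponds to the map induced by the periodicity operator $\hat H^q(N;M)\to\hat H^{q+2}(N;M)$ of the cyclic group $N$ with generator $\gamma^3$. (3) Inverting $b$ in the abutment gives Tate cohomology: $\hat H^n(G;M)\cong\operatorname{colim}_k H^{n+2k}(G;M)$ along multiplication by $b$, where $b$ corresponds to the periodicity operator of $\hat H^*(G;M)$ with respect to $\gamma$. Let $F^p\hat H^n(G;M)$ be the filtration of $\hat H^n(G;M)$ induced by the Serre filtration of $H^*(G;M)$; its elements are the $b^{-k}[x]$ with $x$ a cocycle of degree $n+2k$ and filtration $\ge p$. (4) If some page $E_r$ is concentrated in finitely many $p$-degrees, i.e. there are $a,c$ with $E_r^{p,q}=0$ unless $a\le p\le c$, then $E$ converges to $\hat H^{*}(G;M)$ in the following sense. For every $n$ there are $p,p'$ with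 $F^p\hat H^n(G;M)=\hat H^n(G;M)$ and $F^{p'}\hat H^n(G;M)=0$. Moreover, for all sufficiently large $s$, $d_s=0$ and $F^p\hat H^{p+q}(G;M)/F^{p+1}\hat H^{p+q}(G;M)\cong E_s^{p,q}=E_\infty^{p,q}$ for all $p,q$, the class of $b^{-k}[x]$ corresponding to the class $b^{-k}[x]$ on the page. -/

import Mathlib

open CategoryTheory

universe u

noncomputable section

/-! ### Filtered cochain complexes and the pages of their spectral sequences -/

/-- A cochain complex of `R`-modules with a decreasing filtration by subcomplexes. -/
structure FilteredComplex (R : Type u) [CommRing R] where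
  /-- the underlying cochain complex -/
  K : CochainComplex (ModuleCat.{u} R) ℤ
  /-- `F p n` is the `p`-th filtration step in degree `n` -/
  F : ℤ → ∀ n : ℤ, Submodule R (K.X n)
  anti : ∀ (p p' n : ℤ), p ≤ p' → F p' n ≤ F p n
  d_mem : ∀ (p n n' : ℤ) (x : K.X n), x ∈ F p n → (K.d n n').hom x ∈ F p n'

namespace FilteredComplex

variable {R : Type u} [CommRing R] (𝒦 : FilteredComplex R)

/-- `Z r p n = {x ∈ Fᵖ Kⁿ | d x ∈ F^{p+r} Kⁿ⁺¹}`. -/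
def Z (r p n : ℤ) : Submodule R (𝒦.K.X n) :=
  𝒦.F p n ⊓ (𝒦.F (p + r) (n + 1)).comap (𝒦.K.d n (n + 1)).hom

/-- `B r p n = Z_{r-1}^{p+1} + d Z_{r-1}^{p-r+1}`, in degree `n`.  (In the supremum only
`i = n - 1` contributes, since `d` from degree `i` to degree `n` vanishes otherwise.) -/
def B (r p n : ℤ) : Submodule R (𝒦.K.X n) :=
  𝒦.Z (r - 1) (p + 1) n ⊔ ⨆ i : ℤ, (𝒦.Z (r - 1) (p - r + 1) i).map (𝒦.K.d i n).hom

/-- The entry `E_r^{p, n - p} = Z_r / B_r` of the spectral sequence of a filtered complex;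
here `n` is the total degree. -/
abbrev Page (r p n : ℤ) : Type u := 𝒦.Z r p n ⧸ (𝒦.B r p n).submoduleOf (𝒦.Z r p n)

/-- The class in `E_r^{p, n - p}` of an element of `Z r p n`. -/
def cls (r p n : ℤ) : 𝒦.Z r p n →ₗ[R] 𝒦.Page r p n :=
  ((𝒦.B r p n).submoduleOf (𝒦.Z r p n)).mkQ

/-- The submodule of all cocycles of degree `n`. -/
def cocycles (n : ℤ) : Submodule R (𝒦.K.X n) := LinearMap.ker (𝒦.K.d n (n + 1)).hom

lemma d_mem_Z {r p n p' n' : ℤ} (hp : p' = p + r) (hn : n' = n + 1) (x : 𝒦.K.X n)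
    (hx : x ∈ 𝒦.Z r p n) : (𝒦.K.d n n').hom x ∈ 𝒦.Z r p' n' := by
  subst hp hn
  have h : (𝒦.K.d (n + 1) (n + 1 + 1)).hom ((𝒦.K.d n (n + 1)).hom x) = 0 := by
    rw [← LinearMap.comp_apply, ← ModuleCat.hom_comp, 𝒦.K.d_comp_d]
    rfl
  refine Submodule.mem_inf.2 ⟨hx.2, Submodule.mem_comap.2 ?_⟩
  rw [h]
  exact zero_mem _

/-- The restriction of the differential to a map `Z_r^p → Z_r^{p+r}`. -/
def dZ (r p n p' n' : ℤ) (hp : p' = p + r) (hn : n' = n + 1) :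
    𝒦.Z r p n →ₗ[R] 𝒦.Z r p' n' :=
  (𝒦.K.d n n').hom.restrict fun x hx => 𝒦.d_mem_Z hp hn x hx

/-- The differential `d_r : E_r^{p,q} → E_r^{p+r,q-r+1}`, induced by the differential of the
complex. -/
def pageD (r p n p' n' : ℤ) (hp : p' = p + r) (hn : n' = n + 1) :
    𝒦.Page r p n →ₗ[R] 𝒦.Page r p' n' :=
  Submodule.mapQ _ _ (𝒦.dZ r p n p' n' hp hn) <| by
    rintro ⟨x, hx⟩ hxB
    change x ∈ 𝒦.B r p n at hxB
    change (𝒦.K.d n n').hom x ∈ 𝒦.B r p' n'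
    obtain ⟨y, hy, w, hw, rfl⟩ := Submodule.mem_sup.1 hxB
    have hker : (⨆ i : ℤ, (𝒦.Z (r - 1) (p - r + 1) i).map (𝒦.K.d i n).hom) ≤
        LinearMap.ker (𝒦.K.d n n').hom := by
      refine iSup_le fun i => ?_
      rintro _ ⟨v, -, rfl⟩
      rw [LinearMap.mem_ker, ← LinearMap.comp_apply, ← ModuleCat.hom_comp, 𝒦.K.d_comp_d]
      rfl
    rw [map_add, LinearMap.mem_ker.1 (hker hw), add_zero]
    refine Submodule.mem_sup_right (Submodule.mem_iSup_of_mem n ⟨y, ?_, rfl⟩)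
    rwa [show p' - r + 1 = p + 1 by rw [hp]; ring]

end FilteredComplex

/-! ### The Serre spectral sequence of a cyclic group and a subgroup

`G` is a finite commutative group, `N` a subgroup, `Q = G ⧸ N`, `γ : G` (in the application a
generator of `G`).  The free resolutions used are the periodic ones,
`F = (⋯ → R[G] --norm--> R[G] --(γ - 1)--> R[G])` over `R[G]` and
`P = (⋯ → R[Q] --norm--> R[Q] --(γ - 1)--> R[Q])` over `R[Q]`.  The double complex
`Hom_{R[Q]}(P_p, Hom_{R[N]}(F_q, M))` has `Hom_{R[N]}(R[G], M)` in every bidegree with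
`p, q ≥ 0`. -/

namespace SerreTate

variable {R G : Type u} [CommRing R] [CommGroup G]
  (γ : G) (N : Subgroup G) (M : Rep.{u} R G)

/-- `Hom_{R[N]}(R[G], M)`, as functions `f : G → M` with `f (n g) = n f(g)` for `n ∈ N`. -/
def Inner : Type u :=
  Representation.coindV N.subtype (M.ρ.comp N.subtype)

instance : AddCommGroup (Inner N M) :=
  inferInstanceAs (AddCommGroup (Representation.coindV N.subtype (M.ρ.comp N.subtype)))

instance : Module R (Inner N M) :=
  inferInstanceAs (Module R (Representation.coindV N.subtype (M.ρ.comp N.subtype)))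

@[ext] lemma Inner.ext {f f' : Inner N M} (h : ∀ x, f.1 x = f'.1 x) : f = f' :=
  Subtype.ext (funext h)

lemma sum_comp {V : Type u} [AddCommGroup V] [Module R V] {ι : Type*} (s : Finset ι)
    (f : ι → V →ₗ[R] V) (g : V →ₗ[R] V) : (∑ i ∈ s, f i) ∘ₗ g = ∑ i ∈ s, f i ∘ₗ g := by
  ext x
  simp

lemma comp_sum {V : Type u} [AddCommGroup V] [Module R V] {ι : Type*} (s : Finset ι)
    (f : ι → V →ₗ[R] V) (g : V →ₗ[R] V) : g ∘ₗ (∑ i ∈ s, f i) = ∑ i ∈ s, g ∘ₗ f i := by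
  ext x
  simp

/-- The endomorphism of `Hom_{R[N]}(R[G], M)` induced by multiplication by `g` on `R[G]`. -/
def translate (g : G) : Inner N M →ₗ[R] Inner N M :=
  LinearMap.restrict (p := Representation.coindV N.subtype (M.ρ.comp N.subtype))
    (q := Representation.coindV N.subtype (M.ρ.comp N.subtype)) (LinearMap.funLeft R M.V (fun x => g * x)) fun f hf n x => by
    have := hf n (g * x)
    simpa [LinearMap.funLeft_apply, mul_left_comm] using this

/-- The action `(g • f)(x) = g f(g⁻¹ x)` of `G` on `Hom_{R[N]}(R[G], M)`; it factors through
`G ⧸ N`. -/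
def conj (g : G) : Inner N M →ₗ[R] Inner N M :=
  LinearMap.restrict (p := Representation.coindV N.subtype (M.ρ.comp N.subtype))
    (q := Representation.coindV N.subtype (M.ρ.comp N.subtype))
    ((M.ρ g).compLeft G ∘ₗ LinearMap.funLeft R M.V (fun x => g⁻¹ * x)) fun f hf n x => by
    have h := hf n (g⁻¹ * x)
    have h' : M.ρ g (M.ρ (n : G) (f (g⁻¹ * x))) = M.ρ (n : G) (M.ρ g (f (g⁻¹ * x))) := by
      rw [← Module.End.mul_apply, ← Module.End.mul_apply, ← map_mul, ← map_mul, mul_comm]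
    simp only [LinearMap.coe_comp, Function.comp_apply, LinearMap.compLeft_apply,
      LinearMap.funLeft_apply, Subgroup.coe_subtype, MonoidHom.coe_comp] at h ⊢
    rw [mul_left_comm, h, h']

@[simp] lemma translate_apply (g : G) (f : Inner N M) (x : G) :
    (translate N M g f).1 x = f.1 (g * x) := rfl

@[simp] lemma conj_apply (g : G) (f : Inner N M) (x : G) :
    (conj N M g f).1 x = M.ρ g (f.1 (g⁻¹ * x)) := rfl

/-- The differential `K^{p,q} → K^{p+1,q}` (for every `q`), induced by that of `P`: it is `γ - 1`
for `p` even and the norm of the group `G ⧸ N` for `p` odd. -/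
def dH (p : ℕ) : Inner N M →ₗ[R] Inner N M :=
  if Even p then conj N M γ - LinearMap.id
  else ∑ j ∈ Finset.range N.index, conj N M (γ ^ j)

/-- The differential `K^{p,q} → K^{p,q+1}` (for every `p`), induced by that of `F`: it is `γ - 1`
for `q` even and the norm of `G` for `q` odd. -/
def dV [Fintype G] (q : ℤ) : Inner N M →ₗ[R] Inner N M :=
  if Even q then translate N M γ - LinearMap.id
  else ∑ g : G, translate N M g

/-- The total differential from total degree `n` to total degree `n + 1`.  The entry `x p` of
`x : ℕ →₀ Hom_{R[N]}(R[G], M)` is the component in bidegree `(p, n - p)`. -/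
def D [Fintype G] (n : ℤ) : (ℕ →₀ Inner N M) →ₗ[R] (ℕ →₀ Inner N M) :=
  Finsupp.lsum R fun p : ℕ =>
    Finsupp.lsingle (p + 1) ∘ₗ dH γ N M p +
      ((-1 : ℤ) ^ p) • (Finsupp.lsingle p ∘ₗ dV γ N M (n - p))

lemma D_single [Fintype G] (n : ℤ) (p : ℕ) (a : Inner N M) :
    D γ N M n (Finsupp.single p a) = Finsupp.single (p + 1) (dH γ N M p a) +
      ((-1 : ℤ) ^ p) • Finsupp.single p (dV γ N M (n - p) a) := by
  simp [D]

lemma conj_mul (g h : G) : conj N M g ∘ₗ conj N M h = conj N M (g * h) := by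
  ext f x
  simp [mul_assoc]

lemma conj_one : conj N M 1 = LinearMap.id := by
  ext f x
  simp

lemma conj_mem (n : G) (hn : n ∈ N) : conj N M n = LinearMap.id := by
  ext f x
  have h := f.2 ⟨n, hn⟩ (n⁻¹ * x)
  simp only [Subgroup.coe_subtype, mul_inv_cancel_left] at h
  exact h.symm

lemma translate_mul (g h : G) : translate N M g ∘ₗ translate N M h = translate N M (g * h) := by
  ext f x
  simp [mul_assoc, mul_left_comm]

lemma conj_translate (g h : G) :
    conj N M g ∘ₗ translate N M h = translate N M h ∘ₗ conj N M g := by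
  ext f x
  simp [mul_left_comm]

lemma norm_conj :
    (∑ j ∈ Finset.range N.index, conj N M (γ ^ j)) ∘ₗ (conj N M γ - LinearMap.id) = 0 := by
  rw [LinearMap.comp_sub, sum_comp, LinearMap.comp_id, ← Finset.sum_sub_distrib]
  simp only [conj_mul, ← pow_succ]
  rw [Finset.sum_range_sub (fun j => conj N M (γ ^ j)), conj_mem N M _ (N.pow_index_mem γ),
    pow_zero, conj_one, sub_self]

lemma conj_norm :
    (conj N M γ - LinearMap.id) ∘ₗ (∑ j ∈ Finset.range N.index, conj N M (γ ^ j)) = 0 := by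
  rw [LinearMap.sub_comp, comp_sum, LinearMap.id_comp, ← Finset.sum_sub_distrib]
  simp only [conj_mul, ← pow_succ']
  rw [Finset.sum_range_sub (fun j => conj N M (γ ^ j)), conj_mem N M _ (N.pow_index_mem γ),
    pow_zero, conj_one, sub_self]

lemma dH_dH (p : ℕ) : dH γ N M (p + 1) ∘ₗ dH γ N M p = 0 := by
  by_cases hp : Even p
  · simp only [dH, if_pos hp, if_neg (Nat.not_even_iff_odd.2 hp.add_one)]
    exact norm_conj γ N M
  · have hp' : Even (p + 1) := (Nat.not_even_iff_odd.1 hp).add_one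
    simp only [dH, if_neg hp, if_pos hp']
    exact conj_norm γ N M

lemma dV_dV [Fintype G] (q : ℤ) : dV γ N M (q + 1) ∘ₗ dV γ N M q = 0 := by
  by_cases hq : Even q
  · simp only [dV, if_pos hq, if_neg (Int.not_even_iff_odd.2 hq.add_one)]
    rw [LinearMap.comp_sub, sum_comp, LinearMap.comp_id, sub_eq_zero]
    simp only [translate_mul]
    exact Fintype.sum_equiv (Equiv.mulRight γ) _ _ fun g => rfl
  · have hq' : Even (q + 1) := (Int.not_even_iff_odd.1 hq).add_one
    simp only [dV, if_neg hq, if_pos hq']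
    rw [LinearMap.sub_comp, comp_sum, LinearMap.id_comp, sub_eq_zero]
    simp only [translate_mul]
    exact Fintype.sum_equiv (Equiv.mulLeft γ) _ _ fun g => rfl

lemma dH_dV [Fintype G] (p : ℕ) (q : ℤ) :
    dH γ N M p ∘ₗ dV γ N M q = dV γ N M q ∘ₗ dH γ N M p := by
  have h : ∀ g, conj N M g ∘ₗ dV γ N M q = dV γ N M q ∘ₗ conj N M g := by
    intro g
    unfold dV
    split_ifs
    · rw [LinearMap.comp_sub, LinearMap.sub_comp, conj_translate]
      rfl
    · rw [comp_sum, sum_comp]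
      simp only [conj_translate]
  by_cases hp : Even p
  · simp only [dH, if_pos hp]
    rw [LinearMap.sub_comp, LinearMap.comp_sub, h]
    rfl
  · simp only [dH, if_neg hp]
    rw [sum_comp, comp_sum]
    simp only [h]

lemma D_D [Fintype G] (n : ℤ) : D γ N M (n + 1) ∘ₗ D γ N M n = 0 := by
  refine Finsupp.lhom_ext fun p a => ?_
  have h1 := LinearMap.congr_fun (dH_dH γ N M p) a
  have h2 := LinearMap.congr_fun (dV_dV γ N M (n - p)) a
  have h3 := LinearMap.congr_fun (dH_dV γ N M p (n - p)) a
  simp only [LinearMap.comp_apply, LinearMap.zero_apply] at h1 h2 h3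
  have e1 : n + 1 - ((p + 1 : ℕ) : ℤ) = n - p := by push_cast; ring
  have e2 : n + 1 - (p : ℤ) = n - p + 1 := by ring
  rw [LinearMap.comp_apply, D_single, map_add, map_zsmul, D_single, D_single, h1, e1, e2, h2, h3,
    LinearMap.zero_apply, pow_succ]
  simp

/-- The cochains of total degree `n` with components in the bidegrees `(p, n - p)` with
`0 ≤ p ≤ n` only. -/
def totX (n : ℤ) : Submodule R (ℕ →₀ Inner N M) where
  carrier := {x | ∀ p : ℕ, n < p → x p = 0}
  add_mem' hx hy p hp := by simp [hx p hp, hy p hp]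
  zero_mem' _ _ := rfl
  smul_mem' c x hx p hp := by simp [hx p hp]

/-- The cochains with components in horizontal degrees `≥ p` only. -/
def filX (p : ℤ) : Submodule R (ℕ →₀ Inner N M) where
  carrier := {x | ∀ i : ℕ, (i : ℤ) < p → x i = 0}
  add_mem' hx hy i hi := by simp [hx i hi, hy i hi]
  zero_mem' _ _ := rfl
  smul_mem' c x hx i hi := by simp [hx i hi]

lemma D_apply_zero [Fintype G] (n : ℤ) (x : ℕ →₀ Inner N M) :
    D γ N M n x 0 = dV γ N M n (x 0) := by
  induction x using Finsupp.induction_linear with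
  | zero => simp
  | add x y hx hy => simp [hx, hy]
  | single p a =>
    rw [D_single]
    rcases p with _ | p
    · simp
    · simp

lemma D_apply_succ [Fintype G] (n : ℤ) (x : ℕ →₀ Inner N M) (i : ℕ) :
    D γ N M n x (i + 1) =
      dH γ N M i (x i) + ((-1 : ℤ) ^ (i + 1)) • dV γ N M (n - (i + 1 : ℕ)) (x (i + 1)) := by
  induction x using Finsupp.induction_linear with
  | zero => simp
  | add x y hx hy =>
    simp only [map_add, Finsupp.add_apply, hx, hy, smul_add]
    abel
  | single p a =>
    rw [D_single, Finsupp.add_apply, Finsupp.smul_apply]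
    congr 1
    · by_cases h : p = i
      · subst h; simp
      · rw [Finsupp.single_eq_of_ne (by omega), Finsupp.single_eq_of_ne (by omega), map_zero]
    · by_cases h : p = i + 1
      · subst h; simp
      · rw [Finsupp.single_eq_of_ne (by omega), Finsupp.single_eq_of_ne (by omega), map_zero,
          smul_zero, smul_zero]

lemma D_mem_totX [Fintype G] (n n' : ℤ) (h : n + 1 = n') (x : ℕ →₀ Inner N M)
    (hx : x ∈ totX N M n) : D γ N M n x ∈ totX N M n' := by
  subst h
  intro p hp
  rcases p with _ | p
  · rw [D_apply_zero, hx 0 (by omega), map_zero]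
  · rw [D_apply_succ, hx p (by push_cast at hp; omega), hx (p + 1) (by omega), map_zero, map_zero,
      smul_zero, add_zero]

lemma D_mem_filX [Fintype G] (n p : ℤ) (x : ℕ →₀ Inner N M) (hx : x ∈ filX N M p) :
    D γ N M n x ∈ filX N M p := by
  intro i hi
  rcases i with _ | i
  · rw [D_apply_zero, hx 0 hi, map_zero]
  · rw [D_apply_succ, hx i (by push_cast at hi; omega), hx (i + 1) hi, map_zero, map_zero,
      smul_zero, add_zero]

/-- The total complex of the double complex `Hom_{R[Q]}(P_p, Hom_{R[N]}(F_q, M))`, `p, q ≥ 0`. -/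
def tot [Fintype G] : CochainComplex (ModuleCat.{u} R) ℤ where
  X n := ModuleCat.of R (totX N M n)
  d n n' := if h : n + 1 = n' then
      ModuleCat.ofHom ((D γ N M n).restrict fun x hx => D_mem_totX γ N M n n' h x hx)
    else 0
  shape n n' h := dif_neg h
  d_comp_d' i j k hij hjk := by
    have hij' : i + 1 = j := hij
    have hjk' : j + 1 = k := hjk
    subst hij' hjk'
    rw [dif_pos rfl, dif_pos rfl]
    ext x : 2
    exact Subtype.ext (LinearMap.congr_fun (D_D γ N M i) x.1)

lemma tot_d_apply [Fintype G] (n n' : ℤ) (h : n + 1 = n') (x : totX N M n) :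
    (((tot γ N M).d n n').hom x : totX N M n').1 = D γ N M n x.1 := by
  have e : (tot γ N M).d n n' =
      ModuleCat.ofHom ((D γ N M n).restrict fun x hx => D_mem_totX γ N M n n' h x hx) := dif_pos h
  rw [e]
  rfl

/-- The total complex, filtered by the horizontal degree `p`.  Its spectral sequence is the
(Lyndon–Hochschild–)Serre spectral sequence `H^p(G ⧸ N; H^q(N; M)) ⇒ H^{p+q}(G; M)`. -/
def serre [Fintype G] : FilteredComplex R where
  K := tot γ N M
  F p n := show Submodule R (totX N M n) from (filX N M p).comap (totX N M n).subtype
  anti p p' n h x hx i hi := hx i (by omega)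
  d_mem p n n' x hx := by
    by_cases h : n + 1 = n'
    · intro i hi
      exact (DFunLike.congr_fun (tot_d_apply γ N M n n' h x) i).trans
        (D_mem_filX γ N M n p x.1 hx i hi)
    · rw [(tot γ N M).shape n n' h]
      exact zero_mem _

/-! ### Tate cohomology and its periodicity for cyclic groups

`C` is a finite commutative group, `X` a representation of `C`, and `σ` a generator of `C`.  The
periodicity class of `C` (with respect to `σ`) is the class of the extension
`0 → R → R[C] --(σ - 1)--> R[C] → R → 0`; it acts on Tate cohomology by the double connecting
homomorphism of `0 → X → Map(C, X) → Map(C, X) → X → 0`. -/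

section Periodicity

variable {C : Type u} [CommGroup C] (X : Rep.{u} R C)

/-- `Map(C, X) ≅ R[C] ⊗ X` with the diagonal action `(c • f)(x) = c f(c⁻¹ x)`. -/
def funRho : Representation R C (C → X.V) where
  toFun c := (X.ρ c).compLeft C ∘ₗ LinearMap.funLeft R X.V (fun x => c⁻¹ * x)
  map_one' := by
    ext f x
    simp [LinearMap.funLeft_apply]
  map_mul' c c' := by
    ext f x
    simp [LinearMap.funLeft_apply, mul_assoc]

lemma funRho_apply (c : C) (f : C → X.V) (x : C) :
    funRho X c f x = X.ρ c (f (c⁻¹ * x)) := rfl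

/-- `f ↦ f(σ⁻¹ ·) - f` on `Map(C, X)`. -/
def diffMap (σ : C) : (C → X.V) →ₗ[R] (C → X.V) :=
  LinearMap.funLeft R X.V (fun x => σ⁻¹ * x) - LinearMap.id

lemma diffMap_apply (σ : C) (f : C → X.V) (x : C) : diffMap X σ f x = f (σ⁻¹ * x) - f x := rfl

lemma rep_shortExact {S : ShortComplex (Rep.{u} R C)} (h1 : Function.Injective S.f.hom)
    (h2 : ∀ y, S.g.hom y = 0 → ∃ x, S.f.hom x = y) (h3 : Function.Surjective S.g.hom) :
    S.ShortExact where
  exact := by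
    apply (forget₂ _ (ModuleCat R)).reflects_exact_of_faithful
    rw [ShortComplex.moduleCat_exact_iff]
    exact h2
  mono_f := (Rep.mono_iff_injective _).2 h1
  epi_g := (Rep.epi_iff_surjective _).2 h3

lemma eq_of_invariant (σ : C) (hσ : ∀ x, x ∈ Subgroup.zpowers σ) (f : C → X.V)
    (hf : ∀ x, f (σ⁻¹ * x) = f x) (x : C) : f x = f 1 := by
  let S : Subgroup C :=
    { carrier := {c | ∀ x, f (c * x) = f x}
      mul_mem' := fun {a c} ha hc x => by rw [mul_assoc, ha, hc]
      one_mem' := fun x => by rw [one_mul]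
      inv_mem' := fun {a} ha x => by rw [← ha (a⁻¹ * x), mul_inv_cancel_left] }
  have h : σ ∈ S := by
    rw [← S.inv_mem_iff]
    exact hf
  have h' : x ∈ S := (Subgroup.zpowers_le.2 h) (hσ x)
  simpa using h' 1

/-- The translation action of `C` on `Map(C, X)`. -/
def transRho : Representation R C (C → X.V) where
  toFun c := LinearMap.funLeft R X.V (fun x => c⁻¹ * x)
  map_one' := by
    ext f x
    simp [LinearMap.funLeft_apply]
  map_mul' c c' := by
    ext f x
    simp [LinearMap.funLeft_apply, mul_assoc]

variable [Fintype C]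

/-- The sum map `Map(C, X) → X`, `f ↦ ∑ x, f x`. -/
def sumMap : (C → X.V) →ₗ[R] X.V := ∑ x : C, LinearMap.proj x

lemma sumMap_apply (f : C → X.V) : sumMap X f = ∑ x : C, f x := by
  simp [sumMap]

lemma sumMap_funRho (c : C) (f : C → X.V) : sumMap X (funRho X c f) = X.ρ c (sumMap X f) := by
  simp only [sumMap_apply, funRho_apply, map_sum]
  exact Fintype.sum_equiv (Equiv.mulLeft c⁻¹) _ _ fun x => rfl

/-- The kernel of the sum map, as a subrepresentation of `Map(C, X)`. -/
def kerRho : Representation R C (LinearMap.ker (sumMap X)) where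
  toFun c := (funRho X c).restrict fun f hf => by
    rw [LinearMap.mem_ker, sumMap_funRho, LinearMap.mem_ker.1 hf, map_zero]
  map_one' := by
    ext f x
    simp
  map_mul' c c' := by
    ext f x
    simp [funRho_apply]

lemma sumMap_diffMap (σ : C) (f : C → X.V) : sumMap X (diffMap X σ f) = 0 := by
  simp only [sumMap_apply, diffMap_apply, Finset.sum_sub_distrib, sub_eq_zero]
  exact Fintype.sum_equiv (Equiv.mulLeft σ⁻¹) _ _ fun x => rfl

/-- The short complex `X → Map(C, X) → ker(sum)`: constant functions, then `f ↦ f(σ⁻¹ ·) - f`. -/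
def leftSeq (σ : C) : ShortComplex (Rep.{u} R C) where
  X₁ := X
  X₂ := Rep.of (funRho X)
  X₃ := Rep.of (kerRho X)
  f := Rep.ofHom ⟨LinearMap.pi fun _ => LinearMap.id, fun c => by
    ext m x
    rfl⟩
  g := Rep.ofHom ⟨(diffMap X σ).codRestrict _ (sumMap_diffMap X σ), fun c => by
    ext f x
    change X.ρ c (f (c⁻¹ * (σ⁻¹ * x))) - X.ρ c (f (c⁻¹ * x)) =
      X.ρ c (f (σ⁻¹ * (c⁻¹ * x)) - f (c⁻¹ * x))
    rw [map_sub, mul_left_comm]⟩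
  zero := by
    ext m x
    exact sub_self m

/-- The short complex `ker(sum) → Map(C, X) → X`. -/
def rightSeq : ShortComplex (Rep.{u} R C) where
  X₁ := Rep.of (kerRho X)
  X₂ := Rep.of (funRho X)
  X₃ := X
  f := Rep.ofHom ⟨(LinearMap.ker (sumMap X)).subtype, fun c => rfl⟩
  g := Rep.ofHom ⟨sumMap X, fun c => by
    ext f : 1
    exact sumMap_funRho X c f⟩
  zero := by
    ext f
    exact f.2

lemma exists_diffMap (σ : C) (hσ : ∀ x, x ∈ Subgroup.zpowers σ) (f : C → X.V)
    (hf : sumMap X f = 0) : ∃ h, diffMap X σ h = f := by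
  classical
  have key : f ∈ Representation.Coinvariants.ker (transRho X) := by
    have e : f = ∑ x : C, (transRho X x (Pi.single 1 (f x)) - Pi.single 1 (f x)) := by
      have e1 : ∑ x : C, (Pi.single (1 : C) (f x) : C → X.V) = 0 := by
        rw [← Finset.univ_sum_single (∑ x : C, (Pi.single (1 : C) (f x) : C → X.V))]
        refine Finset.sum_eq_zero fun y _ => ?_
        rw [Finset.sum_apply]
        by_cases hy : y = 1
        · subst hy
          simp only [Pi.single_eq_same]
          rw [← sumMap_apply, hf, Pi.single_zero]
        · simp [Pi.single_eq_of_ne hy]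
      rw [Finset.sum_sub_distrib, e1, sub_zero]
      funext y
      rw [Finset.sum_apply, Finset.sum_eq_single y]
      · change f y = (Pi.single (1 : C) (f y) : C → X.V) (y⁻¹ * y)
        simp
      · intro x _ hx
        change (Pi.single (1 : C) (f x) : C → X.V) (x⁻¹ * y) = 0
        refine Pi.single_eq_of_ne (fun h => hx ?_) _
        rwa [inv_mul_eq_one] at h
      · simp
    rw [e]
    exact Submodule.sum_mem _ fun x _ => Representation.Coinvariants.sub_mem_ker x _
  rw [Representation.FiniteCyclicGroup.coinvariantsKer_eq_range _ σ hσ] at key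
  exact key

lemma leftSeq_shortExact (σ : C) (hσ : ∀ x, x ∈ Subgroup.zpowers σ) :
    (leftSeq X σ).ShortExact := by
  refine rep_shortExact (fun m m' h => ?_) (fun f hf => ?_) fun f => ?_
  · exact congr_fun h (1 : C)
  · refine ⟨f (1 : C), ?_⟩
    funext x
    refine (eq_of_invariant X σ hσ f (fun y => ?_) x).symm
    exact sub_eq_zero.1 (congr_fun (congr_arg Subtype.val hf) y)
  · obtain ⟨h, hh⟩ := exists_diffMap X σ hσ f.1 f.2
    exact ⟨h, Subtype.ext hh⟩

lemma sumMap_surjective : Function.Surjective (sumMap X) := by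
  classical
  intro m
  refine ⟨Pi.single 1 m, ?_⟩
  rw [sumMap_apply]
  simp

lemma rightSeq_shortExact : (rightSeq X).ShortExact :=
  rep_shortExact (fun _ _ h => Subtype.ext h) (fun f hf => ⟨⟨f, hf⟩, rfl⟩) (sumMap_surjective X)

/-- Multiplication by the periodicity class, `Ĥ^q(C; X) → Ĥ^{q+2}(C; X)`. -/
def periodicity (σ : C) (hσ : ∀ x, x ∈ Subgroup.zpowers σ) (q : ℤ) :
    tateCohomology X q →ₗ[R] tateCohomology X (q + 1 + 1) :=
  (TateCohomology.δ (rightSeq_shortExact X) q ≫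
    TateCohomology.δ (leftSeq_shortExact X σ hσ) (q + 1)).hom

end Periodicity

/-! ### The inner periodicity class

The resolution `F` is periodic, and the periodicity class `b` acts on cochains by the
identification `F_{q+2} = F_q`, i.e. by the identity maps `K^{p,q} = K^{p,q+2}`. -/

/-- Multiplication by `b ^ k`, from total degree `n` to total degree `n' = n + 2 k`: it maps the
component in bidegree `(p, q)` identically to bidegree `(p, q + 2 k)`. -/
def b [Fintype G] (k : ℕ) (n n' : ℤ) (h : n' = n + 2 * k) :
    (serre γ N M).K.X n →ₗ[R] (serre γ N M).K.X n' :=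
  Submodule.inclusion (p := totX N M n) (p' := totX N M n') fun x hx p hp => hx p (by omega)

lemma dV_periodic [Fintype G] (q : ℤ) (k : ℕ) : dV γ N M (q + 2 * k) = dV γ N M q := by
  have : Even (q + 2 * (k : ℤ)) ↔ Even q := by
    rw [Int.even_add]
    simp
  simp only [dV, this]

lemma D_periodic [Fintype G] (n : ℤ) (k : ℕ) : D γ N M (n + 2 * k) = D γ N M n := by
  refine Finsupp.lhom_ext fun p a => ?_
  rw [D_single, D_single, show n + 2 * (k : ℤ) - p = n - p + 2 * k by ring, dV_periodic]

lemma d_b [Fintype G] (k : ℕ) (i n i' n' : ℤ) (hi : i' = i + 2 * k) (hn : n' = n + 2 * k)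
    (x : (serre γ N M).K.X i) :
    ((serre γ N M).K.d i' n').hom (b γ N M k i i' hi x) =
      b γ N M k n n' hn (((serre γ N M).K.d i n).hom x) := by
  by_cases h : i + 1 = n
  · refine Subtype.ext ?_
    refine (tot_d_apply γ N M i' n' (by omega) _).trans ?_
    refine Eq.trans ?_ (tot_d_apply γ N M i n h x).symm
    subst hi
    rw [D_periodic]
    rfl
  · rw [(serre γ N M).K.shape i n h, (serre γ N M).K.shape i' n' fun h' => h (by
      have : i' + 1 = n' := h'
      omega)]
    exact (map_zero (b γ N M k n n' hn)).symm

lemma b_mem_Z [Fintype G] (k : ℕ) (r p n n' : ℤ) (h : n' = n + 2 * k)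
    (x : (serre γ N M).K.X n) (hx : x ∈ (serre γ N M).Z r p n) :
    b γ N M k n n' h x ∈ (serre γ N M).Z r p n' := by
  refine Submodule.mem_inf.2 ⟨hx.1, Submodule.mem_comap.2 ?_⟩
  rw [d_b γ N M k n (n + 1) n' (n' + 1) h (by omega) x]
  exact hx.2

/-- Multiplication by `b ^ k` on `Z_r^p`. -/
def bZ [Fintype G] (k : ℕ) (r p n n' : ℤ) (h : n' = n + 2 * k) :
    (serre γ N M).Z r p n →ₗ[R] (serre γ N M).Z r p n' :=
  (b γ N M k n n' h).restrict fun x hx => b_mem_Z γ N M k r p n n' h x hx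

/-- Multiplication by `b ^ k` on the pages of the Serre spectral sequence,
`E_r^{p,q} → E_r^{p,q+2k}`. -/
def bPage [Fintype G] (k : ℕ) (r p n n' : ℤ) (h : n' = n + 2 * k) :
    (serre γ N M).Page r p n →ₗ[R] (serre γ N M).Page r p n' :=
  Submodule.mapQ _ _ (bZ γ N M k r p n n' h) <| by
    rintro ⟨x, hx⟩ hxB
    change x ∈ (serre γ N M).B r p n at hxB
    change b γ N M k n n' h x ∈ (serre γ N M).B r p n'
    suffices H : (serre γ N M).B r p n ≤ ((serre γ N M).B r p n').comap (b γ N M k n n' h) from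
      H hxB
    refine sup_le (fun y hy => ?_) (iSup_le fun i => ?_)
    · exact Submodule.mem_sup_left (b_mem_Z γ N M k (r - 1) (p + 1) n n' h y hy)
    · rintro _ ⟨v, hv, rfl⟩
      refine Submodule.mem_sup_right (Submodule.mem_iSup_of_mem (i + 2 * k)
        ⟨b γ N M k i _ rfl v, b_mem_Z γ N M k _ _ _ _ rfl v hv, ?_⟩)
      exact d_b γ N M k i n _ n' rfl h v

/-! ### Inverting the periodicity class -/

section Localization

variable [Fintype G]

/-- The statement that the spectral sequence `E` is the Serre spectral sequence with `b` inverted: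
`E_r^{p,q}` is, through the maps `frac = (x ↦ b⁻ᵏ x)`, the colimit over `k` of the entries
`E_r^{p,q+2k}` of the Serre spectral sequence along multiplication by `b`, and the differentials
of `E` and the isomorphisms from the homology of a page to the next page are the induced ones. -/
structure Localization (E : E₂CohomologicalSpectralSequence (ModuleCat.{u} R)) where
  /-- `x ↦ b⁻ᵏ x`, from bidegree `(p, q + 2 k)` (total degree `n`) to bidegree `(p, q)` -/
  frac (r : ℤ) (hr : 2 ≤ r) (p q n : ℤ) (k : ℕ) (hn : n = p + q + 2 * k) :
    (serre γ N M).Page r p n →ₗ[R] (E.page r hr).X (p, q)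
  frac_b (r : ℤ) (hr : 2 ≤ r) (p q n n' : ℤ) (k j : ℕ) (hn : n = p + q + 2 * k)
    (hn' : n' = p + q + 2 * ((k + j : ℕ) : ℤ)) (h : n' = n + 2 * j)
    (x : (serre γ N M).Page r p n) :
    frac r hr p q n' (k + j) hn' (bPage γ N M j r p n n' h x) = frac r hr p q n k hn x
  exists_frac (r : ℤ) (hr : 2 ≤ r) (p q : ℤ) (y : (E.page r hr).X (p, q)) :
    ∃ (k : ℕ) (x : (serre γ N M).Page r p (p + q + 2 * k)), frac r hr p q _ k rfl x = y
  frac_eq_zero (r : ℤ) (hr : 2 ≤ r) (p q n : ℤ) (k : ℕ) (hn : n = p + q + 2 * k)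
    (x : (serre γ N M).Page r p n) (hx : frac r hr p q n k hn x = 0) :
    ∃ j : ℕ, bPage γ N M j r p n (n + 2 * j) rfl x = 0
  frac_d (r : ℤ) (hr : 2 ≤ r) (p q n : ℤ) (k : ℕ) (hn : n = p + q + 2 * k)
    (hn' : n + 1 = p + r + (q + 1 - r) + 2 * k) (x : (serre γ N M).Page r p n) :
    ((E.page r hr).d (p, q) (p + r, q + 1 - r)).hom (frac r hr p q n k hn x) =
      frac r hr (p + r) (q + 1 - r) (n + 1) k hn'
        ((serre γ N M).pageD r p n (p + r) (n + 1) rfl rfl x)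
  frac_iso (r : ℤ) (hr : 2 ≤ r) (p q n : ℤ) (k : ℕ) (hn : n = p + q + 2 * k)
    (z : (serre γ N M).Z r p n) (z' : (serre γ N M).Z (r + 1) p n) (hz : z.1 = z'.1)
    (c : (E.page r hr).cycles (p, q))
    (hc : ((E.page r hr).iCycles (p, q)).hom c =
      frac r hr p q n k hn ((serre γ N M).cls r p n z)) :
    (E.iso r (r + 1) (p, q) rfl hr).hom.hom (((E.page r hr).homologyπ (p, q)).hom c) =
      frac (r + 1) (by omega) p q n k hn ((serre γ N M).cls (r + 1) p n z')

/-- The identification of `Ĥ^*(G; M)` with the abutment `H^*(G; M)` of the Serre spectral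
sequence (the cohomology of the total complex) with the periodicity class inverted:
`Ĥ^n(G; M)` is, through the maps `frac = (x ↦ b⁻ᵏ [x])`, the colimit over `k` of the cohomology
groups in degrees `n + 2 k` along multiplication by `b`, and `b` corresponds to the
periodicity of `Ĥ^*(G; M)`. -/
structure Abutment (hγ : ∀ x, x ∈ Subgroup.zpowers γ) where
  /-- `x ↦ b⁻ᵏ [x]`, from cocycles of degree `m = n + 2 k` to `Ĥ^n(G; M)` -/
  frac (n m : ℤ) (k : ℕ) (hm : m = n + 2 * k) :
    (serre γ N M).cocycles m →ₗ[R] tateCohomology M n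
  frac_b (n m m' : ℤ) (k j : ℕ) (hm : m = n + 2 * k) (hm' : m' = n + 2 * ((k + j : ℕ) : ℤ))
    (h : m' = m + 2 * j) (x : (serre γ N M).cocycles m) (x' : (serre γ N M).cocycles m')
    (hx : x'.1 = b γ N M j m m' h x.1) : frac n m' (k + j) hm' x' = frac n m k hm x
  exists_frac (n : ℤ) (y : tateCohomology M n) :
    ∃ (k : ℕ) (x : (serre γ N M).cocycles (n + 2 * k)), frac n _ k rfl x = y
  frac_eq_zero_iff (n m : ℤ) (k : ℕ) (hm : m = n + 2 * k) (x : (serre γ N M).cocycles m) :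
    frac n m k hm x = 0 ↔ ∃ (j : ℕ) (w : (serre γ N M).K.X (m + 2 * j - 1)),
      ((serre γ N M).K.d (m + 2 * j - 1) (m + 2 * j)).hom w = b γ N M j m (m + 2 * j) rfl x.1
  periodicity_frac (n m : ℤ) (k : ℕ) (hm : m = n + 2 * ((k + 1 : ℕ) : ℤ))
    (hm' : m = n + 1 + 1 + 2 * k) (x : (serre γ N M).cocycles m) :
    periodicity M γ hγ n (frac n m (k + 1) hm x) = frac (n + 1 + 1) m k hm' x

variable {γ N M}

/-- The filtration of `Ĥ^n(G; M)` obtained from the Serre filtration by inverting `b`: its `p`-th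
step consists of the classes `b⁻ᵏ [x]` with `x` a cocycle of filtration `≥ p`. -/
def Abutment.fil {hγ : ∀ x, x ∈ Subgroup.zpowers γ} (A : Abutment γ N M hγ) (p n : ℤ) :
    Submodule R (tateCohomology M n) :=
  ⨆ k : ℕ, (((serre γ N M).F p (n + 2 * k)).comap
    ((serre γ N M).cocycles (n + 2 * k)).subtype).map (A.frac n (n + 2 * k) k rfl)

/-- Convergence of `E` to `Ĥ^*(G; M)`: the filtration of every `Ĥ^n(G; M)` is finite, `E`
degenerates at some page, and from that page on the entry in bidegree `(p, q)` is the
graded piece `F^p Ĥ^{p+q} / F^{p+1} Ĥ^{p+q}`, the class of `b⁻ᵏ [x]` being sent to the class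
`b⁻ᵏ [x]` of the page. -/
structure Converges {hγ : ∀ x, x ∈ Subgroup.zpowers γ}
    {E : E₂CohomologicalSpectralSequence (ModuleCat.{u} R)}
    (L : Localization γ N M E) (A : Abutment γ N M hγ) : Prop where
  fil_eq_top : ∀ n, ∃ p, A.fil p n = ⊤
  fil_eq_bot : ∀ n, ∃ p, A.fil p n = ⊥
  degenerates : ∃ s, ∀ (r : ℤ) (hr : 2 ≤ r), s ≤ r →
    (∀ i j, (E.page r hr).d i j = 0) ∧
    ∀ p q : ℤ, ∃ ε : A.fil p (p + q) →ₗ[R] (E.page r hr).X (p, q),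
      Function.Surjective ε ∧
      LinearMap.ker ε = (A.fil (p + 1) (p + q)).submoduleOf (A.fil p (p + q)) ∧
      ∀ (n : ℤ) (k : ℕ) (hn : n = p + q + 2 * k) (x : (serre γ N M).cocycles n)
        (z : (serre γ N M).Z r p n) (y : A.fil p (p + q)),
        z.1 = x.1 → y.1 = A.frac (p + q) n k hn x →
        ε y = L.frac r hr p q n k hn ((serre γ N M).cls r p n z)

end Localization

end SerreTate

/-! Inverting `b` is realised on cochains. Let `periodic` be the complex with `Inner N M` in every
bidegree `(p, q)`, `p ≥ 0`, `q` any integer, totalised by direct sums. The Serre complex is its part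
with `q ≥ 0`, and `b` is the identity of `Inner N M` in a shifted degree. A finitely supported
cochain lies in the Serre part after multiplication by a large power of `b`. Hence the cocycles,
boundaries and filtration pieces of `periodic` are the colimits of those of `serre`, and the
spectral sequence of `periodic` is the localised one (`localization`).

For `E_2`, the columns compute Tate cohomology of `N`. This is Shapiro's lemma, done by hand in
degrees `0` and `-1` (`exists_colTateEquiv_zero`, `exists_colTateEquiv_neg_one`). In all other
degrees the isomorphism is defined by transport along the two periodicities, so its compatibility
with periodicity holds by construction (`exists_colTateEquiv`). The first differential induces on
column cohomology the differential of the standard periodic complex of the cyclic group `G ⧸ N`,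
which gives `secondPageEquiv`.

For the abutment, the rows are the same double complex seen from the other side. `Inner N M` is an
induced `G ⧸ N`-module, so the rows are exact except at `p = 0`, where the kernel is the copy `iota`
of `M`. Since cochains have finite support, a cocycle can be pushed down to column `0`, and the
total cohomology is that of the periodic complex of `G` with coefficients in `M`, that is, Tate
cohomology of `G` (`exists_totEquiv`).

Convergence rests on the operator `shift`, `K^{p,q} → K^{p+2,q-2}`, which is the outer periodicity
class times the inverse of `b`. It commutes with the total differential and on total cohomology it
acts as the norm of `N` (`exists_D_eq_shift_sub`). Applied twice, this norm acts as multiplication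
by `|N|² = 9 = |G|`, which kills Tate cohomology of `G` (`normN_normN_mem_range`). So the square of
`shift` is zero on cohomology. A cocycle of filtration at least `4` is a double shift of a cocycle,
hence a coboundary, and shifting primitives shows that a cocycle of filtration `p ≥ 4` has a
primitive of filtration at least `p - 5` (`exists_primitive_of_four_le`). This uniform bound makes
the filtration finite, makes all late differentials vanish and identifies the late pages with the
graded pieces. -/

/-! ### Homology classes in complexes of modules -/

namespace HomologicalComplex

variable {R : Type u} [CommRing R] {ι : Type*} {c : ComplexShape ι}
  (K : HomologicalComplex (ModuleCat.{u} R) c)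

/-- The cycle given by an element killed by the differential. -/
def cycleOf (i j : ι) (hj : c.next i = j) :
    LinearMap.ker (K.d i j).hom →ₗ[R] K.cycles i :=
  (K.liftCycles (ModuleCat.ofHom (LinearMap.ker (K.d i j).hom).subtype) j hj
    (by ext x; exact x.2)).hom

/-- The homology class of an element killed by the differential. -/
def classOf (i j : ι) (hj : c.next i = j) :
    LinearMap.ker (K.d i j).hom →ₗ[R] K.homology i :=
  (K.homologyπ i).hom ∘ₗ K.cycleOf i j hj

lemma iCycles_cycleOf (i j : ι) (hj : c.next i = j) (x : LinearMap.ker (K.d i j).hom) :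
    (K.iCycles i).hom (K.cycleOf i j hj x) = x.1 := by
  have := K.liftCycles_i (ModuleCat.ofHom (LinearMap.ker (K.d i j).hom).subtype) j hj
    (by ext x; exact x.2)
  exact LinearMap.congr_fun (congrArg ModuleCat.Hom.hom this) x

lemma iCycles_injective (i : ι) : Function.Injective (K.iCycles i).hom :=
  (ModuleCat.mono_iff_injective _).1 inferInstance

lemma d_iCycles (i j : ι) (z : K.cycles i) : (K.d i j).hom ((K.iCycles i).hom z) = 0 :=
  LinearMap.congr_fun (congrArg ModuleCat.Hom.hom (K.iCycles_d i j)) z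

lemma classOf_iCycles (i j : ι) (hj : c.next i = j) (z : K.cycles i) :
    K.classOf i j hj ⟨(K.iCycles i).hom z, K.d_iCycles i j z⟩ = (K.homologyπ i).hom z := by
  refine congrArg (K.homologyπ i).hom (K.iCycles_injective i ?_)
  rw [iCycles_cycleOf]

lemma classOf_surjective (i j : ι) (hj : c.next i = j) :
    Function.Surjective (K.classOf i j hj) := by
  intro y
  obtain ⟨z, rfl⟩ := (ModuleCat.epi_iff_surjective (K.homologyπ i)).1 inferInstance y
  exact ⟨_, K.classOf_iCycles i j hj z⟩

/-- Homology is the cokernel of `toCycles`, and cycles embed in the term of the complex, so a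
vanishing class can be tested on underlying elements. -/
lemma classOf_eq_zero_iff (h i j : ι) (hh : c.prev i = h) (hj : c.next i = j)
    (x : LinearMap.ker (K.d i j).hom) :
    K.classOf i j hj x = 0 ↔ ∃ y : K.X h, (K.d h i).hom y = x.1 := by
  have ex : (ShortComplex.mk _ _ (K.toCycles_comp_homologyπ h i)).Exact :=
    ShortComplex.exact_of_g_is_cokernel _ (K.homologyIsCokernel h i hh)
  rw [ShortComplex.moduleCat_exact_iff] at ex
  have hi : ∀ y : K.X h, (K.iCycles i).hom ((K.toCycles h i).hom y) = (K.d h i).hom y := fun y =>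
    LinearMap.congr_fun (congrArg ModuleCat.Hom.hom (K.toCycles_i h i)) y
  constructor
  · intro hx
    obtain ⟨y, hy⟩ := ex _ hx
    refine ⟨y, ?_⟩
    have hy' : (K.toCycles h i).hom y = K.cycleOf i j hj x := hy
    rw [← hi, hy', iCycles_cycleOf]
  · rintro ⟨y, hy⟩
    have e : K.cycleOf i j hj x = (K.toCycles h i).hom y :=
      K.iCycles_injective i (by rw [iCycles_cycleOf, hi, hy])
    change (K.homologyπ i).hom (K.cycleOf i j hj x) = 0
    rw [e]
    exact LinearMap.congr_fun (congrArg ModuleCat.Hom.hom (K.toCycles_comp_homologyπ h i)) y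

lemma homologyMap_classOf {L : HomologicalComplex (ModuleCat.{u} R) c} (f : K ⟶ L) (i j : ι)
    (hj : c.next i = j) (x : LinearMap.ker (K.d i j).hom) (y : LinearMap.ker (L.d i j).hom)
    (hxy : (f.f i).hom x.1 = y.1) :
    (homologyMap f i).hom (K.classOf i j hj x) = L.classOf i j hj y := by
  have h1 : (homologyMap f i).hom ((K.homologyπ i).hom (K.cycleOf i j hj x)) =
      (L.homologyπ i).hom ((cyclesMap f i).hom (K.cycleOf i j hj x)) :=
    LinearMap.congr_fun (congrArg ModuleCat.Hom.hom (homologyπ_naturality f i)) _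
  refine h1.trans (congrArg _ (L.iCycles_injective i ?_))
  have h2 : (L.iCycles i).hom ((cyclesMap f i).hom (K.cycleOf i j hj x)) =
      (f.f i).hom ((K.iCycles i).hom (K.cycleOf i j hj x)) :=
    LinearMap.congr_fun (congrArg ModuleCat.Hom.hom (cyclesMap_i f i)) _
  rw [h2, iCycles_cycleOf, iCycles_cycleOf, hxy]

end HomologicalComplex

/-! ### Recursion over the integers -/

/-- Upward the recursion applies `up`, downward its inverse, which is why bijections rather than
maps are required. -/
lemma Int.exists_section_succ {P : ℤ → Type*} (x₀ : P 0) (up : ∀ n, P n ≃ P (n + 1)) :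
    ∃ f : ∀ n, P n, f 0 = x₀ ∧ ∀ n, f (n + 1) = up n (f n) := by
  let fpos : ∀ n : ℕ, P (Int.ofNat n) := fun n => Nat.rec x₀ (fun n x => up (Int.ofNat n) x) n
  let fneg : ∀ n : ℕ, P (Int.negSucc n) := fun n =>
    Nat.rec ((up (Int.negSucc 0)).symm x₀) (fun n x => (up (Int.negSucc (n + 1))).symm x) n
  refine ⟨fun n => match n with
    | Int.ofNat n => fpos n
    | Int.negSucc n => fneg n, rfl, fun n => ?_⟩
  match n with
  | Int.ofNat n => rfl
  | Int.negSucc 0 => exact ((up (Int.negSucc 0)).apply_symm_apply x₀).symm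
  | Int.negSucc (n + 1) => exact ((up (Int.negSucc (n + 1))).apply_symm_apply (fneg n)).symm

/-- A family indexed by the integers, `2`-periodic up to given bijections, has a section compatible
with the bijections as soon as it is inhabited at two consecutive integers. -/
lemma Int.exists_section_two {P : ℤ → Type*} (n₀ : ℤ) (x₀ : P n₀) (x₁ : P (n₀ + 1))
    (up : ∀ n, P n ≃ P (n + 1 + 1)) :
    ∃ f : ∀ n, P n, ∀ n, f (n + 1 + 1) = up n (f n) := by
  -- Pairs of consecutive values turn the two-step recursion into the one-step recursion `(x, y) ↦
  -- (y, up x)`; the shift by `n₀` moves the starting point to `0`, and the cast only reassociates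
  -- indices.
  let up' : ∀ n : ℤ, (P (n + n₀) × P (n + n₀ + 1)) ≃ (P (n + 1 + n₀) × P (n + 1 + n₀ + 1)) :=
    fun n => (Equiv.prodComm _ _).trans (((Equiv.refl _).prodCongr (up (n + n₀))).trans
      (Equiv.cast (by rw [add_right_comm n n₀ 1])))
  obtain ⟨F, -, hF⟩ := Int.exists_section_succ
    (P := fun n => P (n + n₀) × P (n + n₀ + 1))
    (cast (by rw [zero_add]) (x₀, x₁)) up'
  -- A cast between these product types acts componentwise up to heterogeneous equality.
  have key : ∀ m n : ℤ, ∀ h : m = n + 1, ∀ a : P (n + n₀ + 1) × P (n + n₀ + 1 + 1),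
      ∀ e : (P (n + n₀ + 1) × P (n + n₀ + 1 + 1)) = (P (m + n₀) × P (m + n₀ + 1)),
      HEq (cast e a).1 a.1 ∧ HEq (cast e a).2 a.2 := by
    intro m n h a e
    have h' : n + n₀ + 1 = m + n₀ := by omega
    revert a e
    rw [h']
    intro a e
    exact ⟨HEq.rfl, HEq.rfl⟩
  have h1 : ∀ n, HEq (F (n + 1)).1 (F n).2 := fun n => by
    rw [hF]
    exact (key _ n rfl ((F n).2, up (n + n₀) (F n).1) _).1
  have h2 : ∀ n, HEq (F (n + 1)).2 (up (n + n₀) (F n).1) := fun n => by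
    rw [hF]
    exact (key _ n rfl ((F n).2, up (n + n₀) (F n).1) _).2
  have h3 : ∀ n, HEq (F (n + 1 + 1)).1 (up (n + n₀) (F n).1) := fun n => (h1 _).trans (h2 n)
  refine ⟨fun n => cast (by rw [sub_add_cancel]) (F (n - n₀)).1, fun n => ?_⟩
  apply eq_of_heq
  refine (cast_heq _ _).trans ?_
  have h4 : n + 1 + 1 - n₀ = n - n₀ + 1 + 1 := by ring
  rw [h4]
  refine (h3 _).trans ?_
  have h5 : ∀ (k m : ℤ) (h : k = m) (a : P k) (b : P m), HEq a b → HEq (up k a) (up m b) := by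
    rintro k m rfl a b hab
    rw [eq_of_heq hab]
  exact h5 _ _ (by ring) _ _ (cast_heq _ _).symm

/-! ### The spectral sequence of a filtered complex -/

namespace FilteredComplex

variable {R : Type u} [CommRing R] (𝒦 : FilteredComplex R)

lemma d_d (i j k : ℤ) (x : 𝒦.K.X i) : (𝒦.K.d j k).hom ((𝒦.K.d i j).hom x) = 0 :=
  LinearMap.congr_fun (congrArg ModuleCat.Hom.hom (𝒦.K.d_comp_d i j k)) x

lemma Z_mono {r r' p p' n : ℤ} (hp : p ≤ p') (hr : p + r ≤ p' + r') :
    𝒦.Z r' p' n ≤ 𝒦.Z r p n := fun _ hx =>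
  ⟨𝒦.anti _ _ _ hp hx.1, 𝒦.anti _ _ _ hr hx.2⟩

lemma mem_B {r p n : ℤ} {x : 𝒦.K.X n} :
    x ∈ 𝒦.B r p n ↔ ∃ y ∈ 𝒦.Z (r - 1) (p + 1) n, ∃ w ∈ 𝒦.Z (r - 1) (p - r + 1) (n - 1),
      x = y + (𝒦.K.d (n - 1) n).hom w := by
  constructor
  · intro hx
    obtain ⟨y, hy, v, hv, rfl⟩ := Submodule.mem_sup.1 hx
    have h : (⨆ i : ℤ, (𝒦.Z (r - 1) (p - r + 1) i).map (𝒦.K.d i n).hom) ≤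
        (𝒦.Z (r - 1) (p - r + 1) (n - 1)).map (𝒦.K.d (n - 1) n).hom := by
      refine iSup_le fun i => ?_
      by_cases hi : i + 1 = n
      · obtain rfl : i = n - 1 := by omega
        exact le_rfl
      · rintro _ ⟨w, -, rfl⟩
        rw [𝒦.K.shape i n hi]
        exact zero_mem _
    obtain ⟨w, hw, rfl⟩ := h hv
    exact ⟨y, hy, w, hw, rfl⟩
  · rintro ⟨y, hy, w, hw, rfl⟩
    exact add_mem (Submodule.mem_sup_left hy)
      (Submodule.mem_sup_right (Submodule.mem_iSup_of_mem (n - 1) ⟨w, hw, rfl⟩))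

lemma cls_surjective (r p n : ℤ) : Function.Surjective (𝒦.cls r p n) :=
  Submodule.mkQ_surjective _

lemma cls_eq_zero_iff {r p n : ℤ} (x : 𝒦.Z r p n) : 𝒦.cls r p n x = 0 ↔ x.1 ∈ 𝒦.B r p n :=
  (Submodule.Quotient.mk_eq_zero _).trans Iff.rfl

lemma cls_eq_cls_iff {r p n : ℤ} (x y : 𝒦.Z r p n) :
    𝒦.cls r p n x = 𝒦.cls r p n y ↔ x.1 - y.1 ∈ 𝒦.B r p n := by
  rw [← sub_eq_zero, ← map_sub, cls_eq_zero_iff]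
  rfl

lemma pageD_cls (r p n p' n' : ℤ) (hp : p' = p + r) (hn : n' = n + 1) (x : 𝒦.Z r p n)
    (y : 𝒦.Z r p' n') (hxy : (𝒦.K.d n n').hom x.1 = y.1) :
    𝒦.pageD r p n p' n' hp hn (𝒦.cls r p n x) = 𝒦.cls r p' n' y :=
  congrArg (𝒦.cls r p' n') (Subtype.ext hxy : 𝒦.dZ r p n p' n' hp hn x = y)

lemma pageD_pageD (r p n p' n' p'' n'' : ℤ) (hp : p' = p + r) (hn : n' = n + 1)
    (hp' : p'' = p' + r) (hn' : n'' = n' + 1) :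
    𝒦.pageD r p' n' p'' n'' hp' hn' ∘ₗ 𝒦.pageD r p n p' n' hp hn = 0 := by
  ext x
  have e : 𝒦.pageD r p' n' p'' n'' hp' hn' (𝒦.pageD r p n p' n' hp hn (𝒦.cls r p n x)) =
      𝒦.cls r p'' n'' 0 := by
    rw [𝒦.pageD_cls r p n p' n' hp hn x (𝒦.dZ r p n p' n' hp hn x) rfl]
    exact 𝒦.pageD_cls r p' n' p'' n'' hp' hn' _ 0 (𝒦.d_d _ _ _ _)
  rw [map_zero] at e
  exact e

lemma pageRel {r : ℤ} {i j : ℤ × ℤ} (h : (ComplexShape.up' (⟨r, 1 - r⟩ : ℤ × ℤ)).Rel i j) :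
    j.1 = i.1 + r ∧ j.1 + j.2 = i.1 + i.2 + 1 := by
  obtain rfl : i + (r, 1 - r) = j := h
  exact ⟨rfl, by simp only [Prod.fst_add, Prod.snd_add]; ring⟩

/-- The `r`-th page, as a complex. -/
def pageComplex (r : ℤ) :
    HomologicalComplex (ModuleCat.{u} R) (ComplexShape.up' (⟨r, 1 - r⟩ : ℤ × ℤ)) where
  X i := ModuleCat.of R (𝒦.Page r i.1 (i.1 + i.2))
  d i j := if h : (ComplexShape.up' (⟨r, 1 - r⟩ : ℤ × ℤ)).Rel i j then
      ModuleCat.ofHom (𝒦.pageD r i.1 (i.1 + i.2) j.1 (j.1 + j.2) (pageRel h).1 (pageRel h).2)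
    else 0
  shape i j h := dif_neg h
  d_comp_d' i j k hij hjk := by
    rw [dif_pos hij, dif_pos hjk, ← ModuleCat.ofHom_comp, pageD_pageD]
    rfl

lemma pageComplex_d (r : ℤ) (i j : ℤ × ℤ)
    (h : (ComplexShape.up' (⟨r, 1 - r⟩ : ℤ × ℤ)).Rel i j) :
    ((𝒦.pageComplex r).d i j).hom =
      𝒦.pageD r i.1 (i.1 + i.2) j.1 (j.1 + j.2) (pageRel h).1 (pageRel h).2 := by
  have : (𝒦.pageComplex r).d i j = _ := dif_pos h
  rw [this]
  rfl

/-- For `x` in `Z (r + 1)` the element `d x` has filtration one more than needed, so it lies in the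
first summand `Z_{r-1}^{p+r+1}` of `B_r^{p+r}`. -/
lemma cls_mem_ker_pageD (r p n p' n' : ℤ) (hp : p' = p + r) (hn : n' = n + 1) (x : 𝒦.Z r p n)
    (hx : x.1 ∈ 𝒦.Z (r + 1) p n) : 𝒦.pageD r p n p' n' hp hn (𝒦.cls r p n x) = 0 := by
  subst hp hn
  rw [𝒦.pageD_cls r p n _ _ rfl rfl x (𝒦.dZ r p n _ _ rfl rfl x) rfl, cls_eq_zero_iff, mem_B]
  refine ⟨(𝒦.K.d n (n + 1)).hom x.1, ⟨?_, ?_⟩, 0, zero_mem _, ?_⟩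
  · rw [add_assoc]
    exact hx.2
  · refine Submodule.mem_comap.2 ?_
    rw [d_d]
    exact zero_mem _
  · rw [map_zero, add_zero]
    rfl

/-- Every class killed by `d_r` is represented by an element of `Z (r + 1)`. -/
lemma exists_of_pageD_eq_zero (r p n p' n' : ℤ) (hp : p' = p + r) (hn : n' = n + 1)
    (x : 𝒦.Page r p n) (hx : 𝒦.pageD r p n p' n' hp hn x = 0) :
    ∃ z : 𝒦.Z r p n, z.1 ∈ 𝒦.Z (r + 1) p n ∧ 𝒦.cls r p n z = x := by
  subst hp hn
  obtain ⟨z, rfl⟩ := 𝒦.cls_surjective r p n x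
  rw [𝒦.pageD_cls r p n _ _ rfl rfl z (𝒦.dZ r p n _ _ rfl rfl z) rfl, cls_eq_zero_iff] at hx
  obtain ⟨y, hy, w, hw, e⟩ := 𝒦.mem_B.1 hx
  have e' : (𝒦.K.d n (n + 1)).hom z.1 = y + (𝒦.K.d (n + 1 - 1) (n + 1)).hom w := e
  have hw' : ∃ w' ∈ 𝒦.Z (r - 1) (p + 1) n, (𝒦.K.d n (n + 1)).hom z.1 =
      y + (𝒦.K.d n (n + 1)).hom w' := by
    have h1 : n + 1 - 1 = n := by ring
    have h2 : p + r - r + 1 = p + 1 := by ring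
    rw [h2] at hw
    clear e
    revert w
    rw [h1]
    intro w hw e'
    exact ⟨w, hw, e'⟩
  obtain ⟨w', hw', e''⟩ := hw'
  have hwB : w' ∈ 𝒦.B r p n := Submodule.mem_sup_left hw'
  have hwZ : w' ∈ 𝒦.Z r p n := 𝒦.Z_mono (by omega) (by omega) hw'
  -- Subtracting `w'` removes the exact part of `d z` and leaves `y`, of filtration `p + r + 1`; the
  -- class is unchanged because `w'` lies in `B r p n`.
  refine ⟨z - ⟨w', hwZ⟩, ⟨(z - ⟨w', hwZ⟩).2.1, ?_⟩, ?_⟩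
  · change (𝒦.K.d n (n + 1)).hom (z.1 - w') ∈ 𝒦.F (p + (r + 1)) (n + 1)
    rw [map_sub, e'', add_sub_cancel_right, ← add_assoc]
    exact hy.1
  · rw [cls_eq_cls_iff]
    change z.1 - w' - z.1 ∈ _
    rw [sub_sub_cancel_left]
    exact neg_mem hwB

/-- An element of `Z (r + 1)` represents a class in the image of `d_r` if and only if it lies in
`B (r + 1)`. -/
lemma cls_mem_range_pageD_iff (r p n p' n' : ℤ) (hp : p = p' + r) (hn : n = n' + 1)
    (x : 𝒦.Z r p n) (hx : x.1 ∈ 𝒦.Z (r + 1) p n) :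
    (∃ y, 𝒦.pageD r p' n' p n hp hn y = 𝒦.cls r p n x) ↔ x.1 ∈ 𝒦.B (r + 1) p n := by
  obtain rfl : n' = n - 1 := by omega
  obtain rfl : p' = p - r := by omega
  have e1 : r + 1 - 1 = r := by ring
  have e2 : p - (r + 1) + 1 = p - r := by ring
  constructor
  · rintro ⟨y, hy⟩
    obtain ⟨w, rfl⟩ := 𝒦.cls_surjective r _ _ y
    rw [𝒦.pageD_cls r _ _ _ _ hp hn w (𝒦.dZ r _ _ _ _ hp hn w) rfl, eq_comm,
      cls_eq_cls_iff] at hy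
    obtain ⟨y, hy, v, hv, e⟩ := 𝒦.mem_B.1 hy
    have e' : x.1 = y + (𝒦.K.d (n - 1) n).hom (v + w.1) := by
      rw [map_add, ← add_assoc]
      exact eq_add_of_sub_eq e
    rw [mem_B, e1, e2]
    -- A priori `y` is only in `Z_{r-1}^{p+1}`; it lies in `Z_r^{p+1}` because `d y = d x` and `x`
    -- is in `Z (r + 1)`.
    refine ⟨y, ⟨hy.1, ?_⟩, v + w.1, add_mem (𝒦.Z_mono (by omega) (by omega) hv) w.2, e'⟩
    have hd : (𝒦.K.d n (n + 1)).hom x.1 = (𝒦.K.d n (n + 1)).hom y := by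
      rw [e', map_add, d_d, add_zero]
    refine Submodule.mem_comap.2 ?_
    rw [← hd, show p + 1 + r = p + (r + 1) by ring]
    exact hx.2
  · intro h
    rw [mem_B, e1, e2] at h
    obtain ⟨y, hy, w, hw, e⟩ := h
    refine ⟨𝒦.cls r _ _ ⟨w, hw⟩, ?_⟩
    rw [𝒦.pageD_cls r _ _ _ _ hp hn ⟨w, hw⟩ (𝒦.dZ r _ _ _ _ hp hn ⟨w, hw⟩) rfl, eq_comm,
      cls_eq_cls_iff]
    change x.1 - (𝒦.K.d (n - 1) n).hom w ∈ _
    rw [e, add_sub_cancel_right]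
    exact Submodule.mem_sup_left (𝒦.Z_mono (by omega) (by omega) hy)

lemma pageRel_next (r : ℤ) (i : ℤ × ℤ) :
    (ComplexShape.up' (⟨r, 1 - r⟩ : ℤ × ℤ)).Rel i (i.1 + r, i.2 + (1 - r)) := rfl

lemma pageRel_prev (r : ℤ) (i : ℤ × ℤ) :
    (ComplexShape.up' (⟨r, 1 - r⟩ : ℤ × ℤ)).Rel (i.1 - r, i.2 - (1 - r)) i := by
  change _ + _ = _
  ext <;> simp

/-- The class in `E_r` of an element of `Z (r + 1)`, as an element of the complex `E_r`. -/
def clsX (r : ℤ) (i : ℤ × ℤ) : 𝒦.Z (r + 1) i.1 (i.1 + i.2) →ₗ[R] (𝒦.pageComplex r).X i :=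
  show 𝒦.Z (r + 1) i.1 (i.1 + i.2) →ₗ[R] 𝒦.Page r i.1 (i.1 + i.2) from
    𝒦.cls r i.1 (i.1 + i.2) ∘ₗ Submodule.inclusion (𝒦.Z_mono le_rfl (by omega))

/-- The homology class on the `r`-th page of an element of `Z (r + 1)`. -/
def toHomology (r : ℤ) (i : ℤ × ℤ) :
    𝒦.Z (r + 1) i.1 (i.1 + i.2) →ₗ[R] (𝒦.pageComplex r).homology i :=
  (𝒦.pageComplex r).classOf i _ (ComplexShape.next_eq' _ (pageRel_next r i)) ∘ₗ
    (𝒦.clsX r i).codRestrict _ fun z => LinearMap.mem_ker.2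
      ((LinearMap.congr_fun (𝒦.pageComplex_d r i _ (pageRel_next r i)) _).trans
        (𝒦.cls_mem_ker_pageD r _ _ _ _ _ _
          (Submodule.inclusion (𝒦.Z_mono le_rfl (by omega)) z) z.2))

lemma toHomology_surjective (r : ℤ) (i : ℤ × ℤ) : Function.Surjective (𝒦.toHomology r i) := by
  intro y
  obtain ⟨⟨x, hx⟩, rfl⟩ := (𝒦.pageComplex r).classOf_surjective i _
    (ComplexShape.next_eq' _ (pageRel_next r i)) y
  have hx' := hx
  rw [LinearMap.mem_ker, 𝒦.pageComplex_d r i _ (pageRel_next r i)] at hx'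
  obtain ⟨z, hz, rfl⟩ := 𝒦.exists_of_pageD_eq_zero r _ _ _ _ _ _ x hx'
  exact ⟨⟨z.1, hz⟩, rfl⟩

lemma ker_toHomology (r : ℤ) (i : ℤ × ℤ) :
    LinearMap.ker (𝒦.toHomology r i) =
      (𝒦.B (r + 1) i.1 (i.1 + i.2)).submoduleOf (𝒦.Z (r + 1) i.1 (i.1 + i.2)) := by
  ext z
  rw [LinearMap.mem_ker]
  refine ((𝒦.pageComplex r).classOf_eq_zero_iff _ i _
    (ComplexShape.prev_eq' _ (pageRel_prev r i)) _ _).trans ?_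
  rw [𝒦.pageComplex_d r _ i (pageRel_prev r i)]
  exact 𝒦.cls_mem_range_pageD_iff r _ _ _ _ _ _ ⟨z.1, _⟩ z.2

/-- The homology of the `r`-th page is the `(r + 1)`-st page. -/
def pageIso (r : ℤ) (i : ℤ × ℤ) :
    (𝒦.pageComplex r).homology i ≅ (𝒦.pageComplex (r + 1)).X i :=
  ((Submodule.quotEquivOfEq _ _ (𝒦.ker_toHomology r i).symm).trans
    ((𝒦.toHomology r i).quotKerEquivOfSurjective
      (𝒦.toHomology_surjective r i))).toModuleIso.symm

lemma pageIso_inv (r : ℤ) (i : ℤ × ℤ) (z : 𝒦.Z (r + 1) i.1 (i.1 + i.2)) :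
    (𝒦.pageIso r i).inv.hom (𝒦.cls (r + 1) _ _ z) = 𝒦.toHomology r i z := rfl

lemma pageIso_homologyπ (r : ℤ) (i : ℤ × ℤ) (z : 𝒦.Z r i.1 (i.1 + i.2))
    (z' : 𝒦.Z (r + 1) i.1 (i.1 + i.2)) (hz : z.1 = z'.1) (c : (𝒦.pageComplex r).cycles i)
    (hc : ((𝒦.pageComplex r).iCycles i).hom c = 𝒦.cls r _ _ z) :
    (𝒦.pageIso r i).hom.hom (((𝒦.pageComplex r).homologyπ i).hom c) = 𝒦.cls (r + 1) _ _ z' := by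
  have e : ((𝒦.pageComplex r).homologyπ i).hom c = 𝒦.toHomology r i z' := by
    rw [← (𝒦.pageComplex r).classOf_iCycles i _ (ComplexShape.next_eq' _ (pageRel_next r i)) c]
    refine congrArg _ (Subtype.ext ?_)
    refine hc.trans (congrArg (𝒦.cls r _ _) (Subtype.ext hz))
  rw [e, ← pageIso_inv]
  exact LinearMap.congr_fun (congrArg ModuleCat.Hom.hom (𝒦.pageIso r i).inv_hom_id) _

/-- The spectral sequence of a filtered complex. -/
def spectralSequence : E₂CohomologicalSpectralSequence (ModuleCat.{u} R) where
  page r _ := 𝒦.pageComplex r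
  -- The index `r'` equals `r + 1` only propositionally; `eqToIso` becomes the identity once `r'` is
  -- `r + 1`.
  iso r r' i hrr' _ := 𝒦.pageIso r i ≪≫ eqToIso (by subst hrr'; rfl)

lemma spectralSequence_iso (r : ℤ) (hr : 2 ≤ r) (i : ℤ × ℤ) :
    (𝒦.spectralSequence).iso r (r + 1) i rfl hr = 𝒦.pageIso r i :=
  Iso.ext (Category.comp_id _)

end FilteredComplex

namespace SerreTate

/-! ### The double complex with the inner periodicity class inverted -/

section Supports

variable {R G : Type u} [CommRing R] [CommGroup G] (N : Subgroup G) (M : Rep.{u} R G)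

lemma filX_anti {p p' : ℤ} (h : p ≤ p') : filX N M p' ≤ filX N M p :=
  fun _ hx i hi => hx i (by omega)

lemma filX_eq_top {p : ℤ} (h : p ≤ 0) : filX N M p = ⊤ :=
  eq_top_iff.2 fun _ _ i hi => absurd hi (by omega)

/-- Every finitely supported cochain lies in `totX` in large enough degrees. -/
lemma exists_forall_mem_totX (x : ℕ →₀ Inner N M) : ∃ m : ℤ, ∀ n, m ≤ n → x ∈ totX N M n := by
  refine ⟨(x.support.sup id : ℕ), fun n hn p hp => ?_⟩
  by_contra h
  have : p ≤ x.support.sup id := Finset.le_sup (f := id) (Finsupp.mem_support_iff.2 h)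
  omega

end Supports

section Periodic

variable {R G : Type u} [CommRing R] [CommGroup G] [Fintype G]
  (γ : G) (N : Subgroup G) (M : Rep.{u} R G)

/-- The total complex of the double complex which is `Hom_{R[N]}(R[G], M)` in all bidegrees
`(p, q)` with `0 ≤ p`. -/
def periodicTot : CochainComplex (ModuleCat.{u} R) ℤ where
  X _ := ModuleCat.of R (ℕ →₀ Inner N M)
  d n n' := if n + 1 = n' then ModuleCat.ofHom (D γ N M n) else 0
  shape n n' h := if_neg h
  d_comp_d' i j k hij hjk := by
    have hij' : i + 1 = j := hij
    have hjk' : j + 1 = k := hjk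
    subst hij' hjk'
    rw [if_pos rfl, if_pos rfl, ← ModuleCat.ofHom_comp, D_D]
    rfl

lemma periodicTot_d (n n' : ℤ) (h : n + 1 = n') :
    ((periodicTot γ N M).d n n').hom = D γ N M n := by
  have e : (periodicTot γ N M).d n n' = ModuleCat.ofHom (D γ N M n) := if_pos h
  rw [e]
  rfl

/-- The total complex `periodicTot`, filtered by the horizontal degree. -/
def periodic : FilteredComplex R where
  K := periodicTot γ N M
  F p _ := filX N M p
  anti p p' n h x hx i hi := hx i (by omega)
  d_mem p n n' x hx := by
    by_cases h : n + 1 = n'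
    · rw [periodicTot_d γ N M n n' h]
      exact D_mem_filX γ N M n p x hx
    · rw [(periodicTot γ N M).shape n n' h]
      exact zero_mem _

lemma mem_periodic_Z {r p n : ℤ} {x : ℕ →₀ Inner N M} :
    x ∈ (show Submodule R (ℕ →₀ Inner N M) from (periodic γ N M).Z r p n) ↔
      x ∈ filX N M p ∧ D γ N M n x ∈ filX N M (p + r) := by
  rw [← periodicTot_d γ N M n (n + 1) rfl]
  rfl

lemma mem_periodic_B {r p n : ℤ} {x : ℕ →₀ Inner N M} :
    x ∈ (show Submodule R (ℕ →₀ Inner N M) from (periodic γ N M).B r p n) ↔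
      ∃ y w : ℕ →₀ Inner N M, (y ∈ filX N M (p + 1) ∧ D γ N M n y ∈ filX N M (p + r)) ∧
        (w ∈ filX N M (p - r + 1) ∧ D γ N M (n - 1) w ∈ filX N M p) ∧
        x = y + D γ N M (n - 1) w := by
  have e1 : p + 1 + (r - 1) = p + r := by ring
  have e2 : p - r + 1 + (r - 1) = p := by ring
  refine (periodic γ N M).mem_B.trans ⟨?_, ?_⟩
  · rintro ⟨y, hy, w, hw, e⟩
    have hy' := (mem_periodic_Z γ N M).1 hy
    have hw' := (mem_periodic_Z γ N M).1 hw
    rw [e1] at hy'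
    rw [e2] at hw'
    refine ⟨y, w, hy', hw', e.trans ?_⟩
    rw [← periodicTot_d γ N M (n - 1) n (by ring)]
    rfl
  · rintro ⟨y, w, hy, hw, rfl⟩
    rw [← e1] at hy
    nth_rw 2 [← e2] at hw
    refine ⟨y, (mem_periodic_Z γ N M).2 hy, w, (mem_periodic_Z γ N M).2 hw, ?_⟩
    rw [← periodicTot_d γ N M (n - 1) n (by ring)]
    rfl

lemma mem_serre_Z {r p n : ℤ} (x : (serre γ N M).K.X n) :
    x ∈ (serre γ N M).Z r p n ↔ (show totX N M n from x).1 ∈ filX N M p ∧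
      D γ N M n (show totX N M n from x).1 ∈ filX N M (p + r) := by
  have e := tot_d_apply γ N M n (n + 1) rfl x
  constructor
  · intro h
    refine ⟨h.1, ?_⟩
    rw [← e]
    exact h.2
  · intro h
    refine ⟨h.1, ?_⟩
    have h2 := h.2
    rw [← e] at h2
    exact h2

lemma serre_d_eq_iff {n n' : ℤ} (h : n + 1 = n') (x : (serre γ N M).K.X n)
    (y : (serre γ N M).K.X n') : ((serre γ N M).K.d n n').hom x = y ↔
      D γ N M n (show totX N M n from x).1 = (show totX N M n' from y).1 := by
  have e := tot_d_apply γ N M n n' h x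
  constructor
  · intro h
    rw [← e]
    exact congrArg (fun z : totX N M n' => z.1) h
  · intro h
    exact Subtype.ext (e.trans h)

lemma D_of_eq {n m : ℤ} {k : ℕ} (h : n = m + 2 * k) : D γ N M n = D γ N M m := by
  rw [h, D_periodic]

/-- The inclusion of `Z_r^p` of the Serre filtration into that of the periodic complex. -/
def inclZ (r p m n : ℤ) (k : ℕ) (hn : n = m + 2 * k) :
    (serre γ N M).Z r p n →ₗ[R] (periodic γ N M).Z r p m :=
  LinearMap.restrict (p := (serre γ N M).Z r p n) (q := (periodic γ N M).Z r p m)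
    (show totX N M n →ₗ[R] (ℕ →₀ Inner N M) from (totX N M n).subtype) fun x hx => by
    have h := (mem_serre_Z γ N M x).1 hx
    rw [D_of_eq γ N M hn] at h
    exact (mem_periodic_Z γ N M).2 h

/-- Compared with `mem_periodic_B` only the bounds on the supports of `y` and `w` are new. They are
the whole difference between the two complexes, and a high power of `b` makes them harmless. -/
lemma mem_serre_B {r p n : ℤ} {x : (serre γ N M).K.X n} :
    x ∈ (serre γ N M).B r p n ↔
      ∃ y w : ℕ →₀ Inner N M, (y ∈ filX N M (p + 1) ∧ D γ N M n y ∈ filX N M (p + r)) ∧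
        (w ∈ filX N M (p - r + 1) ∧ D γ N M (n - 1) w ∈ filX N M p) ∧
        (show totX N M n from x).1 = y + D γ N M (n - 1) w ∧
        y ∈ totX N M n ∧ w ∈ totX N M (n - 1) := by
  have e1 : p + 1 + (r - 1) = p + r := by ring
  have e2 : p - r + 1 + (r - 1) = p := by ring
  refine (serre γ N M).mem_B.trans ⟨?_, ?_⟩
  · rintro ⟨y, hy, w, hw, e⟩
    have hy' := (mem_serre_Z γ N M y).1 hy
    have hw' := (mem_serre_Z γ N M w).1 hw
    rw [e1] at hy'
    rw [e2] at hw'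
    refine ⟨_, _, hy', hw', ?_, Subtype.prop (show totX N M n from y),
      Subtype.prop (show totX N M (n - 1) from w)⟩
    have e3 := tot_d_apply γ N M (n - 1) n (by ring) w
    rw [← e3, e]
    rfl
  · rintro ⟨y, w, hy, hw, e, hy', hw'⟩
    rw [← e1] at hy
    nth_rw 2 [← e2] at hw
    let y' : totX N M n := ⟨y, hy'⟩
    let w' : totX N M (n - 1) := ⟨w, hw'⟩
    refine ⟨y', (mem_serre_Z γ N M y').2 hy, w', (mem_serre_Z γ N M w').2 hw, ?_⟩
    refine Subtype.ext (e.trans ?_)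
    exact congrArg (y + ·) (tot_d_apply γ N M (n - 1) n (by ring) w').symm

/-- The map from the pages of the Serre spectral sequence to those of the periodic complex. -/
def inclPage (r p m n : ℤ) (k : ℕ) (hn : n = m + 2 * k) :
    (serre γ N M).Page r p n →ₗ[R] (periodic γ N M).Page r p m :=
  Submodule.mapQ _ _ (inclZ γ N M r p m n k hn) <| by
    rintro x hx
    obtain ⟨y, w, hy, hw, e, -, -⟩ := (mem_serre_B γ N M).1
      (show x.1 ∈ (serre γ N M).B r p n from hx)
    rw [D_of_eq γ N M hn] at hy
    rw [D_of_eq γ N M (show n - 1 = m - 1 + 2 * k by omega)] at hw e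
    exact (mem_periodic_B γ N M).2 ⟨y, w, hy, hw, e⟩

lemma bPage_cls (k : ℕ) (r p n n' : ℤ) (h : n' = n + 2 * k) (x : (serre γ N M).Z r p n) :
    bPage γ N M k r p n n' h ((serre γ N M).cls r p n x) =
      (serre γ N M).cls r p n' (bZ γ N M k r p n n' h x) := rfl

/-- The spectral sequence of the periodic complex is the Serre spectral sequence with the
periodicity class inverted. -/
def localization : Localization γ N M (periodic γ N M).spectralSequence where
  frac r hr p q n k hn := inclPage γ N M r p (p + q) n k hn
  frac_b r hr p q n n' k j hn hn' h x := by
    obtain ⟨x, rfl⟩ := (serre γ N M).cls_surjective r p n x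
    rfl
  exists_frac r hr p q y := by
    obtain ⟨⟨y, hy⟩, rfl⟩ := (periodic γ N M).cls_surjective r p (p + q) y
    have hy' := (mem_periodic_Z γ N M).1 hy
    -- Finite support is used here: the same `y` is a Serre cochain in all large degrees.
    obtain ⟨m, hm⟩ := exists_forall_mem_totX N M y
    let k : ℕ := (m - (p + q)).toNat
    have hk := hm (p + q + 2 * k) (by omega)
    let x : totX N M (p + q + 2 * k) := ⟨y, hk⟩
    have hx : x ∈ (serre γ N M).Z r p (p + q + 2 * k) := by
      refine (mem_serre_Z γ N M x).2 ?_
      rw [D_periodic]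
      exact hy'
    exact ⟨k, (serre γ N M).cls r p _ ⟨x, hx⟩, rfl⟩
  frac_eq_zero r hr p q n k hn x hx := by
    obtain ⟨x, rfl⟩ := (serre γ N M).cls_surjective r p n x
    have hx' := ((periodic γ N M).cls_eq_zero_iff (inclZ γ N M r p (p + q) n k hn x)).1 hx
    obtain ⟨y, w, hy, hw, e⟩ := (mem_periodic_B γ N M).1 hx'
    obtain ⟨m₁, hm₁⟩ := exists_forall_mem_totX N M y
    obtain ⟨m₂, hm₂⟩ := exists_forall_mem_totX N M w
    -- Large enough for `y` to fit in degree `n + 2 * j` and for `w` to fit in degree `n + 2 * j -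
    -- 1`, whence the `m₂ + 1`.
    let j : ℕ := (max (m₁ - n) (m₂ + 1 - n)).toNat
    refine ⟨j, ?_⟩
    rw [bPage_cls, FilteredComplex.cls_eq_zero_iff, mem_serre_B]
    rw [← D_of_eq γ N M hn, ← D_of_eq γ N M (show n + 2 * (j : ℤ) = n + 2 * (j : ℕ) from rfl)]
      at hy
    rw [← D_of_eq γ N M (show n - 1 = p + q - 1 + 2 * k by omega),
      ← D_of_eq γ N M (show n + 2 * (j : ℤ) - 1 = n - 1 + 2 * (j : ℕ) by ring)] at hw e
    exact ⟨y, w, hy, hw, e, hm₁ _ (by omega), hm₂ _ (by omega)⟩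
  frac_d r hr p q n k hn hn' x := by
    obtain ⟨x, rfl⟩ := (serre γ N M).cls_surjective r p n x
    have hrel : (ComplexShape.up' (⟨r, 1 - r⟩ : ℤ × ℤ)).Rel (p, q) (p + r, q + 1 - r) := by
      change (_, _) = _
      ext
      · rfl
      · change q + (1 - r) = q + 1 - r
        ring
    refine (LinearMap.congr_fun ((periodic γ N M).pageComplex_d r (p, q) _ hrel) _).trans ?_
    refine FilteredComplex.pageD_cls (periodic γ N M) r p (p + q) (p + r) _ rfl _
      (inclZ γ N M r p (p + q) n k hn x) (inclZ γ N M r (p + r) (p + r + (q + 1 - r)) (n + 1) k hn'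
        ((serre γ N M).dZ r p n _ _ rfl rfl x)) ?_
    refine (LinearMap.congr_fun (periodicTot_d γ N M (p + q) (p + r + (q + 1 - r)) (by ring))
      _).trans ?_
    rw [← D_of_eq γ N M hn]
    exact (tot_d_apply γ N M n (n + 1) rfl x.1).symm
  frac_iso r hr p q n k hn z z' hz c hc := by
    rw [FilteredComplex.spectralSequence_iso]
    refine (periodic γ N M).pageIso_homologyπ r (p, q) (inclZ γ N M r p (p + q) n k hn z)
      (inclZ γ N M (r + 1) p (p + q) n k hn z') ?_ c hc
    exact congrArg (fun y : totX N M n => y.1) hz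

end Periodic

end SerreTate

/-! ### Tate cohomology of finite cyclic groups in degrees `-1` and `0` -/

namespace TateCohomology

variable {R C : Type u} [CommRing R] [CommGroup C] [Fintype C] (X Y : Rep.{u} R C)

/-- The constant inhomogeneous `0`-cochain. -/
def constCochain : X.V →ₗ[R] (tateComplex X).X 0 :=
  show X.V →ₗ[R] ((Fin 0 → C) → X.V) from LinearMap.pi fun _ => LinearMap.id

/-- The inhomogeneous `0`-chain, in degree `-1` of the Tate complex. -/
def singleChain : X.V →ₗ[R] (tateComplex X).X (-1) :=
  show X.V →ₗ[R] ((Fin 0 → C) →₀ X.V) from Finsupp.lsingle default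

lemma constCochain_surjective : Function.Surjective (constCochain X) := fun f =>
  ⟨(show (Fin 0 → C) → X.V from f) default, funext fun x =>
    congrArg (show (Fin 0 → C) → X.V from f) (Subsingleton.elim _ x)⟩

lemma singleChain_surjective : Function.Surjective (singleChain X) := fun f =>
  ⟨(show (Fin 0 → C) →₀ X.V from f) default, Finsupp.ext fun x => by
    obtain rfl : x = default := Subsingleton.elim _ _
    exact Finsupp.single_eq_same⟩

lemma constCochain_injective : Function.Injective (constCochain X) := fun _ _ h =>
  congrFun h (default : Fin 0 → C)

lemma singleChain_injective : Function.Injective (singleChain X) :=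
  Finsupp.single_injective (default : Fin 0 → C)

lemma d_constCochain_eq_zero_iff (x : X.V) :
    ((tateComplex X).d 0 1).hom (constCochain X x) = 0 ↔ ∀ c, X.ρ c x = x := by
  have h : ∀ g : Fin 1 → C, (show (Fin 1 → C) → X.V from
      ((tateComplex X).d 0 1).hom (constCochain X x)) g = X.ρ (g 0) x - x := by
    intro g
    have e : (tateComplex X).d 0 1 = inhomogeneousCochains.d X 0 :=
      groupCohomology.inhomogeneousCochains.d_def X 0
    rw [e]
    refine (inhomogeneousCochains.d_hom_apply X 0 _ _).trans ?_
    have e2 : ∑ j : Fin (0 + 1), (-1 : R) ^ ((j : ℕ) + 1) •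
        (show (Fin 0 → C) → X.V from constCochain X x) (Fin.contractNth j (· * ·) g) = -x :=
      (Fin.sum_univ_one _).trans ((congrArg (· • x) (pow_one (-1 : R))).trans (neg_one_smul R x))
    exact (congrArg (X.ρ (g 0) x + ·) e2).trans (sub_eq_add_neg _ _).symm
  constructor
  · intro h0 c
    have := h (fun _ => c)
    rw [h0] at this
    exact (sub_eq_zero.1 this.symm)
  · intro hx
    funext g
    exact (h g).trans (sub_eq_zero.2 (hx _))

/-- The Tate complex is glued from chains and cochains by the norm, and this is the gluing map. -/
lemma d_singleChain (x : X.V) :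
    ((tateComplex X).d (-1) 0).hom (singleChain X x) = constCochain X (X.ρ.norm x) := by
  have e := LinearMap.congr_fun (congrArg ModuleCat.Hom.hom (Rep.tateNorm_eq X))
    (Finsupp.single (default : Fin 0 → C) x)
  refine e.trans ?_
  rw [ModuleCat.hom_ofHom, Finsupp.lsum_single]
  rfl

/-- Below degree `0` the Tate complex is the complex of inhomogeneous chains, whose last
differential has as image the span of the elements `c x - x`. -/
lemma singleChain_mem_range_d_iff (x : X.V) :
    (∃ y, ((tateComplex X).d (-2) (-1)).hom y = singleChain X x) ↔
      x ∈ Representation.Coinvariants.ker X.ρ := by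
  rw [← groupHomology.range_d₁₀_eq_coinvariantsKer]
  have h : ∀ y : groupHomology.inhomogeneousChains X |>.X 1,
      ((groupHomology.inhomogeneousChains X).d 1 0).hom y =
        singleChain X ((groupHomology.d₁₀ X).hom ((groupHomology.chainsIso₁ X).hom.hom y)) := by
    intro y
    have e := LinearMap.congr_fun (congrArg ModuleCat.Hom.hom (groupHomology.comp_d₁₀_eq X)) y
    have e' : (groupHomology.d₁₀ X).hom ((groupHomology.chainsIso₁ X).hom.hom y) =
      (groupHomology.chainsIso₀ X).hom.hom
        (((groupHomology.inhomogeneousChains X).d 1 0).hom y) := e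
    rw [e']
    refine Finsupp.ext fun z => ?_
    obtain rfl : z = default := Subsingleton.elim _ _
    exact Finsupp.single_eq_same.symm
  constructor
  · rintro ⟨y, hy⟩
    exact ⟨_, singleChain_injective X ((h y).symm.trans hy)⟩
  · rintro ⟨y, hy⟩
    refine ⟨(groupHomology.chainsIso₁ X).inv.hom y, (h _).trans ?_⟩
    have e := LinearMap.congr_fun
      (congrArg ModuleCat.Hom.hom (groupHomology.chainsIso₁ X).inv_hom_id) y
    have e' : (groupHomology.chainsIso₁ X).hom.hom ((groupHomology.chainsIso₁ X).inv.hom y) = y := e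
    rw [e', hy]

variable (σ : C) (hσ : ∀ x, x ∈ Subgroup.zpowers σ)

/-- The class in `Ĥ⁰` of an invariant. -/
def zeroClass : X.ρ.invariants →ₗ[R] tateCohomology X 0 :=
  (tateComplex X).classOf 0 1 (by simp) ∘ₗ
    ((constCochain X) ∘ₗ X.ρ.invariants.subtype).codRestrict _ fun x =>
      LinearMap.mem_ker.2 ((d_constCochain_eq_zero_iff X _).2 x.2)

lemma zeroClass_surjective : Function.Surjective (zeroClass X) := by
  intro y
  obtain ⟨⟨f, hf⟩, rfl⟩ := (tateComplex X).classOf_surjective 0 1 (by simp) y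
  obtain ⟨x, rfl⟩ := constCochain_surjective X f
  exact ⟨⟨x, (d_constCochain_eq_zero_iff X x).1 hf⟩, rfl⟩

lemma zeroClass_eq_zero_iff (x : X.ρ.invariants) :
    zeroClass X x = 0 ↔ ∃ y, X.ρ.norm y = x.1 := by
  refine ((tateComplex X).classOf_eq_zero_iff (-1) 0 1 (by simp) (by simp) _).trans ?_
  constructor
  · rintro ⟨y, hy⟩
    obtain ⟨y, rfl⟩ := singleChain_surjective X y
    rw [d_singleChain] at hy
    exact ⟨y, constCochain_injective X hy⟩
  · rintro ⟨y, hy⟩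
    refine ⟨singleChain X y, ?_⟩
    rw [d_singleChain, hy]
    rfl

/-- The class in `Ĥ⁻¹` of an element of norm zero. -/
def negOneClass : LinearMap.ker X.ρ.norm →ₗ[R] tateCohomology X (-1) :=
  (tateComplex X).classOf (-1) 0 (by simp) ∘ₗ
    ((singleChain X) ∘ₗ (LinearMap.ker X.ρ.norm).subtype).codRestrict _ fun x => by
      refine LinearMap.mem_ker.2 ((d_singleChain X _).trans ?_)
      rw [Submodule.subtype_apply, LinearMap.mem_ker.1 x.2, map_zero]

lemma negOneClass_surjective : Function.Surjective (negOneClass X) := by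
  intro y
  obtain ⟨⟨f, hf⟩, rfl⟩ := (tateComplex X).classOf_surjective (-1) 0 (by simp) y
  obtain ⟨x, rfl⟩ := singleChain_surjective X f
  refine ⟨⟨x, LinearMap.mem_ker.2 (constCochain_injective X ?_)⟩, rfl⟩
  rw [← d_singleChain, map_zero]
  exact hf

lemma negOneClass_eq_zero_iff (x : LinearMap.ker X.ρ.norm) :
    negOneClass X x = 0 ↔ x.1 ∈ Representation.Coinvariants.ker X.ρ :=
  ((tateComplex X).classOf_eq_zero_iff (-2) (-1) 0 (by simp) (by simp) _).trans
    (singleChain_mem_range_d_iff X x.1)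

variable {X Y}

lemma map_zeroClass (f : X ⟶ Y) (x : X.ρ.invariants) (y : Y.ρ.invariants)
    (h : f.hom x.1 = y.1) : ((tateCohomologyFunctor 0).map f).hom (zeroClass X x) =
      zeroClass Y y := by
  refine HomologicalComplex.homologyMap_classOf (tateComplex X)
    ((tateComplexFunctor R C).map f) 0 1 (by simp) _ _ ?_
  exact funext fun _ => h

lemma map_negOneClass (f : X ⟶ Y) (x : LinearMap.ker X.ρ.norm) (y : LinearMap.ker Y.ρ.norm)
    (h : f.hom x.1 = y.1) : ((tateCohomologyFunctor (-1)).map f).hom (negOneClass X x) =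
      negOneClass Y y := by
  refine HomologicalComplex.homologyMap_classOf (tateComplex X)
    ((tateComplexFunctor R C).map f) (-1) 0 (by simp) _ _ ?_
  refine (groupHomology.chainsMap_f_single (MonoidHom.id C) f 0 default x.1).trans ?_
  refine Finsupp.ext fun z => ?_
  obtain rfl : z = default := Subsingleton.elim _ _
  refine Eq.trans (b := f.hom x.1) ?_ (h.trans Finsupp.single_eq_same.symm)
  convert Finsupp.single_eq_same
  

end TateCohomology

/-! ### Vanishing of Tate cohomology and periodicity -/

namespace TateCohomology

variable {R C : Type u} [CommRing R] [CommGroup C] [Fintype C] (X : Rep.{u} R C)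
  (σ : C) (hσ : ∀ x, x ∈ Subgroup.zpowers σ)

include hσ in
/-- The Tate cohomology of a representation of a cyclic group vanishes if it does so in the two
periodic degrees. -/
lemma isZero_of_cyclic (h₁ : ∀ x, X.ρ σ x = x → ∃ y, X.ρ.norm y = x)
    (h₂ : ∀ x, X.ρ.norm x = 0 → ∃ y, X.ρ σ y - y = x) (q : ℤ) :
    Limits.IsZero (tateCohomology X q) := by
  classical
  have e₁ : (Rep.FiniteCyclicGroup.normHomCompSub X σ).Exact := by
    rw [ShortComplex.moduleCat_exact_iff]
    intro x hx
    exact h₁ x (sub_eq_zero.1 hx)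
  have e₂ : (Rep.FiniteCyclicGroup.subCompNormHom X σ).Exact := by
    rw [ShortComplex.moduleCat_exact_iff]
    intro x hx
    exact h₂ x hx
  have z₁ := (ShortComplex.exact_iff_isZero_homology _).1 e₁
  have z₂ := (ShortComplex.exact_iff_isZero_homology _).1 e₂
  -- Positive degrees are group cohomology and degrees below `-1` group homology, both known for
  -- cyclic groups by parity; the two degrees next to the gluing map are treated with explicit
  -- representatives.
  have key : q = 0 ∨ q = -1 ∨ (∃ n : ℕ, n ≠ 0 ∧ q = n) ∨ ∃ n : ℕ, n ≠ 0 ∧ q = -(n + 1) := by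
    by_cases h0 : 0 < q
    · exact .inr (.inr (.inl ⟨q.toNat, by omega, by omega⟩))
    · by_cases h1 : q < -1
      · exact .inr (.inr (.inr ⟨(-q - 1).toNat, by omega, by omega⟩))
      · omega
  rcases key with rfl | rfl | ⟨n, hn, rfl⟩ | ⟨n, hn, hq⟩
  · refine ModuleCat.isZero_of_iff_subsingleton.2 ⟨fun a b => ?_⟩
    have : ∀ a : tateCohomology X 0, a = 0 := by
      intro a
      obtain ⟨x, rfl⟩ := zeroClass_surjective X a
      exact (zeroClass_eq_zero_iff X x).2 (h₁ _ (x.2 σ))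
    rw [this a, this b]
  · refine ModuleCat.isZero_of_iff_subsingleton.2 ⟨fun a b => ?_⟩
    have : ∀ a : tateCohomology X (-1), a = 0 := by
      intro a
      obtain ⟨x, rfl⟩ := negOneClass_surjective X a
      refine (negOneClass_eq_zero_iff X x).2 ?_
      obtain ⟨y, hy⟩ := h₂ _ x.2
      rw [← hy]
      exact Representation.Coinvariants.sub_mem_ker _ _
    rw [this a, this b]
  · have : NeZero n := ⟨hn⟩
    refine Limits.IsZero.of_iso ?_ ((isoGroupCohomology n).app X)
    rcases Nat.even_or_odd n with h | h
    · exact z₁.of_iso (Rep.FiniteCyclicGroup.groupCohomologyIsoEven X σ hσ n h)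
    · exact z₂.of_iso (Rep.FiniteCyclicGroup.groupCohomologyIsoOdd X σ hσ n h)
  · have : NeZero n := ⟨hn⟩
    refine Limits.IsZero.of_iso ?_ ((isoGroupHomology q n hq).app X)
    rcases Nat.even_or_odd n with h | h
    · exact z₂.of_iso (Rep.FiniteCyclicGroup.groupHomologyIsoEven X σ hσ n h)
    · exact z₁.of_iso (Rep.FiniteCyclicGroup.groupHomologyIsoOdd X σ hσ n h)

end TateCohomology

namespace SerreTate

open TateCohomology

variable {R C : Type u} [CommRing R] [CommGroup C] (X Y : Rep.{u} R C)

/-- The isomorphism `f ↦ (x ↦ x f(x))` of `Map(C, X)` with the translation action to `Map(C, X)`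
with the diagonal action. -/
def twist : (C → X.V) →ₗ[R] (C → X.V) := LinearMap.pi fun x => X.ρ x ∘ₗ LinearMap.proj x

lemma twist_apply (f : C → X.V) (x : C) : twist X f x = X.ρ x (f x) := rfl

lemma exists_twist (f : C → X.V) : ∃ h, twist X h = f :=
  ⟨fun x => X.ρ x⁻¹ (f x), funext fun x => by
    rw [twist_apply, ← Module.End.mul_apply, ← map_mul, mul_inv_cancel, map_one,
      Module.End.one_apply]⟩

lemma twist_injective : Function.Injective (twist X) := fun f h e => funext fun x => by
  have := congrArg (X.ρ x⁻¹) (congrFun e x)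
  simpa only [twist_apply, ← Module.End.mul_apply, ← map_mul, inv_mul_cancel, map_one,
      Module.End.one_apply] using this

lemma funRho_twist (c : C) (f : C → X.V) :
    funRho X c (twist X f) = twist X (fun x => f (c⁻¹ * x)) := by
  funext x
  rw [funRho_apply, twist_apply, twist_apply, ← Module.End.mul_apply, ← map_mul,
    mul_inv_cancel_left]

lemma compLeft_funRho {X Y : Rep.{u} R C} (f : X ⟶ Y) (c : C) (g : C → X.V) :
    f.hom.toLinearMap.compLeft C (funRho X c g) = funRho Y c (f.hom.toLinearMap.compLeft C g) := by
  funext x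
  exact Rep.hom_comm_apply f c _

variable [Fintype C]

/-- Untwisting turns the diagonal action into translation, and the sum of all translates of a
function is constant. -/
lemma norm_funRho_twist (f : C → X.V) :
    (funRho X).norm (twist X f) = twist X (fun _ => sumMap X f) := by
  rw [Representation.norm, LinearMap.sum_apply]
  simp only [funRho_twist, ← map_sum]
  congr 1
  funext x
  rw [Finset.sum_apply, sumMap_apply]
  exact Fintype.sum_equiv ((Equiv.inv C).trans (Equiv.mulRight x)) _ _ fun c => rfl

variable (σ : C) (hσ : ∀ x, x ∈ Subgroup.zpowers σ)

include hσ in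
-- `Map(C, X)` is induced. After untwisting, an invariant is a constant function, hence the norm of
-- any function with that total sum; a function killed by the norm has sum zero, hence is of the
-- form `diffMap X σ g`.
lemma isZero_tateCohomology_funRho (q : ℤ) :
    Limits.IsZero (tateCohomology (Rep.of (funRho X)) q) := by
  classical
  refine isZero_of_cyclic _ σ hσ (fun (f : C → X.V) hf => ?_) (fun (f : C → X.V) hf => ?_) q
  · obtain ⟨h, rfl⟩ := exists_twist X f
    have hf' : funRho X σ (twist X h) = twist X h := hf
    rw [funRho_twist] at hf'
    have h1 := eq_of_invariant X σ hσ h (congrFun (twist_injective X hf'))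
    obtain ⟨g, hg⟩ := sumMap_surjective X (h 1)
    refine ⟨twist X g, (norm_funRho_twist X g).trans ?_⟩
    congr 1
    funext x
    rw [hg, h1 x]
  · obtain ⟨h, rfl⟩ := exists_twist X f
    have hf' : (funRho X).norm (twist X h) = 0 := hf
    rw [norm_funRho_twist, ← map_zero (twist X)] at hf'
    obtain ⟨g, hg⟩ := exists_diffMap X σ hσ h (congrFun (twist_injective X hf') 1)
    refine ⟨twist X g, ?_⟩
    rw [← hg]
    change funRho X σ (twist X g) - twist X g = _
    rw [funRho_twist, ← map_sub]
    rfl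

include hσ in
-- Both connecting homomorphisms are isomorphisms, since the middle term of each sequence is the
-- acyclic module `Map(C, X)`.
lemma periodicity_bijective (q : ℤ) : Function.Bijective (periodicity X σ hσ q) := by
  have h1 : IsIso (TateCohomology.δ (rightSeq_shortExact X) q) :=
    ShortComplex.ShortExact.isIso_δ _ _ _ _ (isZero_tateCohomology_funRho X σ hσ q)
      (isZero_tateCohomology_funRho X σ hσ (q + 1))
  have h2 : IsIso (TateCohomology.δ (leftSeq_shortExact X σ hσ) (q + 1)) :=
    ShortComplex.ShortExact.isIso_δ _ _ _ _ (isZero_tateCohomology_funRho X σ hσ (q + 1))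
      (isZero_tateCohomology_funRho X σ hσ (q + 1 + 1))
  exact (ConcreteCategory.bijective_of_isIso
    (TateCohomology.δ (leftSeq_shortExact X σ hσ) (q + 1))).comp
      (ConcreteCategory.bijective_of_isIso (TateCohomology.δ (rightSeq_shortExact X) q))

/-- The periodicity operator as an isomorphism. -/
def periodicityEquiv (q : ℤ) : tateCohomology X q ≃ₗ[R] tateCohomology X (q + 1 + 1) :=
  LinearEquiv.ofBijective (periodicity X σ hσ q) (periodicity_bijective X σ hσ q)

variable {X Y}

/-- The map `Map(C, X) → Map(C, Y)` induced by `f : X → Y`. -/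
def funMap (f : X ⟶ Y) : Rep.of (funRho X) ⟶ Rep.of (funRho Y) :=
  Rep.ofHom ⟨f.hom.toLinearMap.compLeft C, fun c => by
    ext1 g
    exact compLeft_funRho f c g⟩

lemma sumMap_compLeft (f : X ⟶ Y) (g : C → X.V) :
    sumMap Y (f.hom.toLinearMap.compLeft C g) = f.hom (sumMap X g) := by
  rw [sumMap_apply, sumMap_apply, map_sum]
  rfl

/-- The map on kernels of the sum maps induced by `f : X → Y`. -/
def kerMap (f : X ⟶ Y) : Rep.of (kerRho X) ⟶ Rep.of (kerRho Y) :=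
  Rep.ofHom ⟨(f.hom.toLinearMap.compLeft C).restrict fun g hg => by
    rw [LinearMap.mem_ker, sumMap_compLeft, LinearMap.mem_ker.1 hg, map_zero], fun c => by
    ext1 g
    exact Subtype.ext (compLeft_funRho f c g.1)⟩

/-- The morphism of sequences `rightSeq` induced by `f : X → Y`. -/
def rightSeqMap (f : X ⟶ Y) : rightSeq X ⟶ rightSeq Y where
  τ₁ := kerMap f
  τ₂ := funMap f
  τ₃ := f
  comm₁₂ := rfl
  comm₂₃ := by
    ext g
    exact sumMap_compLeft f g

/-- The morphism of sequences `leftSeq` induced by `f : X → Y`. -/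
def leftSeqMap (f : X ⟶ Y) : leftSeq X σ ⟶ leftSeq Y σ where
  τ₁ := f
  τ₂ := funMap f
  τ₃ := kerMap f
  comm₁₂ := rfl
  comm₂₃ := by
    ext g
    refine Subtype.ext (funext fun x => ?_)
    exact (map_sub f.hom _ _).symm

/-- Both short exact sequences are functorial in the module. Applied to the action of `g` on `M`,
this shows that periodicity commutes with the action of `G` on Tate cohomology of `N`. -/
lemma periodicity_naturality (f : X ⟶ Y) (q : ℤ) (x : tateCohomology X q) :
    periodicity Y σ hσ q (((tateCohomologyFunctor q).map f).hom x) =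
      ((tateCohomologyFunctor (q + 1 + 1)).map f).hom (periodicity X σ hσ q x) := by
  have h1 := TateCohomology.δ_naturality (rightSeq_shortExact X) (rightSeq_shortExact Y)
    (rightSeqMap f) q
  have h2 := TateCohomology.δ_naturality (leftSeq_shortExact X σ hσ) (leftSeq_shortExact Y σ hσ)
    (leftSeqMap σ f) (q + 1)
  have h3 := LinearMap.congr_fun (congrArg ModuleCat.Hom.hom h1) x
  have h4 := LinearMap.congr_fun (congrArg ModuleCat.Hom.hom h2)
    ((TateCohomology.δ (rightSeq_shortExact X) q).hom x)
  exact (h4.trans (congrArg (TateCohomology.δ (leftSeq_shortExact Y σ hσ) (q + 1)).hom h3)).symm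

end SerreTate

/-! ### Homology of a pair of endomorphisms -/

section HomologyMod

variable {R V : Type*} [CommRing R] [AddCommGroup V] [Module R V]

/-- The homology `ker d / (ker d ∩ im d')`. -/
abbrev HomologyMod (d' d : V →ₗ[R] V) : Type _ :=
  LinearMap.ker d ⧸ (LinearMap.range d').submoduleOf (LinearMap.ker d)

namespace HomologyMod

variable {d₁' d₁ d₂' d₂ : V →ₗ[R] V}

/-- The class of an element of the kernel. -/
def mk (d' d : V →ₗ[R] V) : LinearMap.ker d →ₗ[R] HomologyMod d' d :=
  ((LinearMap.range d').submoduleOf (LinearMap.ker d)).mkQ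

lemma mk_surjective (d' d : V →ₗ[R] V) : Function.Surjective (mk d' d) :=
  Submodule.mkQ_surjective _

lemma mk_eq_zero_iff {d' d : V →ₗ[R] V} (x : LinearMap.ker d) :
    mk d' d x = 0 ↔ ∃ y, d' y = x.1 :=
  (Submodule.Quotient.mk_eq_zero _).trans Iff.rfl

lemma mk_eq_mk_iff {d' d : V →ₗ[R] V} (x y : LinearMap.ker d) :
    mk d' d x = mk d' d y ↔ ∃ z, d' z = x.1 - y.1 := by
  rw [← sub_eq_zero, ← map_sub, mk_eq_zero_iff]
  rfl

/-- The identification of the homologies of equal pairs of endomorphisms. -/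
def congr (h' : d₁' = d₂') (h : d₁ = d₂) : HomologyMod d₁' d₁ ≃ₗ[R] HomologyMod d₂' d₂ :=
  Submodule.Quotient.equiv _ _ (LinearEquiv.ofEq _ _ (by rw [h])) (by
    subst h' h
    ext x
    constructor
    · rintro ⟨y, hy, rfl⟩
      exact hy
    · exact fun hx => ⟨x, hx, rfl⟩)

lemma congr_mk (h' : d₁' = d₂') (h : d₁ = d₂) (x : LinearMap.ker d₁) (y : LinearMap.ker d₂)
    (hxy : x.1 = y.1) : congr h' h (mk d₁' d₁ x) = mk d₂' d₂ y := by
  subst h' h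
  obtain rfl : x = y := Subtype.ext hxy
  rfl

variable {Γ : Type*} [Monoid Γ] (ρ : Representation R Γ V) (d' d : V →ₗ[R] V)

/-- The representation on the homology of a pair of equivariant endomorphisms. -/
def rep (h' : ∀ g, ρ g ∘ₗ d' = d' ∘ₗ ρ g) (h : ∀ g, ρ g ∘ₗ d = d ∘ₗ ρ g) :
    Representation R Γ (HomologyMod d' d) where
  toFun g := Submodule.mapQ _ _ ((ρ g).restrict (p := LinearMap.ker d) (q := LinearMap.ker d)
    fun x hx => by
      rw [LinearMap.mem_ker, ← LinearMap.comp_apply, ← h, LinearMap.comp_apply,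
        LinearMap.mem_ker.1 hx, map_zero]) fun x hx => by
      obtain ⟨y, hy⟩ := hx
      exact ⟨ρ g y, (LinearMap.congr_fun (h' g) y).symm.trans (congrArg (ρ g) hy)⟩
  map_one' := by
    ext x
    refine congrArg (mk d' d) (Subtype.ext ?_)
    exact congrArg (fun e : V →ₗ[R] V => e x.1) (map_one ρ)
  map_mul' g₁ g₂ := by
    ext x
    refine congrArg (mk d' d) (Subtype.ext ?_)
    exact congrArg (fun e : V →ₗ[R] V => e x.1) (map_mul ρ g₁ g₂)

lemma rep_mk (h' : ∀ g, ρ g ∘ₗ d' = d' ∘ₗ ρ g) (h : ∀ g, ρ g ∘ₗ d = d ∘ₗ ρ g) (g : Γ)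
    (x y : LinearMap.ker d) (hxy : ρ g x.1 = y.1) :
    rep ρ d' d h' h g (mk d' d x) = mk d' d y :=
  congrArg (mk d' d) (Subtype.ext hxy)

end HomologyMod

/-- Two surjective maps with the same kernel have isomorphic targets. -/
def LinearMap.equivOfKerEq {W₁ W₂ : Type*} [AddCommGroup W₁] [Module R W₁] [AddCommGroup W₂]
    [Module R W₂] (s₁ : V →ₗ[R] W₁) (s₂ : V →ₗ[R] W₂) (h₁ : Function.Surjective s₁)
    (h₂ : Function.Surjective s₂) (h : ∀ x, s₁ x = 0 ↔ s₂ x = 0) : W₁ ≃ₗ[R] W₂ :=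
  (s₁.quotKerEquivOfSurjective h₁).symm.trans
    ((Submodule.quotEquivOfEq _ _ (by ext x; exact h x)).trans (s₂.quotKerEquivOfSurjective h₂))

lemma LinearMap.equivOfKerEq_apply {W₁ W₂ : Type*} [AddCommGroup W₁] [Module R W₁]
    [AddCommGroup W₂] [Module R W₂] (s₁ : V →ₗ[R] W₁) (s₂ : V →ₗ[R] W₂)
    (h₁ : Function.Surjective s₁) (h₂ : Function.Surjective s₂) (h : ∀ x, s₁ x = 0 ↔ s₂ x = 0)
    (x : V) : LinearMap.equivOfKerEq s₁ s₂ h₁ h₂ h (s₁ x) = s₂ x := by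
  have e : (s₁.quotKerEquivOfSurjective h₁).symm (s₁ x) = (LinearMap.ker s₁).mkQ x := by
    rw [LinearEquiv.symm_apply_eq]
    rfl
  rw [LinearMap.equivOfKerEq, LinearEquiv.trans_apply, e]
  rfl

end HomologyMod

namespace SerreTate

/-! ### The columns of the double complex -/

section Columns

variable {R G : Type u} [CommRing R] [CommGroup G] (N : Subgroup G) (M : Rep.{u} R G)

open Classical in
/-- The function with support in `N` and value `m` at `1`. -/
def delta : M.V →ₗ[R] Inner N M :=
  LinearMap.codRestrict (Representation.coindV N.subtype (M.ρ.comp N.subtype))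
    (LinearMap.pi fun x => if x ∈ N then M.ρ x else 0) fun m n x => by
    by_cases hx : x ∈ N
    · have h : (n : G) * x ∈ N := N.mul_mem n.2 hx
      simp [hx, h]
    · have h : (n : G) * x ∉ N := fun h => hx ((N.mul_mem_cancel_left n.2).1 h)
      simp [hx, h]

lemma delta_apply_mem (m : M.V) {x : G} (hx : x ∈ N) : (delta N M m).1 x = M.ρ x m :=
  congrArg (fun e : M.V →ₗ[R] M.V => e m) (if_pos hx)

lemma delta_apply_notMem (m : M.V) {x : G} (hx : x ∉ N) : (delta N M m).1 x = 0 :=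
  congrArg (fun e : M.V →ₗ[R] M.V => e m) (if_neg hx)

lemma Inner.map_mul (f : Inner N M) {n : G} (hn : n ∈ N) (x : G) :
    f.1 (n * x) = M.ρ n (f.1 x) := f.2 ⟨n, hn⟩ x

lemma translate_delta {n : G} (hn : n ∈ N) (m : M.V) :
    translate N M n (delta N M m) = delta N M (M.ρ n m) := by
  ext x
  rw [translate_apply]
  by_cases hx : x ∈ N
  · rw [delta_apply_mem N M _ (N.mul_mem hn hx), delta_apply_mem N M _ hx, mul_comm, _root_.map_mul,
      Module.End.mul_apply]
  · rw [delta_apply_notMem N M _ hx, delta_apply_notMem N M _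
      (fun h => hx ((N.mul_mem_cancel_left hn).1 h))]

/-- Both sides are supported on the coset `g N`. Since translations act trivially modulo the image
of `translate N M γ - 1` when `γ` generates `G`, conjugation by `g` acts on classes of deltas as `g`
acts on `M`. -/
lemma conj_delta (g : G) (m : M.V) :
    conj N M g (delta N M m) = translate N M g⁻¹ (delta N M (M.ρ g m)) := by
  ext x
  rw [conj_apply, translate_apply]
  by_cases hx : g⁻¹ * x ∈ N
  · rw [delta_apply_mem N M _ hx, delta_apply_mem N M _ hx, ← Module.End.mul_apply,
      ← Module.End.mul_apply, ← _root_.map_mul, ← _root_.map_mul, mul_comm]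
  · rw [delta_apply_notMem N M _ hx, delta_apply_notMem N M _ hx, map_zero]

/-- The action of `G` by translation. -/
def translateRep : Representation R G (Inner N M) where
  toFun := translate N M
  map_one' := by ext f x; simp
  map_mul' g h := (translate_mul N M g h).symm

lemma sum_translate [Fintype G] (g : G) (f : Inner N M) :
    (∑ h : G, translate N M h) (translate N M g f) = (∑ h : G, translate N M h) f := by
  rw [LinearMap.sum_apply, LinearMap.sum_apply]
  simp only [← LinearMap.comp_apply, translate_mul]
  exact Fintype.sum_equiv (Equiv.mulRight g) _ _ fun h => rfl

lemma translate_sub_mem_range [Finite G] (γ : G) (hγ : ∀ x, x ∈ Subgroup.zpowers γ) (g : G)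
    (f : Inner N M) :
    translate N M g f - f ∈ LinearMap.range (translate N M γ - LinearMap.id) := by
  have e := Representation.FiniteCyclicGroup.coinvariantsKer_eq_range (translateRep N M) γ hγ
  have h := Representation.Coinvariants.sub_mem_ker (ρ := translateRep N M) g f
  rw [e] at h
  exact h

/-- Equivariance gives `f (n x) = n f(x)`, so modulo the action of `N` the value depends only on the
coset; commutativity of `G` makes left and right cosets agree. -/
lemma coinv_mk_eq (f : Inner N M) {x y : G} (h : (x : G ⧸ N) = y) :
    Representation.Coinvariants.mk (Rep.res N.subtype M).ρ (f.1 x) =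
      Representation.Coinvariants.mk (Rep.res N.subtype M).ρ (f.1 y) := by
  have hn := QuotientGroup.eq.1 h
  have e : y = x⁻¹ * y * x := (inv_mul_cancel_comm x y).symm
  rw [e, Inner.map_mul N M f hn]
  exact (Representation.Coinvariants.mk_self_apply (Rep.res N.subtype M).ρ ⟨_, hn⟩ (f.1 x)).symm

section Trace

variable [Fintype (G ⧸ N)]

/-- The sum of the values on a system of representatives of `G ⧸ N`. -/
def trace : Inner N M →ₗ[R] M.V :=
  ∑ c : G ⧸ N, LinearMap.proj c.out ∘ₗ
    (Representation.coindV N.subtype (M.ρ.comp N.subtype)).subtype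

lemma trace_apply (f : Inner N M) : trace N M f = ∑ c : G ⧸ N, f.1 c.out := by
  rw [trace, LinearMap.sum_apply]
  rfl

/-- A function is the sum of its restrictions to the cosets of `N`, and by equivariance each
restriction is determined by one value. -/
lemma eq_sum_translate_delta (f : Inner N M) :
    f = ∑ c : G ⧸ N, translate N M c.out⁻¹ (delta N M (f.1 c.out)) := by
  ext x
  have e : (∑ c : G ⧸ N, translate N M c.out⁻¹ (delta N M (f.1 c.out))).1 x =
      ∑ c : G ⧸ N, (delta N M (f.1 c.out)).1 (c.out⁻¹ * x) :=
    map_sum ((LinearMap.proj x : (G → M.V) →ₗ[R] M.V) ∘ₗ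
      (Representation.coindV N.subtype (M.ρ.comp N.subtype)).subtype) _ _
  rw [e, Finset.sum_eq_single (x : G ⧸ N)]
  · have h : (x : G ⧸ N).out⁻¹ * x ∈ N := by
      rw [← QuotientGroup.eq, QuotientGroup.out_eq']
    rw [delta_apply_mem N M _ h, ← Inner.map_mul N M f h, inv_mul_cancel_comm]
  · intro c _ hc
    refine delta_apply_notMem N M _ fun h => hc ?_
    rw [← QuotientGroup.eq, QuotientGroup.out_eq'] at h
    exact h
  · simp

/-- The sum over `G ⧸ N` of the classes of the values in the coinvariants of `N`. -/
def coinvTrace : Inner N M →ₗ[R] (Rep.res N.subtype M).ρ.Coinvariants :=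
  Representation.Coinvariants.mk (Rep.res N.subtype M).ρ ∘ₗ
    (show Inner N M →ₗ[R] (Rep.res N.subtype M).V from trace N M)

lemma coinvTrace_apply (f : Inner N M) : coinvTrace N M f =
    ∑ c : G ⧸ N, Representation.Coinvariants.mk (Rep.res N.subtype M).ρ (f.1 c.out) := by
  refine Eq.trans ?_ (map_sum (Representation.Coinvariants.mk (Rep.res N.subtype M).ρ) _ _)
  exact congrArg _ (trace_apply N M f)

/-- Translation permutes the cosets. Thus `coinvTrace` vanishes on the image of `translate N M γ -
1`, which makes it the inverse of `delta` on coinvariants. -/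
lemma coinvTrace_translate (g : G) (f : Inner N M) :
    coinvTrace N M (translate N M g f) = coinvTrace N M f := by
  rw [coinvTrace_apply, coinvTrace_apply]
  refine Fintype.sum_equiv (Equiv.mulLeft (g : G ⧸ N)) _ _ fun c => ?_
  refine coinv_mk_eq N M f (x := g * c.out) (y := ((g : G ⧸ N) * c).out) ?_
  rw [QuotientGroup.out_eq', QuotientGroup.mk_mul, QuotientGroup.out_eq']

lemma coinvTrace_delta (m : M.V) : coinvTrace N M (delta N M m) =
    Representation.Coinvariants.mk (Rep.res N.subtype M).ρ m := by
  rw [coinvTrace_apply, Finset.sum_eq_single (1 : G ⧸ N)]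
  · rw [coinv_mk_eq N M (delta N M m) (x := (1 : G ⧸ N).out) (y := 1)
      (QuotientGroup.out_eq' _), delta_apply_mem N M m N.one_mem, map_one, Module.End.one_apply]
  · intro c _ hc
    rw [delta_apply_notMem N M m, map_zero]
    intro h
    rw [← QuotientGroup.eq_one_iff, QuotientGroup.out_eq'] at h
    exact hc h
  · simp

end Trace

/-- Only the translates `h` with `h x ∈ N` contribute, and reindexing by `h x` removes the
dependence on `x`. -/
lemma sum_translate_delta [Fintype G] [Fintype N] (m : M.V) (x : G) :
    ((∑ h : G, translate N M h) (delta N M m)).1 x =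
      (Rep.res N.subtype M).ρ.norm m := by
  classical
  have e : ((∑ h : G, translate N M h) (delta N M m)).1 x =
      ∑ h : G, (delta N M m).1 (h * x) := by
    rw [LinearMap.sum_apply]
    exact map_sum ((LinearMap.proj x : (G → M.V) →ₗ[R] M.V) ∘ₗ
      (Representation.coindV N.subtype (M.ρ.comp N.subtype)).subtype) _ _
  rw [e, Representation.norm, LinearMap.sum_apply,
    Fintype.sum_equiv (Equiv.mulRight x) (fun h => (delta N M m).1 (h * x))
      (fun h => (delta N M m).1 h) fun h => rfl]
  symm
  refine Finset.sum_of_injOn (fun n : N => (n : G)) Subtype.val_injective.injOn (by simp)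
    (fun g _ hg => ?_) fun n _ => ?_
  · refine delta_apply_notMem N M _ fun h => hg ⟨⟨g, h⟩, by simp⟩
  · exact (delta_apply_mem N M m n.2).symm

/-- The action of `G ⧸ N` on `Hom_{R[N]}(R[G], M)`. -/
def conjRep : Representation R (G ⧸ N) (Inner N M) :=
  QuotientGroup.lift N
    { toFun := conj N M
      map_one' := conj_one N M
      map_mul' := fun g h => (conj_mul N M g h).symm } fun n hn => conj_mem N M n hn

lemma conjRep_mk (g : G) : conjRep N M (g : G ⧸ N) = conj N M g := rfl

variable [Fintype G] (γ : G)

lemma conj_dV (g : G) (q : ℤ) : conj N M g ∘ₗ dV γ N M q = dV γ N M q ∘ₗ conj N M g := by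
  unfold dV
  split_ifs
  · rw [LinearMap.comp_sub, LinearMap.sub_comp, conj_translate]
    rfl
  · rw [comp_sum, sum_comp]
    simp only [conj_translate]

lemma conjRep_dV (q : ℤ) (c : G ⧸ N) :
    conjRep N M c ∘ₗ dV γ N M q = dV γ N M q ∘ₗ conjRep N M c := by
  obtain ⟨g, rfl⟩ := QuotientGroup.mk_surjective c
  exact conj_dV N M γ g q

/-- The cohomology `H^q` of the columns of the double complex. -/
abbrev ColH (q : ℤ) : Type u := HomologyMod (dV γ N M (q - 1)) (dV γ N M q)

/-- The action of `G ⧸ N` on the cohomology of the columns. -/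
def colRep (q : ℤ) : Representation R (G ⧸ N) (ColH N M γ q) :=
  HomologyMod.rep (conjRep N M) _ _ (conjRep_dV N M γ (q - 1)) (conjRep_dV N M γ q)

lemma dV_two (q : ℤ) : dV γ N M (q + 1 + 1) = dV γ N M q := by
  have := dV_periodic γ N M q 1
  rw [← this]
  congr 1
  push_cast
  ring

lemma dV_zero : dV γ N M 0 = translate N M γ - LinearMap.id := if_pos Even.zero

lemma dV_neg_one : dV γ N M (-1) = ∑ g : G, translate N M g := if_neg (by decide)

lemma dV_neg_two : dV γ N M (-2) = translate N M γ - LinearMap.id := if_pos (by decide)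

/-- The `2`-periodicity of the cohomology of the columns. -/
def colPeriod (q : ℤ) : ColH N M γ q ≃ₗ[R] ColH N M γ (q + 1 + 1) :=
  HomologyMod.congr (by rw [← dV_two]; congr 1; ring) (dV_two N M γ q).symm

lemma colPeriod_mk (q : ℤ) (x : LinearMap.ker (dV γ N M q))
    (y : LinearMap.ker (dV γ N M (q + 1 + 1))) (h : x.1 = y.1) :
    colPeriod N M γ q (HomologyMod.mk _ _ x) = HomologyMod.mk _ _ y :=
  HomologyMod.congr_mk _ _ x y h

lemma colPeriod_rep (q : ℤ) (c : G ⧸ N) (x : ColH N M γ q) :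
    colPeriod N M γ q (colRep N M γ q c x) =
      colRep N M γ (q + 1 + 1) c (colPeriod N M γ q x) := by
  obtain ⟨x, rfl⟩ := HomologyMod.mk_surjective _ _ x
  have hx : x.1 ∈ LinearMap.ker (dV γ N M (q + 1 + 1)) := by
    rw [dV_two]
    exact x.2
  have hx' : conjRep N M c x.1 ∈ LinearMap.ker (dV γ N M q) := by
    rw [LinearMap.mem_ker, ← LinearMap.comp_apply, ← conjRep_dV, LinearMap.comp_apply,
      LinearMap.mem_ker.1 x.2, map_zero]
  have hx'' : conjRep N M c x.1 ∈ LinearMap.ker (dV γ N M (q + 1 + 1)) := by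
    rw [dV_two]
    exact hx'
  rw [colPeriod_mk N M γ q x ⟨x.1, hx⟩ rfl, colRep, colRep,
    HomologyMod.rep_mk _ _ _ _ _ c x ⟨_, hx'⟩ rfl,
    HomologyMod.rep_mk _ _ _ _ _ c ⟨x.1, hx⟩ ⟨_, hx''⟩ rfl]
  exact colPeriod_mk N M γ q _ _ rfl

variable [Fintype (G ⧸ N)]

lemma sum_translate_eq (f : Inner N M) :
    (∑ h : G, translate N M h) f = (∑ h : G, translate N M h) (delta N M (trace N M f)) := by
  conv_lhs => rw [eq_sum_translate_delta N M f, map_sum]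
  simp only [sum_translate]
  rw [trace_apply, map_sum, map_sum]

/-- Every `f` is a sum of translates of deltas, and translating does not change classes modulo the
image of `translate N M γ - 1`; so `f` may be replaced by the delta of its trace. -/
lemma sub_delta_trace_mem (hγ : ∀ x, x ∈ Subgroup.zpowers γ) (f : Inner N M) :
    f - delta N M (trace N M f) ∈ LinearMap.range (translate N M γ - LinearMap.id) := by
  have e : f - delta N M (trace N M f) = ∑ c : G ⧸ N,
      (translate N M c.out⁻¹ (delta N M (f.1 c.out)) - delta N M (f.1 c.out)) := by
    rw [Finset.sum_sub_distrib, ← eq_sum_translate_delta, trace_apply, map_sum]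
  rw [e]
  exact Submodule.sum_mem _ fun c _ => translate_sub_mem_range N M γ hγ _ _

/-- Degree zero of Shapiro's lemma in homology: `coinvTrace` detects the coinvariant class of `m`,
and conversely `delta` sends `n x - x` to a translate of a delta minus that delta. -/
lemma delta_mem_range_iff (hγ : ∀ x, x ∈ Subgroup.zpowers γ) (m : M.V) :
    delta N M m ∈ LinearMap.range (translate N M γ - LinearMap.id) ↔
      m ∈ Representation.Coinvariants.ker (Rep.res N.subtype M).ρ := by
  constructor
  · rintro ⟨h, hh⟩
    have e := coinvTrace_delta N M m
    rw [← hh, LinearMap.sub_apply, map_sub, coinvTrace_translate, LinearMap.id_apply,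
      sub_self] at e
    exact (Submodule.Quotient.mk_eq_zero _).1 e.symm
  · intro h
    have hle : Representation.Coinvariants.ker (Rep.res N.subtype M).ρ ≤
        (LinearMap.range (translate N M γ - LinearMap.id)).comap (delta N M) := by
      refine Submodule.span_le.2 ?_
      rintro _ ⟨⟨n, x⟩, rfl⟩
      change delta N M (M.ρ n x - x) ∈ LinearMap.range (translate N M γ - LinearMap.id)
      rw [map_sub, ← translate_delta N M n.2]
      exact translate_sub_mem_range N M γ hγ _ _
    exact hle h

end Columns

end SerreTate

namespace SerreTate

open TateCohomology

/-! ### Shapiro's lemma: column cohomology is Tate cohomology of `N` -/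

section ColumnsTate

variable {R G : Type u} [CommRing R] [CommGroup G] (N : Subgroup G) (M : Rep.{u} R G)

lemma value_mem_invariants {f : Inner N M} (hf : ∀ x, f.1 x = f.1 1) :
    f.1 1 ∈ (Rep.res N.subtype M).ρ.invariants := by
  intro n
  exact (Inner.map_mul N M f n.2 1).symm.trans (hf _)

lemma mem_ker_dV_zero [Fintype G] (γ : G) (hγ : ∀ x, x ∈ Subgroup.zpowers γ)
    {f : Inner N M} : f ∈ LinearMap.ker (dV γ N M 0) ↔ ∀ x, f.1 x = f.1 1 := by
  rw [dV_zero, LinearMap.mem_ker, LinearMap.sub_apply, sub_eq_zero]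
  constructor
  · intro h x
    refine eq_of_invariant M γ hγ f.1 (fun y => ?_) x
    have := congrArg (fun e : Inner N M => e.1 (γ⁻¹ * y)) h
    simpa using this.symm
  · intro h
    ext x
    exact (h _).trans (h x).symm

variable [Fintype N]

/-- The map on `Ĥ^q(N; M)` induced by the action of an element of `G`. -/
abbrev tateAct (q : ℤ) (g : G) :
    tateCohomology (Rep.res N.subtype M) q →ₗ[R] tateCohomology (Rep.res N.subtype M) q :=
  ((tateCohomologyFunctor q).map (Rep.resMap N.subtype (M.applyAsHom g))).hom

lemma periodicityEquiv_tateAct (σ : N) (hσ : ∀ x, x ∈ Subgroup.zpowers σ) (q : ℤ) (g : G)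
    (x : tateCohomology (Rep.res N.subtype M) q) :
    periodicityEquiv (Rep.res N.subtype M) σ hσ q (tateAct N M q g x) =
      tateAct N M (q + 1 + 1) g (periodicityEquiv (Rep.res N.subtype M) σ hσ q x) :=
  periodicity_naturality σ hσ (Rep.resMap N.subtype (M.applyAsHom g)) q x

variable [Fintype G] (γ : G) (hγ : ∀ x, x ∈ Subgroup.zpowers γ)

/-- Isomorphisms from the cohomology of the columns to the Tate cohomology of `N`, compatible
with the actions of `G`. -/
abbrev ColTateEquiv (q : ℤ) : Type u :=
  {ψ : ColH N M γ q ≃ₗ[R] tateCohomology (Rep.res N.subtype M) q //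
    ∀ (g : G) (x : ColH N M γ q), ψ (colRep N M γ q (g : G ⧸ N) x) = tateAct N M q g (ψ x)}

include hγ in
-- Evaluation at `1` identifies the kernel, the constant functions, with the `N`-invariants. The
-- vertical norm of `h` is the constant function whose value is the `N`-norm of `trace N M h`, so
-- boundaries correspond to norms.
lemma exists_colTateEquiv_zero : Nonempty (ColTateEquiv N M γ 0) := by
  classical
  have := Fintype.ofFinite (G ⧸ N)
  let s₂ : LinearMap.ker (dV γ N M 0) →ₗ[R] tateCohomology (Rep.res N.subtype M) 0 :=
    zeroClass (Rep.res N.subtype M) ∘ₗ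
      ((show Inner N M →ₗ[R] (Rep.res N.subtype M).V from LinearMap.proj (1 : G) ∘ₗ
        (Representation.coindV N.subtype (M.ρ.comp N.subtype)).subtype) ∘ₗ
          (LinearMap.ker (dV γ N M 0)).subtype).codRestrict _ fun f =>
            value_mem_invariants N M ((mem_ker_dV_zero N M γ hγ).1 f.2)
  have hs₂ : ∀ f : LinearMap.ker (dV γ N M 0), s₂ f = zeroClass (Rep.res N.subtype M)
      ⟨f.1.1 1, value_mem_invariants N M ((mem_ker_dV_zero N M γ hγ).1 f.2)⟩ := fun f => rfl
  have h₂ : Function.Surjective s₂ := by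
    intro y
    obtain ⟨⟨m, hm⟩, rfl⟩ := zeroClass_surjective _ y
    have hmi : (fun _ : G => (m : M.V)) ∈
        Representation.coindV N.subtype (M.ρ.comp N.subtype) := fun n x => (hm n).symm
    exact ⟨⟨(⟨fun _ => m, hmi⟩ : Inner N M), (mem_ker_dV_zero N M γ hγ).2 fun x => rfl⟩, rfl⟩
  have hk : ∀ f, HomologyMod.mk (dV γ N M (0 - 1)) _ f = 0 ↔ s₂ f = 0 := by
    intro f
    rw [HomologyMod.mk_eq_zero_iff, hs₂, zeroClass_eq_zero_iff, zero_sub, dV_neg_one]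
    constructor
    · rintro ⟨h, hh⟩
      refine ⟨trace N M h, ?_⟩
      rw [← sum_translate_delta N M (trace N M h) 1, ← sum_translate_eq]
      exact congrArg (fun e : Inner N M => e.1 1) hh
    · rintro ⟨m, hm⟩
      refine ⟨delta N M m, ?_⟩
      ext x
      rw [sum_translate_delta]
      exact hm.trans ((mem_ker_dV_zero N M γ hγ).1 f.2 x).symm
  refine ⟨⟨LinearMap.equivOfKerEq _ s₂ (HomologyMod.mk_surjective _ _) h₂ hk, fun g x => ?_⟩⟩
  obtain ⟨f, rfl⟩ := HomologyMod.mk_surjective _ _ x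
  have hf := (mem_ker_dV_zero N M γ hγ).1 f.2
  have hgf : conj N M g f.1 ∈ LinearMap.ker (dV γ N M 0) := by
    rw [LinearMap.mem_ker, ← LinearMap.comp_apply, ← conj_dV, LinearMap.comp_apply,
      LinearMap.mem_ker.1 f.2, map_zero]
  rw [colRep, HomologyMod.rep_mk _ _ _ _ _ (g : G ⧸ N) f ⟨_, hgf⟩ rfl,
    LinearMap.equivOfKerEq_apply, LinearMap.equivOfKerEq_apply, hs₂, hs₂]
  refine (map_zeroClass _ _ _ ?_).symm
  exact congrArg (M.ρ g) (hf _).symm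

include hγ in
-- Here the comparison map goes from `M` to the column, by `delta`. It is onto because `f` and
-- `delta N M (trace N M f)` have the same class, and `delta_mem_range_iff` computes its kernel.
lemma exists_colTateEquiv_neg_one : Nonempty (ColTateEquiv N M γ (-1)) := by
  classical
  have := Fintype.ofFinite (G ⧸ N)
  have hd : dV γ N M (-1 - 1) = translate N M γ - LinearMap.id := dV_neg_two N M γ
  have hker : ∀ m : M.V, delta N M m ∈ LinearMap.ker (dV γ N M (-1)) ↔
      m ∈ LinearMap.ker (Rep.res N.subtype M).ρ.norm := by
    intro m
    rw [LinearMap.mem_ker, LinearMap.mem_ker, dV_neg_one]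
    constructor
    · intro h
      rw [← sum_translate_delta N M m 1, h]
      rfl
    · intro h
      ext x
      rw [sum_translate_delta, h]
      rfl
  let s₁ : LinearMap.ker (Rep.res N.subtype M).ρ.norm →ₗ[R] ColH N M γ (-1) :=
    HomologyMod.mk _ _ ∘ₗ
      ((show (Rep.res N.subtype M).V →ₗ[R] Inner N M from delta N M) ∘ₗ
        (LinearMap.ker (Rep.res N.subtype M).ρ.norm).subtype).codRestrict _
          fun m => (hker m.1).2 m.2
  have hs₁ : ∀ m, s₁ m = HomologyMod.mk _ _ ⟨delta N M m.1, (hker m.1).2 m.2⟩ := fun m => rfl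
  have h₁ : Function.Surjective s₁ := by
    intro x
    obtain ⟨f, rfl⟩ := HomologyMod.mk_surjective _ _ x
    have hm : trace N M f.1 ∈ LinearMap.ker (Rep.res N.subtype M).ρ.norm := by
      rw [← hker]
      refine (LinearMap.congr_fun (dV_neg_one N M γ) _).trans ?_
      rw [← sum_translate_eq]
      exact (LinearMap.congr_fun (dV_neg_one N M γ) f.1).symm.trans f.2
    refine ⟨⟨_, hm⟩, ?_⟩
    rw [hs₁, eq_comm, HomologyMod.mk_eq_mk_iff, hd]
    exact sub_delta_trace_mem N M γ hγ f.1
  have hk : ∀ m, s₁ m = 0 ↔ negOneClass (Rep.res N.subtype M) m = 0 := by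
    intro m
    rw [hs₁, HomologyMod.mk_eq_zero_iff, negOneClass_eq_zero_iff, hd]
    exact delta_mem_range_iff N M γ hγ m.1
  refine ⟨⟨LinearMap.equivOfKerEq s₁ _ h₁ (negOneClass_surjective _) hk, fun g x => ?_⟩⟩
  obtain ⟨m, rfl⟩ := h₁ x
  have hgm : M.ρ g m.1 ∈ LinearMap.ker (Rep.res N.subtype M).ρ.norm := by
    have e : (Rep.res N.subtype M).ρ.norm (M.ρ g m.1) =
        M.ρ g ((Rep.res N.subtype M).ρ.norm m.1) :=
      Rep.norm_comm_apply (Rep.resMap N.subtype (M.applyAsHom g)) m.1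
    rw [LinearMap.mem_ker, e, LinearMap.mem_ker.1 m.2, map_zero]
  have e : colRep N M γ (-1) (g : G ⧸ N) (s₁ m) = s₁ ⟨M.ρ g m.1, hgm⟩ := by
    have hgf : conj N M g (delta N M m.1) ∈ LinearMap.ker (dV γ N M (-1)) := by
      rw [LinearMap.mem_ker, ← LinearMap.comp_apply, ← conj_dV, LinearMap.comp_apply,
        LinearMap.mem_ker.1 ((hker m.1).2 m.2), map_zero]
    rw [hs₁, hs₁, colRep, HomologyMod.rep_mk _ _ _ _ _ (g : G ⧸ N) _ ⟨_, hgf⟩ rfl,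
      HomologyMod.mk_eq_mk_iff, hd]
    -- By `conj_delta` the conjugate is a translate of the delta of `M.ρ g m`, hence has the same
    -- class.
    have h := translate_sub_mem_range N M γ hγ g⁻¹ (delta N M (M.ρ g m.1))
    rw [← conj_delta] at h
    exact h
  rw [e, LinearMap.equivOfKerEq_apply, LinearMap.equivOfKerEq_apply]
  refine (map_negOneClass _ _ _ ?_).symm
  rfl

variable (σ : N) (hσ : ∀ x, x ∈ Subgroup.zpowers σ)

/-- The `2`-periodicity of the isomorphisms `ColTateEquiv`. -/
def colTateEquivPeriod (q : ℤ) : ColTateEquiv N M γ q ≃ ColTateEquiv N M γ (q + 1 + 1) where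
  toFun ψ := ⟨(colPeriod N M γ q).symm.trans
    (ψ.1.trans (periodicityEquiv (Rep.res N.subtype M) σ hσ q)), fun g x => by
      obtain ⟨x, rfl⟩ := (colPeriod N M γ q).surjective x
      simp only [LinearEquiv.trans_apply, ← colPeriod_rep, LinearEquiv.symm_apply_apply, ψ.2,
        periodicityEquiv_tateAct]⟩
  invFun ψ := ⟨(colPeriod N M γ q).trans
    (ψ.1.trans (periodicityEquiv (Rep.res N.subtype M) σ hσ q).symm), fun g x => by
      apply (periodicityEquiv (Rep.res N.subtype M) σ hσ q).injective
      simp only [LinearEquiv.trans_apply, colPeriod_rep, LinearEquiv.apply_symm_apply, ψ.2,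
        periodicityEquiv_tateAct]⟩
  left_inv ψ := Subtype.ext (LinearEquiv.ext fun x => by simp)
  right_inv ψ := Subtype.ext (LinearEquiv.ext fun x => by simp)

include hγ in
/-- The cohomology of the columns is the Tate cohomology of `N`, compatibly with the actions of
`G` and with periodicity. -/
lemma exists_colTateEquiv : ∃ ψ : ∀ q, ColTateEquiv N M γ q, ∀ q (x : ColH N M γ q),
    (ψ (q + 1 + 1)).1 (colPeriod N M γ q x) =
      periodicity (Rep.res N.subtype M) σ hσ q ((ψ q).1 x) := by
  -- The two explicit degrees are extended to all degrees by conjugating with the periodicities, so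
  -- the required compatibility is the recursion equation itself.
  obtain ⟨ψ, hψ⟩ := Int.exists_section_two (-1) (exists_colTateEquiv_neg_one N M γ hγ).some
    (exists_colTateEquiv_zero N M γ hγ).some (colTateEquivPeriod N M γ σ hσ)
  refine ⟨ψ, fun q x => ?_⟩
  rw [hψ]
  exact congrArg (fun y => periodicity (Rep.res N.subtype M) σ hσ q ((ψ q).1 y))
    ((colPeriod N M γ q).symm_apply_apply x)

end ColumnsTate

end SerreTate

namespace SerreTate

open TateCohomology

/-! ### The rows of the double complex -/

section Rows

variable {R G : Type u} [CommRing R] [CommGroup G] (N : Subgroup G) (M : Rep.{u} R G)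

/-- The function `x ↦ x m`. -/
def iota : M.V →ₗ[R] Inner N M :=
  LinearMap.codRestrict (Representation.coindV N.subtype (M.ρ.comp N.subtype))
    (LinearMap.pi fun x => M.ρ x) fun m n x =>
      LinearMap.congr_fun (map_mul M.ρ (n : G) x) m

lemma iota_apply (m : M.V) (x : G) : (iota N M m).1 x = M.ρ x m := rfl

lemma iota_apply_one (m : M.V) : (iota N M m).1 1 = m := by
  rw [iota_apply, map_one, Module.End.one_apply]

lemma iota_injective : Function.Injective (iota N M) := fun m m' h => by
  rw [← iota_apply_one N M m, h, iota_apply_one]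

lemma conj_iota (g : G) (m : M.V) : conj N M g (iota N M m) = iota N M m := by
  ext x
  rw [conj_apply, iota_apply, iota_apply, ← Module.End.mul_apply, ← map_mul, mul_inv_cancel_left]

lemma translate_iota (g : G) (m : M.V) :
    translate N M g (iota N M m) = iota N M (M.ρ g m) := by
  ext x
  rw [translate_apply, iota_apply, iota_apply, ← Module.End.mul_apply, ← map_mul, mul_comm]

/-- Invariance under `conj N M γ` says that `x ↦ x⁻¹ f(x)` is invariant under translation by the
generator, hence constant. -/
lemma eq_iota (γ : G) (hγ : ∀ x, x ∈ Subgroup.zpowers γ) {f : Inner N M}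
    (hf : conj N M γ f = f) : f = iota N M (f.1 1) := by
  have h := eq_of_invariant M γ hγ (fun x => M.ρ x⁻¹ (f.1 x)) fun x => by
    have e := congrArg (fun e : Inner N M => M.ρ x⁻¹ (e.1 x)) hf
    simp only [conj_apply, ← Module.End.mul_apply, ← map_mul] at e
    rw [← e]
    congr 2
    group
  ext x
  have e := congrArg (M.ρ x) (h x)
  simp only [← Module.End.mul_apply, ← map_mul] at e
  simpa [iota_apply] using e

lemma dH_of_even (γ : G) {p : ℕ} (hp : Even p) : dH γ N M p = conj N M γ - LinearMap.id := if_pos hp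

lemma dH_zero_iota (γ : G) (m : M.V) : dH γ N M 0 (iota N M m) = 0 := by
  rw [dH_of_even N M γ Even.zero]
  exact sub_eq_zero.2 (conj_iota N M γ m)

lemma eq_iota_of_dH (γ : G) (hγ : ∀ x, x ∈ Subgroup.zpowers γ) {f : Inner N M}
    (hf : dH γ N M 0 f = 0) : f = iota N M (f.1 1) := by
  rw [dH_of_even N M γ Even.zero] at hf
  exact eq_iota N M γ hγ (sub_eq_zero.1 hf)

variable [Fintype (G ⧸ N)]

/-- The powers `γ ^ j` with `j` below the index of `N` represent each coset exactly once, because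
the image of `γ` generates `G ⧸ N`. -/
lemma norm_eq_sum_conj (γ : G) (hγ : ∀ x, x ∈ Subgroup.zpowers γ) :
    ∑ j ∈ Finset.range N.index, conj N M (γ ^ j) = (conjRep N M).norm := by
  classical
  have hγ' : ∀ x : G ⧸ N, x ∈ Subgroup.zpowers (γ : G ⧸ N) := by
    intro x
    obtain ⟨g, rfl⟩ := QuotientGroup.mk_surjective x
    obtain ⟨k, rfl⟩ := hγ g
    exact ⟨k, rfl⟩
  have hi : Finset.image (fun i => (γ : G ⧸ N) ^ i) (Finset.range N.index) = Finset.univ :=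
    IsCyclic.image_range_card hγ'
  have hinj : Set.InjOn (fun i => (γ : G ⧸ N) ^ i) (Finset.range N.index : Set ℕ) := by
    rw [← Finset.card_image_iff, hi, Finset.card_univ, Finset.card_range,
      ← Nat.card_eq_fintype_card]
    rfl
  rw [Representation.norm, ← hi, Finset.sum_image hinj]
  rfl

lemma sum_conjRep_delta (u : G ⧸ N → M.V) (x : G) :
    (∑ c : G ⧸ N, conjRep N M c (delta N M (u c))).1 x = M.ρ x (u x) := by
  have e : (∑ c : G ⧸ N, conjRep N M c (delta N M (u c))).1 x =
      ∑ c : G ⧸ N, (conjRep N M c (delta N M (u c))).1 x :=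
    map_sum ((LinearMap.proj x : (G → M.V) →ₗ[R] M.V) ∘ₗ
      (Representation.coindV N.subtype (M.ρ.comp N.subtype)).subtype) _ _
  have e' : ∀ c : G ⧸ N, (conjRep N M c (delta N M (u c))).1 x =
      M.ρ c.out ((delta N M (u c)).1 (c.out⁻¹ * x)) := fun c => by
    conv_lhs => rw [← QuotientGroup.out_eq' c, conjRep_mk, conj_apply, QuotientGroup.out_eq']
  rw [e, Finset.sum_eq_single (x : G ⧸ N)]
  · have h : (x : G ⧸ N).out⁻¹ * x ∈ N := by
      rw [← QuotientGroup.eq, QuotientGroup.out_eq']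
    rw [e', delta_apply_mem N M _ h, ← Module.End.mul_apply, ← map_mul, mul_inv_cancel_left]
  · intro c _ hc
    rw [e', delta_apply_notMem N M _ fun h => hc ?_, map_zero]
    rw [← QuotientGroup.eq, QuotientGroup.out_eq'] at h
    exact h
  · simp

lemma norm_conjRep_delta (m : M.V) : (conjRep N M).norm (delta N M m) = iota N M m := by
  ext x
  rw [Representation.norm, LinearMap.sum_apply]
  exact sum_conjRep_delta N M (fun _ => m) x

lemma eq_sum_conjRep_delta (f : Inner N M) :
    f = ∑ c : G ⧸ N, conjRep N M c (delta N M (M.ρ c.out⁻¹ (f.1 c.out))) := by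
  ext x
  have h : (x : G ⧸ N).out⁻¹ * x ∈ N := by
    rw [← QuotientGroup.eq, QuotientGroup.out_eq']
  rw [sum_conjRep_delta N M (fun c => M.ρ c.out⁻¹ (f.1 c.out)), ← Module.End.mul_apply, ← map_mul,
    mul_comm x, ← Inner.map_mul N M f h, inv_mul_cancel_comm]

/-- Write `f` as a sum of conjugates of deltas, one for each coset. Its norm is `iota` of the sum of
the coefficients, so this sum vanishes and `f` is a sum of differences of a conjugate and the
original, which the generator condition turns into an element of the image of `conj N M γ - 1`. -/
lemma exists_of_norm_eq_zero (γ : G) (hγ : ∀ x, x ∈ Subgroup.zpowers γ) {f : Inner N M}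
    (hf : (conjRep N M).norm f = 0) : ∃ h, conj N M γ h - h = f := by
  have hγ' : ∀ x : G ⧸ N, x ∈ Subgroup.zpowers (γ : G ⧸ N) := by
    intro x
    obtain ⟨g, rfl⟩ := QuotientGroup.mk_surjective x
    obtain ⟨k, rfl⟩ := hγ g
    exact ⟨k, rfl⟩
  have key : f ∈ Representation.Coinvariants.ker (conjRep N M) := by
    have e := eq_sum_conjRep_delta N M f
    have hs : ∑ c : G ⧸ N, M.ρ c.out⁻¹ (f.1 c.out) = 0 := by
      apply iota_injective N M
      rw [map_zero, ← norm_conjRep_delta, map_sum, map_sum]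
      rw [e, map_sum] at hf
      rw [← hf]
      exact Finset.sum_congr rfl fun c _ =>
        (Representation.norm_self_apply (conjRep N M) c _).symm
    have e2 : f = ∑ c : G ⧸ N, (conjRep N M c (delta N M (M.ρ c.out⁻¹ (f.1 c.out))) -
        delta N M (M.ρ c.out⁻¹ (f.1 c.out))) := by
      rw [Finset.sum_sub_distrib, ← map_sum, hs, map_zero, sub_zero]
      exact e
    rw [e2]
    exact Submodule.sum_mem _ fun c _ => Representation.Coinvariants.sub_mem_ker _ _
  rw [Representation.FiniteCyclicGroup.coinvariantsKer_eq_range _ _ hγ'] at key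
  exact key

variable (γ : G) (hγ : ∀ x, x ∈ Subgroup.zpowers γ)

include hγ in
lemma dH_of_odd {p : ℕ} (hp : Odd p) : dH γ N M p = (conjRep N M).norm :=
  (if_neg (Nat.not_even_iff_odd.2 hp)).trans (norm_eq_sum_conj N M γ hγ)

include hγ in
-- Exactness of the rows in positive degrees: `Inner N M` is an induced `G ⧸ N`-module.
lemma exists_dH_eq {p : ℕ} {f : Inner N M} (hf : dH γ N M (p + 1) f = 0) :
    ∃ h, dH γ N M p h = f := by
  rcases Nat.even_or_odd p with hp | hp
  · rw [dH_of_odd N M γ hγ hp.add_one] at hf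
    rw [dH_of_even N M γ hp]
    exact exists_of_norm_eq_zero N M γ hγ hf
  · rw [dH_of_even N M γ hp.add_one] at hf
    rw [dH_of_odd N M γ hγ hp]
    refine ⟨delta N M (f.1 1), ?_⟩
    rw [norm_conjRep_delta]
    exact (eq_iota N M γ hγ (sub_eq_zero.1 hf)).symm

end Rows

/-! ### The abutment -/

section Abutment

variable {R G : Type u} [CommRing R] [CommGroup G] [Fintype G] (N : Subgroup G)
  (M : Rep.{u} R G) (γ : G) (hγ : ∀ x, x ∈ Subgroup.zpowers γ)

/-- The differentials of the periodic complex computing the Tate cohomology of `G`. -/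
def dC (n : ℤ) : M.V →ₗ[R] M.V := if Even n then M.ρ γ - LinearMap.id else M.ρ.norm

lemma dV_iota (n : ℤ) (m : M.V) : dV γ N M n (iota N M m) = iota N M (dC M γ n m) := by
  unfold dV dC
  split_ifs
  · rw [LinearMap.sub_apply, LinearMap.sub_apply, map_sub, translate_iota]
    rfl
  · rw [Representation.norm, LinearMap.sum_apply, LinearMap.sum_apply, map_sum]
    exact Finset.sum_congr rfl fun g _ => translate_iota N M g m

lemma D_single_iota (n : ℤ) (m : M.V) :
    D γ N M n (Finsupp.single 0 (iota N M m)) = Finsupp.single 0 (iota N M (dC M γ n m)) := by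
  rw [D_single, dH_zero_iota, Finsupp.single_zero, zero_add, pow_zero, one_smul, Nat.cast_zero,
    sub_zero, dV_iota]

lemma D_comp_D (n : ℤ) (x : ℕ →₀ Inner N M) : D γ N M n (D γ N M (n - 1) x) = 0 := by
  have h := LinearMap.congr_fun (D_D γ N M (n - 1)) x
  rwa [sub_add_cancel] at h

include hγ in
/-- Every cochain whose differential vanishes in degrees above `P + 1` can be changed by a
coboundary such that its components in positive degrees vanish. -/
lemma exists_sub_D_eq_zero (n : ℤ) (P : ℕ) (x : ℕ →₀ Inner N M) (hx : ∀ p, P < p → x p = 0)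
    (hD : ∀ p, 1 < p → D γ N M n x p = 0) :
    ∃ w : ℕ →₀ Inner N M, ∀ p, 0 < p → (x - D γ N M (n - 1) w) p = 0 := by
  have := Fintype.ofFinite (G ⧸ N)
  induction P generalizing x with
  | zero => exact ⟨0, fun p hp => by simpa using hx p hp⟩
  | succ P ih =>
    -- With no component beyond column `P + 1`, the component of `D x` in column `P + 2` is purely
    -- horizontal. Exactness of the row gives `h`, and subtracting `D` of `h` placed in column `P`
    -- clears the top column. The descent stops at column `0`, so only columns `p > 1` of `D x` are
    -- used.
    have h1 : dH γ N M (P + 1) (x (P + 1)) = 0 := by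
      have h := hD (P + 2) (by omega)
      rwa [D_apply_succ, hx (P + 1 + 1) (by omega), map_zero, smul_zero, add_zero] at h
    obtain ⟨h, hh⟩ := exists_dH_eq N M γ hγ h1
    obtain ⟨w, hw⟩ := ih (x - D γ N M (n - 1) (Finsupp.single P h)) (fun p hp => by
      rw [D_single, hh, Finsupp.sub_apply, Finsupp.add_apply, Finsupp.smul_apply,
        Finsupp.single_eq_of_ne (by omega : p ≠ P), smul_zero, add_zero]
      by_cases hp' : p = P + 1
      · subst hp'
        rw [Finsupp.single_eq_same, sub_self]
      · rw [hx p (by omega), Finsupp.single_eq_of_ne hp', sub_zero]) (fun p hp => by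
      rw [map_sub, D_comp_D, sub_zero]
      exact hD p hp)
    refine ⟨w + Finsupp.single P h, fun p hp => ?_⟩
    rw [map_add, add_comm, ← sub_sub]
    exact hw p hp

lemma exists_bound {V : Type*} [Zero V] (x : ℕ →₀ V) : ∃ P, ∀ p, P < p → x p = 0 := by
  refine ⟨x.support.sup id, fun p hp => ?_⟩
  by_contra h
  have : p ≤ x.support.sup id := Finset.le_sup (f := id) (Finsupp.mem_support_iff.2 h)
  omega

lemma eq_single_zero {V : Type*} [AddCommGroup V] {x : ℕ →₀ V} (h : ∀ p, 0 < p → x p = 0) :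
    x = Finsupp.single 0 (x 0) := by
  ext p
  rcases p with _ | p
  · simp
  · rw [h _ (by omega), Finsupp.single_eq_of_ne (by omega)]

include hγ in
-- After the descent a cocycle sits in column `0`; its horizontal differential vanishes, so it is in
-- the image of `iota`, on which the vertical differential restricts to `dC`.
lemma exists_eq_iota_add_D (n : ℤ) (x : ℕ →₀ Inner N M) (hx : D γ N M n x = 0) :
    ∃ (m : M.V) (w : ℕ →₀ Inner N M), dC M γ n m = 0 ∧
      x = Finsupp.single 0 (iota N M m) + D γ N M (n - 1) w := by
  have := Fintype.ofFinite (G ⧸ N)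
  obtain ⟨P, hP⟩ := exists_bound x
  obtain ⟨w, hw⟩ := exists_sub_D_eq_zero N M γ hγ n P x hP fun p _ => by simp [hx]
  have e := eq_single_zero hw
  set f := (x - D γ N M (n - 1) w) 0
  have hD : D γ N M n (Finsupp.single 0 f) = 0 := by rw [← e, map_sub, hx, D_comp_D, sub_zero]
  have h1 : dH γ N M 0 f = 0 := by
    have := DFunLike.congr_fun hD 1
    rw [D_single] at this
    simpa using this
  have hf := eq_iota_of_dH N M γ hγ h1
  refine ⟨f.1 1, w, ?_, ?_⟩
  · rw [hf, D_single_iota] at hD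
    apply iota_injective N M
    rw [map_zero]
    exact (Finsupp.single_eq_zero.1 hD)
  · rw [← hf, ← e, sub_add_cancel]

include hγ in
-- The same descent applies to the primitive `w`, since `D w` has no component in positive columns.
lemma single_iota_mem_range_iff (n : ℤ) (m : M.V) :
    (∃ w, D γ N M (n - 1) w = Finsupp.single 0 (iota N M m)) ↔ ∃ m', dC M γ (n - 1) m' = m := by
  have := Fintype.ofFinite (G ⧸ N)
  constructor
  · rintro ⟨w, hw⟩
    obtain ⟨P, hP⟩ := exists_bound w
    obtain ⟨v, hv⟩ := exists_sub_D_eq_zero N M γ hγ (n - 1) P w hP fun p hp => by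
      rw [hw, Finsupp.single_eq_of_ne (by omega)]
    have e := eq_single_zero hv
    set f := (w - D γ N M (n - 1 - 1) v) 0
    have hD : D γ N M (n - 1) (Finsupp.single 0 f) = Finsupp.single 0 (iota N M m) := by
      rw [← e, map_sub, hw, D_comp_D, sub_zero]
    have h1 : dH γ N M 0 f = 0 := by
      have := DFunLike.congr_fun hD 1
      rw [D_single] at this
      simpa using this
    have hf := eq_iota_of_dH N M γ hγ h1
    refine ⟨f.1 1, ?_⟩
    rw [hf, D_single_iota] at hD
    exact iota_injective N M (Finsupp.single_injective 0 hD)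
  · rintro ⟨m', rfl⟩
    exact ⟨_, D_single_iota N M γ _ _⟩

/-- The cohomology of the periodic total complex. -/
abbrev TotH (n : ℤ) : Type u := HomologyMod (D γ N M (n - 1)) (D γ N M n)

lemma D_two (n : ℤ) : D γ N M (n + 1 + 1) = D γ N M n :=
  D_of_eq γ N M (k := 1) (by push_cast; ring)

/-- The `2`-periodicity of the cohomology of the periodic total complex. -/
def totPeriod (n : ℤ) : TotH N M γ n ≃ₗ[R] TotH N M γ (n + 1 + 1) :=
  HomologyMod.congr (by rw [← D_two]; congr 1; ring) (D_two N M γ n).symm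

lemma totPeriod_mk (n : ℤ) (x : LinearMap.ker (D γ N M n))
    (y : LinearMap.ker (D γ N M (n + 1 + 1))) (h : x.1 = y.1) :
    totPeriod N M γ n (HomologyMod.mk _ _ x) = HomologyMod.mk _ _ y :=
  HomologyMod.congr_mk _ _ x y h

/-- The class in the periodic total complex of a cocycle of the periodic complex `dC`. -/
def iotaClass (n : ℤ) : LinearMap.ker (dC M γ n) →ₗ[R] TotH N M γ n :=
  HomologyMod.mk _ _ ∘ₗ (Finsupp.lsingle 0 ∘ₗ iota N M ∘ₗ
    (LinearMap.ker (dC M γ n)).subtype).codRestrict _ fun m => by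
      refine LinearMap.mem_ker.2 ((D_single_iota N M γ n m.1).trans ?_)
      rw [LinearMap.mem_ker.1 m.2, map_zero, Finsupp.single_zero]

include hγ in
lemma iotaClass_surjective (n : ℤ) : Function.Surjective (iotaClass N M γ n) := by
  intro y
  obtain ⟨⟨x, hx⟩, rfl⟩ := HomologyMod.mk_surjective _ _ y
  obtain ⟨m, w, hm, rfl⟩ := exists_eq_iota_add_D N M γ hγ n x hx
  refine ⟨⟨m, hm⟩, ?_⟩
  refine ((HomologyMod.mk_eq_mk_iff _ _).2 ⟨-w, ?_⟩)
  rw [map_neg]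
  exact (sub_add_cancel_left _ _).symm

include hγ in
lemma iotaClass_eq_zero_iff (n : ℤ) (m : LinearMap.ker (dC M γ n)) :
    iotaClass N M γ n m = 0 ↔ ∃ m', dC M γ (n - 1) m' = m.1 :=
  (HomologyMod.mk_eq_zero_iff _).trans (single_iota_mem_range_iff N M γ hγ n m.1)

include hγ in
lemma exists_totEquiv_zero : Nonempty (TotH N M γ 0 ≃ₗ[R] tateCohomology M 0) := by
  have hker : LinearMap.ker (dC M γ 0) = M.ρ.invariants := by
    ext m
    refine ((Representation.mem_invariants_iff_of_forall_mem_zpowers M.ρ γ hγ m).trans ?_).symm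
    rw [dC, if_pos Even.zero, LinearMap.mem_ker, LinearMap.sub_apply, sub_eq_zero]
    rfl
  refine ⟨LinearMap.equivOfKerEq (iotaClass N M γ 0)
    (zeroClass M ∘ₗ (LinearEquiv.ofEq _ _ hker).toLinearMap) (iotaClass_surjective N M γ hγ 0)
    ((zeroClass_surjective M).comp (LinearEquiv.ofEq _ _ hker).surjective) fun m => ?_⟩
  rw [iotaClass_eq_zero_iff N M γ hγ]
  refine Iff.trans ?_ (zeroClass_eq_zero_iff M _).symm
  rw [dC, if_neg (by decide)]
  rfl

include hγ in
lemma exists_totEquiv_neg_one : Nonempty (TotH N M γ (-1) ≃ₗ[R] tateCohomology M (-1)) := by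
  have hker : LinearMap.ker (dC M γ (-1)) = LinearMap.ker M.ρ.norm := by
    rw [dC, if_neg (by decide)]
  refine ⟨LinearMap.equivOfKerEq (iotaClass N M γ (-1))
    (negOneClass M ∘ₗ (LinearEquiv.ofEq _ _ hker).toLinearMap)
    (iotaClass_surjective N M γ hγ (-1))
    ((negOneClass_surjective M).comp (LinearEquiv.ofEq _ _ hker).surjective) fun m => ?_⟩
  rw [iotaClass_eq_zero_iff N M γ hγ]
  refine Iff.trans ?_ (negOneClass_eq_zero_iff M _).symm
  rw [dC, if_pos (by decide), Representation.FiniteCyclicGroup.coinvariantsKer_eq_range _ γ hγ]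
  rfl

/-- The cohomology of the periodic total complex is the Tate cohomology of `G`, compatibly with
periodicity. -/
lemma exists_totEquiv : ∃ ψ : ∀ n, TotH N M γ n ≃ₗ[R] tateCohomology M n,
    ∀ n (x : TotH N M γ n), ψ (n + 1 + 1) (totPeriod N M γ n x) =
      periodicity M γ hγ n (ψ n x) := by
  -- As for the columns, degrees `-1` and `0` are explicit and periodicity defines the rest.
  obtain ⟨ψ, hψ⟩ := Int.exists_section_two
    (P := fun n => TotH N M γ n ≃ₗ[R] tateCohomology M n) (-1)
    (exists_totEquiv_neg_one N M γ hγ).some (exists_totEquiv_zero N M γ hγ).some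
    (fun n =>
      { toFun := fun e => (totPeriod N M γ n).symm.trans (e.trans (periodicityEquiv M γ hγ n))
        invFun := fun e => (totPeriod N M γ n).trans (e.trans (periodicityEquiv M γ hγ n).symm)
        left_inv := fun e => LinearEquiv.ext fun x => by simp
        right_inv := fun e => LinearEquiv.ext fun x => by simp })
  refine ⟨ψ, fun n x => ?_⟩
  rw [hψ]
  exact congrArg (fun y => periodicity M γ hγ n (ψ n y))
    ((totPeriod N M γ n).symm_apply_apply x)

lemma mem_cocycles_iff {m : ℤ} (x : (serre γ N M).K.X m) :
    x ∈ (serre γ N M).cocycles m ↔ D γ N M m (show totX N M m from x).1 = 0 :=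
  serre_d_eq_iff γ N M rfl x 0

/-- The inclusion of the cocycles of the Serre complex into those of the periodic complex. -/
def inclCocycles (n m : ℤ) (k : ℕ) (hm : m = n + 2 * k) :
    (serre γ N M).cocycles m →ₗ[R] LinearMap.ker (D γ N M n) :=
  LinearMap.restrict (p := (serre γ N M).cocycles m) (q := LinearMap.ker (D γ N M n))
    (show totX N M m →ₗ[R] (ℕ →₀ Inner N M) from (totX N M m).subtype) fun x hx => by
    rw [LinearMap.mem_ker, ← D_of_eq γ N M hm]
    exact (mem_cocycles_iff N M γ x).1 hx

variable {N M γ}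

/-- The map `x ↦ b⁻ᵏ [x]` to the cohomology of the periodic total complex. -/
def totFrac (n m : ℤ) (k : ℕ) (hm : m = n + 2 * k) :
    (serre γ N M).cocycles m →ₗ[R] TotH N M γ n :=
  HomologyMod.mk _ _ ∘ₗ inclCocycles N M γ n m k hm

lemma totFrac_apply (n m : ℤ) (k : ℕ) (hm : m = n + 2 * k) (x : (serre γ N M).cocycles m) :
    totFrac n m k hm x = HomologyMod.mk _ _ (inclCocycles N M γ n m k hm x) := rfl

lemma inclCocycles_val (n m : ℤ) (k : ℕ) (hm : m = n + 2 * k) (x : (serre γ N M).cocycles m) :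
    (inclCocycles N M γ n m k hm x).1 = (show totX N M m from x.1).1 := rfl

lemma totFrac_b (n m m' : ℤ) (k j : ℕ) (hm : m = n + 2 * k) (hm' : m' = n + 2 * ((k + j : ℕ) : ℤ))
    (h : m' = m + 2 * j) (x : (serre γ N M).cocycles m) (x' : (serre γ N M).cocycles m')
    (hx : x'.1 = b γ N M j m m' h x.1) : totFrac n m' (k + j) hm' x' = totFrac n m k hm x := by
  have e : inclCocycles N M γ n m' (k + j) hm' x' = inclCocycles N M γ n m k hm x := by
    apply Subtype.ext
    rw [inclCocycles_val, inclCocycles_val, hx]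
    rfl
  rw [totFrac_apply, totFrac_apply, e]

lemma exists_totFrac (n : ℤ) (y : TotH N M γ n) :
    ∃ (k : ℕ) (x : (serre γ N M).cocycles (n + 2 * k)), totFrac n _ k rfl x = y := by
  obtain ⟨⟨x, hx⟩, rfl⟩ := HomologyMod.mk_surjective _ _ y
  obtain ⟨m₀, hm₀⟩ := exists_forall_mem_totX N M x
  let k : ℕ := (m₀ - n).toNat
  let x' : totX N M (n + 2 * k) := ⟨x, hm₀ _ (by omega)⟩
  have hx' : x' ∈ (serre γ N M).cocycles (n + 2 * k) := by
    refine (mem_cocycles_iff N M γ _).2 ?_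
    rw [D_periodic]
    exact hx
  exact ⟨k, ⟨x', hx'⟩, rfl⟩

/-- A primitive in the periodic complex has finite support, so it becomes a Serre cochain after
multiplication by a power of `b`. -/
lemma totFrac_eq_zero_iff (n m : ℤ) (k : ℕ) (hm : m = n + 2 * k) (x : (serre γ N M).cocycles m) :
    totFrac n m k hm x = 0 ↔ ∃ (j : ℕ) (w : (serre γ N M).K.X (m + 2 * j - 1)),
      ((serre γ N M).K.d (m + 2 * j - 1) (m + 2 * j)).hom w = b γ N M j m (m + 2 * j) rfl x.1 := by
  rw [totFrac_apply, HomologyMod.mk_eq_zero_iff, inclCocycles_val]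
  have e (j : ℕ) : D γ N M (m + 2 * j - 1) = D γ N M (n - 1) :=
    D_of_eq γ N M (show m + 2 * (j : ℤ) - 1 = n - 1 + 2 * (k + j : ℕ) by push_cast; omega)
  constructor
  · rintro ⟨w, hw⟩
    obtain ⟨m₀, hm₀⟩ := exists_forall_mem_totX N M w
    let j : ℕ := (m₀ + 1 - m).toNat
    let w' : totX N M (m + 2 * j - 1) := ⟨w, hm₀ _ (by omega)⟩
    refine ⟨j, w', (serre_d_eq_iff γ N M (by ring) w' _).2 ?_⟩
    rw [e]
    exact hw
  · rintro ⟨j, w, hw⟩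
    have h := (serre_d_eq_iff γ N M (by ring) w _).1 hw
    rw [e] at h
    exact ⟨_, h⟩

lemma totPeriod_totFrac (n m : ℤ) (k : ℕ) (hm : m = n + 2 * ((k + 1 : ℕ) : ℤ))
    (hm' : m = n + 1 + 1 + 2 * k) (x : (serre γ N M).cocycles m) :
    totPeriod N M γ n (totFrac n m (k + 1) hm x) = totFrac (n + 1 + 1) m k hm' x := by
  rw [totFrac_apply, totFrac_apply]
  refine totPeriod_mk N M γ n _ _ ?_
  rw [inclCocycles_val, inclCocycles_val]

/-- The abutment, given isomorphisms as in `exists_totEquiv`. -/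
def abutment (ψ : ∀ n, TotH N M γ n ≃ₗ[R] tateCohomology M n)
    (hψ : ∀ n (x : TotH N M γ n), ψ (n + 1 + 1) (totPeriod N M γ n x) =
      periodicity M γ hγ n (ψ n x)) : Abutment γ N M hγ where
  frac n m k hm := (ψ n).toLinearMap ∘ₗ totFrac n m k hm
  frac_b n m m' k j hm hm' h x x' hx := congrArg (ψ n) (totFrac_b n m m' k j hm hm' h x x' hx)
  exists_frac n y := by
    obtain ⟨k, x, hx⟩ := exists_totFrac n ((ψ n).symm y)
    exact ⟨k, x, (congrArg (ψ n) hx).trans ((ψ n).apply_symm_apply y)⟩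
  frac_eq_zero_iff n m k hm x :=
    (map_eq_zero_iff (ψ n) (ψ n).injective).trans (totFrac_eq_zero_iff n m k hm x)
  periodicity_frac n m k hm hm' x :=
    (hψ n _).symm.trans (congrArg (ψ (n + 1 + 1)) (totPeriod_totFrac n m k hm hm' x))

end Abutment

end SerreTate

/-! ### Group cohomology of finite cyclic groups -/

namespace Rep.FiniteCyclicGroup

variable {R Q : Type u} [CommRing R] [CommGroup Q] [Fintype Q] (A : Rep.{u} R Q) (g : Q)

/-- The differentials of the periodic complex computing the cohomology of a cyclic group with
generator `g`. -/
def cyclicD (p : ℕ) : A.V →ₗ[R] A.V := if Even p then A.ρ g - LinearMap.id else A.ρ.norm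

lemma moduleCatCochainComplex_d_apply (p : ℕ) (x : A.V) :
    ((moduleCatCochainComplex A g).d p (p + 1)).hom x = cyclicD A g p x := by
  have h : (ComplexShape.up ℕ).Rel p (p + 1) := rfl
  unfold cyclicD
  by_cases hp : Even p
  · have e : (moduleCatCochainComplex A g).d p (p + 1) =
        ModuleCat.ofHom (applyAsHom A g - 𝟙 A).hom.toLinearMap := (dif_pos h).trans (dif_pos hp)
    rw [e, if_pos hp]
    simp [sub_hom, applyAsHom]
    rfl
  · have e : (moduleCatCochainComplex A g).d p (p + 1) =
        ModuleCat.ofHom A.norm.hom.toLinearMap := (dif_pos h).trans (dif_neg hp)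
    rw [e, if_neg hp]
    rfl

variable (hg : ∀ x, x ∈ Subgroup.zpowers g)

/-- Elements killed by the differential of the periodic complex. -/
def toKer (p : ℕ) : LinearMap.ker (cyclicD A g p) →ₗ[R]
    LinearMap.ker ((moduleCatCochainComplex A g).d p (p + 1)).hom :=
  LinearMap.codRestrict _ (show _ →ₗ[R] (moduleCatCochainComplex A g).X p from
    (LinearMap.ker (cyclicD A g p)).subtype) fun x =>
      (moduleCatCochainComplex_d_apply A g p x.1).trans x.2

lemma toKer_surjective (p : ℕ) : Function.Surjective (toKer A g p) := fun x =>
  ⟨⟨x.1, (moduleCatCochainComplex_d_apply A g p x.1).symm.trans x.2⟩, rfl⟩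

/-- The identification of group cohomology with the cohomology of the periodic complex. -/
def cyclicIso (p : ℕ) : (moduleCatCochainComplex A g).homology p ≃ₗ[R] groupCohomology A p :=
  (groupCohomologyIso A p (resolution R g hg) ≪≫
    HomologicalComplex.homologyMapIso (homResolutionIso A g hg) p).symm.toLinearEquiv

/-- The cohomology class of an element killed by the differential of the periodic complex. -/
def cyclicClass (p : ℕ) : LinearMap.ker (cyclicD A g p) →ₗ[R] groupCohomology A p :=
  (cyclicIso A g hg p).toLinearMap ∘ₗ
    (moduleCatCochainComplex A g).classOf p (p + 1) (CochainComplex.next ℕ p) ∘ₗ toKer A g p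

lemma cyclicClass_surjective (p : ℕ) : Function.Surjective (cyclicClass A g hg p) :=
  (cyclicIso A g hg p).surjective.comp
    (((moduleCatCochainComplex A g).classOf_surjective p (p + 1)
      (CochainComplex.next ℕ p)).comp (toKer_surjective A g p))

lemma cyclicClass_eq_zero_iff (p i : ℕ) (hi : (ComplexShape.up ℕ).prev p = i)
    (x : LinearMap.ker (cyclicD A g p)) : cyclicClass A g hg p x = 0 ↔
      ∃ y : (moduleCatCochainComplex A g).X i,
        ((moduleCatCochainComplex A g).d i p).hom y = (toKer A g p x).1 :=
  (map_eq_zero_iff (cyclicIso A g hg p) (cyclicIso A g hg p).injective).trans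
    ((moduleCatCochainComplex A g).classOf_eq_zero_iff i p (p + 1) hi (CochainComplex.next ℕ p) _)

lemma cyclicClass_zero_eq_zero_iff (x : LinearMap.ker (cyclicD A g 0)) :
    cyclicClass A g hg 0 x = 0 ↔ x.1 = 0 := by
  rw [cyclicClass_eq_zero_iff A g hg 0 0 CochainComplex.prev_nat_zero]
  -- In `ComplexShape.up ℕ` the predecessor of `0` is the default value `0`, with zero differential,
  -- so there are no boundaries in degree `0`.
  have h : ¬ (ComplexShape.up ℕ).Rel 0 0 := Nat.succ_ne_zero 0
  rw [HomologicalComplex.shape _ _ _ h]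
  exact ⟨fun ⟨y, hy⟩ => hy.symm, fun h => ⟨0, h.symm⟩⟩

lemma cyclicClass_succ_eq_zero_iff (p : ℕ) (x : LinearMap.ker (cyclicD A g (p + 1))) :
    cyclicClass A g hg (p + 1) x = 0 ↔ ∃ y, cyclicD A g p y = x.1 := by
  rw [cyclicClass_eq_zero_iff A g hg (p + 1) p (CochainComplex.prev_nat_succ p)]
  exact exists_congr fun y =>
    iff_of_eq (congrArg (· = x.1) (moduleCatCochainComplex_d_apply A g p y))

end Rep.FiniteCyclicGroup

namespace SerreTate

open Rep.FiniteCyclicGroup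

/-! ### Cohomology of the cyclic quotient with coefficients in a column -/

section Classes

variable {R G : Type u} [CommRing R] [CommGroup G] (γ : G) (N : Subgroup G) (M : Rep.{u} R G)

variable {N M} {d' d : Inner N M →ₗ[R] Inner N M}
  (h' : ∀ c, conjRep N M c ∘ₗ d' = d' ∘ₗ conjRep N M c)
  (h : ∀ c, conjRep N M c ∘ₗ d = d ∘ₗ conjRep N M c)

/-- The homology of a pair of equivariant endomorphisms, as a representation of `G ⧸ N`. -/
abbrev colRepOf : Rep.{u} R (G ⧸ N) := Rep.of (HomologyMod.rep (conjRep N M) d' d h' h)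

lemma forall_mem_zpowers_mk {γ : G} (hγ : ∀ x, x ∈ Subgroup.zpowers γ) (x : G ⧸ N) :
    x ∈ Subgroup.zpowers (γ : G ⧸ N) := by
  obtain ⟨g, rfl⟩ := QuotientGroup.mk_surjective x
  obtain ⟨k, rfl⟩ := hγ g
  exact ⟨k, rfl⟩

include h in
lemma conj_mem_ker (g : G) {x : Inner N M} (hx : x ∈ LinearMap.ker d) :
    conj N M g x ∈ LinearMap.ker d := by
  rw [LinearMap.mem_ker, ← conjRep_mk, ← LinearMap.comp_apply, ← h, LinearMap.comp_apply,
    LinearMap.mem_ker.1 hx, map_zero]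

include h in
lemma dH_mem_ker (p : ℕ) {x : Inner N M} (hx : x ∈ LinearMap.ker d) :
    dH γ N M p x ∈ LinearMap.ker d := by
  unfold dH
  split_ifs
  · exact Submodule.sub_mem _ (conj_mem_ker h γ hx) hx
  · rw [LinearMap.sum_apply]
    exact Submodule.sum_mem _ fun j _ => conj_mem_ker h _ hx

variable [Fintype (G ⧸ N)] (hγ : ∀ x, x ∈ Subgroup.zpowers γ)

include hγ in
-- The horizontal differential induces on column cohomology exactly the differential of the periodic
-- complex of `G ⧸ N` with generator the image of `γ`.
lemma cyclicD_mk (p : ℕ) (x y : LinearMap.ker d) (hxy : dH γ N M p x.1 = y.1) :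
    cyclicD (colRepOf h' h) (γ : G ⧸ N) p (HomologyMod.mk d' d x) = HomologyMod.mk d' d y := by
  have hx : ∀ c, conjRep N M c x.1 ∈ LinearMap.ker d := fun c => by
    obtain ⟨g, rfl⟩ := QuotientGroup.mk_surjective c
    exact conj_mem_ker h g x.2
  have e : ∀ c, HomologyMod.rep (conjRep N M) d' d h' h c (HomologyMod.mk d' d x) =
      HomologyMod.mk d' d ⟨_, hx c⟩ := fun c => HomologyMod.rep_mk _ _ _ _ _ _ _ _ rfl
  rcases Nat.even_or_odd p with hp | hp
  · rw [cyclicD, if_pos hp]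
    refine (congrArg (· - HomologyMod.mk d' d x) (e γ)).trans ?_
    rw [← map_sub]
    refine congrArg _ (Subtype.ext ?_)
    rw [← hxy, dH_of_even N M γ hp]
    rfl
  · rw [cyclicD, if_neg (Nat.not_even_iff_odd.2 hp), Representation.norm, LinearMap.sum_apply]
    refine (Finset.sum_congr rfl fun c _ => e c).trans ?_
    rw [← map_sum]
    refine congrArg _ (Subtype.ext ?_)
    rw [← hxy, dH_of_odd N M γ hγ hp, Representation.norm, LinearMap.sum_apply,
      AddSubmonoidClass.coe_finsetSum]

/-- Elements of bidegree `(p, q)` that are killed by the differentials of the first two pages. -/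
def colCocycles (d' d : Inner N M →ₗ[R] Inner N M) (p : ℕ) : Submodule R (Inner N M) :=
  LinearMap.ker d ⊓ (LinearMap.range d').comap (dH γ N M p)

/-- The class in the group cohomology of `G ⧸ N` of an element of `colCocycles`. -/
def colClass (p : ℕ) :
    colCocycles γ d' d p →ₗ[R] groupCohomology (colRepOf h' h) p :=
  cyclicClass (colRepOf h' h) (γ : G ⧸ N) (forall_mem_zpowers_mk hγ) p ∘ₗ
    LinearMap.codRestrict _ (HomologyMod.mk d' d ∘ₗ Submodule.inclusion inf_le_left) fun x =>
      (cyclicD_mk γ h' h hγ p _ ⟨_, dH_mem_ker γ h p x.2.1⟩ rfl).trans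
        ((HomologyMod.mk_eq_zero_iff _).2 x.2.2)

lemma colClass_apply (p : ℕ) (x : colCocycles γ d' d p) : colClass γ h' h hγ p x =
    cyclicClass (colRepOf h' h) (γ : G ⧸ N) (forall_mem_zpowers_mk hγ) p
      ⟨HomologyMod.mk d' d ⟨x.1, x.2.1⟩, (cyclicD_mk γ h' h hγ p _ ⟨_, dH_mem_ker γ h p x.2.1⟩
        rfl).trans ((HomologyMod.mk_eq_zero_iff _).2 x.2.2)⟩ := rfl

lemma colClass_surjective (p : ℕ) : Function.Surjective (colClass γ h' h hγ p) := by
  intro y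
  obtain ⟨⟨z, hz⟩, rfl⟩ := cyclicClass_surjective (colRepOf h' h) (γ : G ⧸ N)
    (forall_mem_zpowers_mk hγ) p y
  obtain ⟨x, rfl⟩ := HomologyMod.mk_surjective d' d z
  have e := cyclicD_mk γ h' h hγ p x ⟨_, dH_mem_ker γ h p x.2⟩ rfl
  have hx : x.1 ∈ colCocycles γ d' d p :=
    ⟨x.2, (HomologyMod.mk_eq_zero_iff _).1 (e.symm.trans hz)⟩
  exact ⟨⟨x.1, hx⟩, rfl⟩

lemma colClass_zero_eq_zero_iff (x : colCocycles γ d' d 0) :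
    colClass γ h' h hγ 0 x = 0 ↔ ∃ w, d' w = x.1 := by
  rw [colClass_apply, cyclicClass_zero_eq_zero_iff]
  exact HomologyMod.mk_eq_zero_iff _

/-- A boundary in the cyclic complex of column cohomology lifts to a horizontal differential of a
vertical cocycle, up to a vertical coboundary `d' w`. -/
lemma colClass_succ_eq_zero_iff (p : ℕ) (x : colCocycles γ d' d (p + 1)) :
    colClass γ h' h hγ (p + 1) x = 0 ↔ ∃ y w, d y = 0 ∧ dH γ N M p y + d' w = x.1 := by
  rw [colClass_apply, cyclicClass_succ_eq_zero_iff]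
  constructor
  · rintro ⟨z, hz⟩
    obtain ⟨y, rfl⟩ := HomologyMod.mk_surjective d' d z
    have e := cyclicD_mk γ h' h hγ p y ⟨_, dH_mem_ker γ h p y.2⟩ rfl
    obtain ⟨w, hw⟩ := (HomologyMod.mk_eq_mk_iff _ _).1 (hz.symm.trans e)
    exact ⟨y.1, w, y.2, by rw [hw]; exact add_sub_cancel _ _⟩
  · rintro ⟨y, w, hy, e⟩
    refine ⟨HomologyMod.mk d' d ⟨y, hy⟩,
      (cyclicD_mk γ h' h hγ p ⟨y, hy⟩ ⟨_, dH_mem_ker γ h p hy⟩ rfl).trans ?_⟩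
    refine ((HomologyMod.mk_eq_mk_iff _ _).2 ⟨w, ?_⟩).symm
    exact (sub_eq_of_eq_add' e.symm).symm

lemma map_colClass {d₁' d₁ : Inner N M →ₗ[R] Inner N M}
    (h₁' : ∀ c, conjRep N M c ∘ₗ d₁' = d₁' ∘ₗ conjRep N M c)
    (h₁ : ∀ c, conjRep N M c ∘ₗ d₁ = d₁ ∘ₗ conjRep N M c) (e' : d' = d₁') (e : d = d₁)
    (β : colRepOf h' h ⟶ colRepOf h₁' h₁) (hβ : ∀ x, β.hom x = HomologyMod.congr e' e x) (p : ℕ)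
    (x : colCocycles γ d' d p) (x₁ : colCocycles γ d₁' d₁ p) (hx : x.1 = x₁.1) :
    ((groupCohomology.functor R (G ⧸ N) p).map β).hom (colClass γ h' h hγ p x) =
      colClass γ h₁' h₁ hγ p x₁ := by
  subst e' e
  obtain rfl : x = x₁ := Subtype.ext hx
  -- Once the pairs of differentials are literally equal, `β` is the identity; this is how the
  -- identity nature of `b` on cochains enters.
  have : β = 𝟙 _ := by
    ext y
    exact (hβ (HomologyMod.mk d' d y)).trans (HomologyMod.congr_mk rfl rfl y y rfl)
  rw [this, CategoryTheory.Functor.map_id]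
  rfl

end Classes

/-! ### The second page of the periodic complex -/

section SecondPage

lemma sub_mem_filX {R G : Type u} [CommRing R] [CommGroup G] (N : Subgroup G)
    (M : Rep.{u} R G) {p : ℕ} {x y : ℕ →₀ Inner N M} (hx : x ∈ filX N M p) (hy : y ∈ filX N M p)
    (h : x p = y p) : x - y ∈ filX N M (p + 1) := by
  intro i hi
  rw [Finsupp.sub_apply]
  by_cases hip : i = p
  · rw [hip, h, sub_self]
  · rw [hx i (by omega), hy i (by omega), sub_zero]

variable {R G : Type u} [CommRing R] [CommGroup G] [Fintype G] (γ : G)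
  (N : Subgroup G) (M : Rep.{u} R G)

lemma neg_one_pow_smul_smul {V : Type*} [AddCommGroup V] (p : ℕ) (x : V) :
    ((-1 : ℤ) ^ p) • ((-1 : ℤ) ^ p) • x = x := by
  rw [smul_smul, ← mul_pow]
  simp

lemma dV_apply_eq_zero {p : ℕ} {n q : ℤ} (hn : n = p + q) {x : ℕ →₀ Inner N M}
    (hx : x ∈ filX N M p) (hD : D γ N M n x ∈ filX N M (p + 1)) : dV γ N M q (x p) = 0 := by
  have h := hD p (by omega)
  rcases p with _ | p
  · rw [D_apply_zero] at h
    rwa [show q = n by simpa using hn.symm]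
  · rw [D_apply_succ, hx p (by push_cast; omega), map_zero, zero_add,
      show n - ((p + 1 : ℕ) : ℤ) = q by omega] at h
    rw [← neg_one_pow_smul_smul (p + 1) (dV γ N M q (x (p + 1))), h, smul_zero]

lemma exists_dV_eq_dH {p : ℕ} {n q : ℤ} (hn : n = p + q) {x : ℕ →₀ Inner N M}
    (hD : D γ N M n x (p + 1) = 0) : ∃ y, dV γ N M (q - 1) y = dH γ N M p (x p) := by
  refine ⟨-((-1 : ℤ) ^ (p + 1)) • x (p + 1), ?_⟩
  rw [D_apply_succ, show n - ((p + 1 : ℕ) : ℤ) = q - 1 by push_cast; omega] at hD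
  rw [neg_smul, map_neg, map_zsmul]
  exact (eq_neg_of_add_eq_zero_left hD).symm

/-- The component in bidegree `(p, q)` of an element of `Z_2^{p,q}`. -/
def colComponent (p : ℕ) (n q : ℤ) (hn : n = p + q) :
    (periodic γ N M).Z 2 p n →ₗ[R] colCocycles γ (dV γ N M (q - 1)) (dV γ N M q) p :=
  LinearMap.restrict (p := (periodic γ N M).Z 2 p n)
    (show (ℕ →₀ Inner N M) →ₗ[R] Inner N M from Finsupp.lapply p) fun x hx => by
      have h := (mem_periodic_Z γ N M).1 hx
      exact ⟨dV_apply_eq_zero γ N M hn h.1 (filX_anti N M (by omega) h.2),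
        exists_dV_eq_dH γ N M hn (h.2 (p + 1) (by push_cast; omega))⟩

lemma colComponent_val (p : ℕ) (n q : ℤ) (hn : n = p + q) (x : (periodic γ N M).Z 2 p n) :
    (colComponent γ N M p n q hn x).1 = (show ℕ →₀ Inner N M from x.1) p := rfl

/-- Given `a` and `y` with `d_V y = d_H a`, place `a` in column `p` and correct it in column `p + 1`
by `y`, with the sign that cancels `d_H a`. The remaining error is in column `p + 2`, as `Z_2`
allows. -/
lemma colComponent_surjective (p : ℕ) (n q : ℤ) (hn : n = p + q) :
    Function.Surjective (colComponent γ N M p n q hn) := by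
  rintro ⟨a, ha, y, hy⟩
  let x : ℕ →₀ Inner N M :=
    Finsupp.single p a - Finsupp.single (p + 1) (((-1 : ℤ) ^ (p + 1)) • y)
  have hx : x ∈ (periodic γ N M).Z 2 p n := by
    refine (mem_periodic_Z γ N M).2 ⟨fun i hi => ?_, fun i hi => ?_⟩
    · simp only [x, Finsupp.sub_apply]
      rw [Finsupp.single_eq_of_ne (by omega), Finsupp.single_eq_of_ne (by omega), sub_zero]
    · simp only [x, map_sub, D_single, Finsupp.sub_apply, Finsupp.add_apply, Finsupp.smul_apply]
      rw [show n - p = q by omega, LinearMap.mem_ker.1 ha, Finsupp.single_zero,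
        show n - (p + 1 : ℕ) = q - 1 by push_cast; omega, map_zsmul (dV γ N M (q - 1)), hy]
      by_cases hi' : i = p + 1
      · subst hi'
        rw [Finsupp.single_eq_same, Finsupp.single_eq_same,
          Finsupp.single_eq_of_ne (a := p + 1 + 1) (by omega), neg_one_pow_smul_smul]
        simp
      · rw [Finsupp.single_eq_of_ne (by omega), Finsupp.single_eq_of_ne (by omega),
          Finsupp.single_eq_of_ne (by omega)]
        simp
  refine ⟨⟨x, hx⟩, Subtype.ext ?_⟩
  rw [colComponent_val]
  simp [x]

/-- The summand in `Z_{r-1}^{p+1}` is `x - D w`: its differential is that of `x`, so only its own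
filtration has to be checked. -/
lemma mem_periodic_B_of_sub {r p n : ℤ} {x w : ℕ →₀ Inner N M}
    (hx : x ∈ (show Submodule R (ℕ →₀ Inner N M) from (periodic γ N M).Z r p n))
    (hw : w ∈ filX N M (p - r + 1)) (hD : D γ N M (n - 1) w ∈ filX N M p)
    (h : x - D γ N M (n - 1) w ∈ filX N M (p + 1)) :
    x ∈ (show Submodule R (ℕ →₀ Inner N M) from (periodic γ N M).B r p n) := by
  refine (mem_periodic_B γ N M).2 ⟨_, w, ⟨h, ?_⟩, ⟨hw, hD⟩, (sub_add_cancel _ _).symm⟩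
  rw [map_sub, D_comp_D, sub_zero]
  exact ((mem_periodic_Z γ N M).1 hx).2

variable [Fintype (G ⧸ N)] (hγ : ∀ x, x ∈ Subgroup.zpowers γ)

/-- The cohomology of the columns, as a representation of `G ⧸ N`. -/
abbrev colRepAt (q : ℤ) : Rep.{u} R (G ⧸ N) :=
  colRepOf (conjRep_dV N M γ (q - 1)) (conjRep_dV N M γ q)

/-- The class in the group cohomology of `G ⧸ N` of an element of `Z_2^{p,q}`. -/
def secondClass (p : ℕ) (n q : ℤ) (hn : n = p + q) :
    (periodic γ N M).Z 2 p n →ₗ[R] groupCohomology (colRepAt γ N M q) p :=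
  colClass γ (conjRep_dV N M γ (q - 1)) (conjRep_dV N M γ q) hγ p ∘ₗ colComponent γ N M p n q hn

lemma secondClass_surjective (p : ℕ) (n q : ℤ) (hn : n = p + q) :
    Function.Surjective (secondClass γ N M hγ p n q hn) := by
  intro y
  obtain ⟨a, rfl⟩ :=
    colClass_surjective γ (conjRep_dV N M γ (q - 1)) (conjRep_dV N M γ q) hγ p y
  obtain ⟨x, rfl⟩ := colComponent_surjective γ N M p n q hn a
  exact ⟨x, rfl⟩

/-- Membership in `B_2` is decided by the component in column `p`, since everything further right is
absorbed by the first summand. In column `0` no horizontal differential arrives, which is why that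
case is separate. -/
lemma secondClass_eq_zero_iff (p : ℕ) (n q : ℤ) (hn : n = p + q) (x : (periodic γ N M).Z 2 p n) :
    secondClass γ N M hγ p n q hn x = 0 ↔ (periodic γ N M).cls 2 p n x = 0 := by
  rw [FilteredComplex.cls_eq_zero_iff]
  obtain ⟨hxp, hxD⟩ := (mem_periodic_Z γ N M).1 x.2
  rcases p with _ | p
  · refine (colClass_zero_eq_zero_iff γ (conjRep_dV N M γ (q - 1)) (conjRep_dV N M γ q) hγ
      (colComponent γ N M 0 n q hn x)).trans ⟨?_, ?_⟩
    · rintro ⟨w, hw⟩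
      rw [colComponent_val, show q - 1 = n - 1 by push_cast at hn; omega] at hw
      refine mem_periodic_B_of_sub γ N M (w := Finsupp.single 0 w) x.2 ?_ ?_ ?_
      · rw [filX_eq_top N M (by simp)]
        trivial
      · rw [filX_eq_top N M (by simp)]
        trivial
      · refine sub_mem_filX N M hxp (by rw [filX_eq_top N M (by simp)]; trivial) ?_
        rw [D_apply_zero, Finsupp.single_eq_same, hw]
    · intro hx
      obtain ⟨y, w, hy, hw, e⟩ := (mem_periodic_B γ N M).1 hx
      refine ⟨w 0, ?_⟩
      rw [colComponent_val, e, Finsupp.add_apply, hy.1 0 (by simp), D_apply_zero, zero_add,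
        show q - 1 = n - 1 by push_cast at hn; omega]
  · have e1 : n - 1 - (p : ℤ) = q := by push_cast at hn; omega
    have e2 : n - 1 - ((p + 1 : ℕ) : ℤ) = q - 1 := by push_cast at hn ⊢; omega
    refine (colClass_succ_eq_zero_iff γ (conjRep_dV N M γ (q - 1)) (conjRep_dV N M γ q) hγ p
      (colComponent γ N M (p + 1) n q hn x)).trans ⟨?_, ?_⟩
    · rintro ⟨y, w, hy, hw⟩
      rw [colComponent_val] at hw
      -- The cochain whose differential has component `d_H y + d_V w` in column `p + 1`; the sign
      -- undoes the one in the total differential. Its component in column `p + 2` is irrelevant.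
      let v : ℕ →₀ Inner N M :=
        Finsupp.single p y + Finsupp.single (p + 1) (((-1 : ℤ) ^ (p + 1)) • w)
      have hv : ∀ i, i ≤ p + 1 → D γ N M (n - 1) v i =
          (Finsupp.single (p + 1) (dH γ N M p y + dV γ N M (q - 1) w)) i := by
        intro i hi
        simp only [v, map_add, D_single, Finsupp.add_apply, Finsupp.smul_apply]
        rw [e1, e2, hy, map_zsmul (dV γ N M (q - 1)), Finsupp.single_zero,
          Finsupp.single_eq_of_ne (a := p + 1 + 1) (by omega)]
        by_cases hi' : i = p + 1
        · subst hi'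
          simp only [Finsupp.single_eq_same]
          rw [neg_one_pow_smul_smul]
          simp
        · simp [Finsupp.single_eq_of_ne hi']
      have hvp : D γ N M (n - 1) v ∈ filX N M ((p + 1 : ℕ) : ℤ) := fun i hi => by
        rw [hv i (by omega), Finsupp.single_eq_of_ne (by omega)]
      refine mem_periodic_B_of_sub γ N M (w := v) x.2 (fun i hi => ?_) hvp ?_
      · simp only [v, Finsupp.add_apply]
        rw [Finsupp.single_eq_of_ne (by push_cast at hi; omega),
          Finsupp.single_eq_of_ne (by push_cast at hi; omega), add_zero]
      · refine sub_mem_filX N M hxp hvp ?_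
        rw [hv _ le_rfl, Finsupp.single_eq_same, hw]
    · intro hx
      obtain ⟨y, w, hy, hw, e⟩ := (mem_periodic_B γ N M).1 hx
      refine ⟨w p, ((-1 : ℤ) ^ (p + 1)) • w (p + 1), ?_, ?_⟩
      · refine dV_apply_eq_zero γ N M (n := n - 1) (by omega)
          (filX_anti N M (by push_cast; omega) hw.1) ?_
        exact filX_anti N M (by push_cast; omega) hw.2
      · rw [colComponent_val, e, Finsupp.add_apply, hy.1 (p + 1) (by push_cast; omega), zero_add,
          D_apply_succ, e2, map_zsmul]

/-- The second page is the group cohomology of `G ⧸ N` with coefficients in the cohomology of the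
columns. -/
def secondPageEquiv (p : ℕ) (n q : ℤ) (hn : n = p + q) :
    (periodic γ N M).Page 2 p n ≃ₗ[R] groupCohomology (colRepAt γ N M q) p :=
  LinearMap.equivOfKerEq ((periodic γ N M).cls 2 p n) (secondClass γ N M hγ p n q hn)
    ((periodic γ N M).cls_surjective 2 p n) (secondClass_surjective γ N M hγ p n q hn)
    fun x => (secondClass_eq_zero_iff γ N M hγ p n q hn x).symm

lemma secondPageEquiv_cls (p : ℕ) (n q : ℤ) (hn : n = p + q) (x : (periodic γ N M).Z 2 p n) :
    secondPageEquiv γ N M hγ p n q hn ((periodic γ N M).cls 2 p n x) =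
      secondClass γ N M hγ p n q hn x :=
  LinearMap.equivOfKerEq_apply _ _ _ _ _ x

end SecondPage

end SerreTate

namespace SerreTate

/-! ### The second page -/

section SecondPageTate

variable {R G : Type u} [CommRing R] [CommGroup G] [Fintype G] {γ : G} {N : Subgroup G}
  [Fintype N] {M : Rep.{u} R G} {q : ℤ}

/-- The action of `G ⧸ N` on `Ĥ^q(N; M)`. -/
def tateRho (ψ : ColTateEquiv N M γ q) :
    Representation R (G ⧸ N) (tateCohomology (Rep.res N.subtype M) q) where
  toFun c := ψ.1.toLinearMap ∘ₗ colRep N M γ q c ∘ₗ ψ.1.symm.toLinearMap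
  map_one' := by
    ext x
    simp
  map_mul' c c' := by
    ext x
    simp

lemma tateRho_apply (ψ : ColTateEquiv N M γ q) (c : G ⧸ N) (x : ColH N M γ q) :
    tateRho ψ c (ψ.1 x) = ψ.1 (colRep N M γ q c x) :=
  congrArg (fun y => ψ.1 (colRep N M γ q c y)) (ψ.1.symm_apply_apply x)

/-- By equivariance of `ψ` the transported action is the intrinsic one, so it does not depend on the
choice of `ψ`. -/
lemma tateRho_mk (ψ : ColTateEquiv N M γ q) (g : G) :
    tateRho ψ (g : G ⧸ N) = tateAct N M q g := by
  refine LinearMap.ext fun y => ?_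
  obtain ⟨x, rfl⟩ := ψ.1.surjective y
  rw [tateRho_apply, ψ.2]

/-- The isomorphism of representations given by a `ColTateEquiv`. -/
def tateRepIso (ψ : ColTateEquiv N M γ q) : colRepAt γ N M q ≅ Rep.of (tateRho ψ) where
  hom := Rep.ofHom ⟨ψ.1.toLinearMap, fun c => LinearMap.ext fun x => (tateRho_apply ψ c x).symm⟩
  inv := Rep.ofHom ⟨ψ.1.symm.toLinearMap, fun c => LinearMap.ext fun y => by
    obtain ⟨x, rfl⟩ := ψ.1.surjective y
    refine (congrArg ψ.1.symm (tateRho_apply ψ c x)).trans ?_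
    refine (ψ.1.symm_apply_apply _).trans ?_
    exact (congrArg (colRep N M γ q c) (ψ.1.symm_apply_apply x)).symm⟩
  hom_inv_id := Rep.hom_ext (Representation.IntertwiningMap.ext
    (LinearMap.ext fun x => ψ.1.symm_apply_apply x))
  inv_hom_id := Rep.hom_ext (Representation.IntertwiningMap.ext
    (LinearMap.ext fun x => ψ.1.apply_symm_apply x))

/-- The periodicity of the cohomology of the columns, as a map of representations. -/
def colPeriodHom (γ : G) (N : Subgroup G) (M : Rep.{u} R G) (q : ℤ) :
    colRepAt γ N M q ⟶ colRepAt γ N M (q + 1 + 1) :=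
  Rep.ofHom ⟨(colPeriod N M γ q).toLinearMap, fun c => LinearMap.ext fun x =>
    colPeriod_rep N M γ q c x⟩

variable {σ : N} {hσ : ∀ x, x ∈ Subgroup.zpowers σ}

/-- The periodicity of `Ĥ^*(N; M)`, as a map of representations of `G ⧸ N`. -/
def tatePeriodHom (ψ : ColTateEquiv N M γ q) (ψ' : ColTateEquiv N M γ (q + 1 + 1))
    (hψ : ∀ x, ψ'.1 (colPeriod N M γ q x) =
      periodicity (Rep.res N.subtype M) σ hσ q (ψ.1 x)) :
    Rep.of (tateRho ψ) ⟶ Rep.of (tateRho ψ') :=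
  Rep.ofHom ⟨periodicity (Rep.res N.subtype M) σ hσ q, fun c => LinearMap.ext fun y => by
    obtain ⟨x, rfl⟩ := ψ.1.surjective y
    rw [LinearMap.comp_apply, LinearMap.comp_apply, tateRho_apply, ← hψ, ← hψ, tateRho_apply,
      colPeriod_rep]⟩

lemma tateRepIso_hom_tatePeriodHom (ψ : ColTateEquiv N M γ q)
    (ψ' : ColTateEquiv N M γ (q + 1 + 1)) (hψ : ∀ x, ψ'.1 (colPeriod N M γ q x) =
      periodicity (Rep.res N.subtype M) σ hσ q (ψ.1 x)) :
    (tateRepIso ψ).hom ≫ tatePeriodHom ψ ψ' hψ =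
      colPeriodHom γ N M q ≫ (tateRepIso ψ').hom :=
  Rep.hom_ext (Representation.IntertwiningMap.ext (LinearMap.ext fun x => (hψ x).symm))

variable [Fintype (G ⧸ N)] (hγ : ∀ x, x ∈ Subgroup.zpowers γ)

/-- The second page in terms of the Tate cohomology of `N`. -/
def secondPageIso (ψ : ColTateEquiv N M γ q) (p : ℕ) :
    ((periodic γ N M).spectralSequence.page 2 le_rfl).X ((p : ℤ), q) ≅
      groupCohomology (Rep.of (tateRho ψ)) p :=
  show ModuleCat.of R ((periodic γ N M).Page 2 p (p + q)) ≅ _ from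
  (secondPageEquiv γ N M hγ p (p + q) q rfl).toModuleIso ≪≫
    (groupCohomology.functor R (G ⧸ N) p).mapIso (tateRepIso ψ)

lemma secondPageIso_frac (ψ : ColTateEquiv N M γ q) (p : ℕ) (n : ℤ) (k : ℕ)
    (hn : n = p + q + 2 * k) (x : (serre γ N M).Z 2 (p : ℤ) n) :
    (secondPageIso hγ ψ p).hom.hom ((localization γ N M).frac 2 le_rfl p q n k hn
      ((serre γ N M).cls 2 p n x)) =
    ((groupCohomology.functor R (G ⧸ N) p).map (tateRepIso ψ).hom).hom
      (secondClass γ N M hγ p (p + q) q rfl (inclZ γ N M 2 p (p + q) n k hn x)) :=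
  congrArg ((groupCohomology.functor R (G ⧸ N) p).map (tateRepIso ψ).hom).hom
    (secondPageEquiv_cls γ N M hγ p (p + q) q rfl (inclZ γ N M 2 p (p + q) n k hn x))

omit [Fintype N] in
-- Both sides come from the same component in column `p` of the same cochain, and `colPeriodHom` is
-- the identity on representatives.
lemma map_secondClass (p : ℕ) (n : ℤ) (k : ℕ) (hn : n = p + q + 2 * ((k + 1 : ℕ) : ℤ))
    (hn' : n = p + (q + 1 + 1) + 2 * k) (x : (serre γ N M).Z 2 (p : ℤ) n) :
    ((groupCohomology.functor R (G ⧸ N) p).map (colPeriodHom γ N M q)).hom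
      (secondClass γ N M hγ p (p + q) q rfl (inclZ γ N M 2 p (p + q) n (k + 1) hn x)) =
    secondClass γ N M hγ p (p + (q + 1 + 1)) (q + 1 + 1) rfl
      (inclZ γ N M 2 p (p + (q + 1 + 1)) n k hn' x) := by
  refine map_colClass γ (conjRep_dV N M γ (q - 1)) (conjRep_dV N M γ q) hγ
    (conjRep_dV N M γ (q + 1 + 1 - 1)) (conjRep_dV N M γ (q + 1 + 1))
    (by rw [← dV_two]; congr 1; ring) (dV_two N M γ q).symm (colPeriodHom γ N M q)
    (fun y => rfl) p _ _ ?_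
  rw [colComponent_val, colComponent_val]
  rfl

/-- On the columns this is `map_secondClass`; the square `tateRepIso_hom_tatePeriodHom` carries it
to Tate cohomology by functoriality in the coefficients. -/
lemma secondPageIso_period (ψ : ColTateEquiv N M γ q) (ψ' : ColTateEquiv N M γ (q + 1 + 1))
    (hψ : ∀ x, ψ'.1 (colPeriod N M γ q x) = periodicity (Rep.res N.subtype M) σ hσ q (ψ.1 x))
    (p : ℕ) (n : ℤ) (k : ℕ) (hn : n = p + q + 2 * ((k + 1 : ℕ) : ℤ))
    (hn' : n = p + (q + 1 + 1) + 2 * k) (x : (serre γ N M).Page 2 (p : ℤ) n) :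
    (secondPageIso hγ ψ' p).hom.hom
        ((localization γ N M).frac 2 le_rfl p (q + 1 + 1) n k hn' x) =
      ((groupCohomology.functor R (G ⧸ N) p).map (tatePeriodHom ψ ψ' hψ)).hom
        ((secondPageIso hγ ψ p).hom.hom
          ((localization γ N M).frac 2 le_rfl p q n (k + 1) hn x)) := by
  obtain ⟨x, rfl⟩ := (serre γ N M).cls_surjective 2 p n x
  rw [secondPageIso_frac, secondPageIso_frac, ← map_secondClass hγ p n k hn hn' x]
  have e := congrArg (groupCohomology.functor R (G ⧸ N) p).map
    (tateRepIso_hom_tatePeriodHom ψ ψ' hψ)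
  rw [Functor.map_comp, Functor.map_comp] at e
  exact (LinearMap.congr_fun (congrArg ModuleCat.Hom.hom e) _).symm

end SecondPageTate

/-- Pages in negative horizontal degrees vanish. -/
lemma subsingleton_page {R G : Type u} [CommRing R] [CommGroup G] [Fintype G] (γ : G)
    (N : Subgroup G) (M : Rep.{u} R G) {r p n : ℤ} (hp : p < 0) :
    Subsingleton ((periodic γ N M).Page r p n) := by
  refine subsingleton_of_forall_eq 0 fun x => ?_
  obtain ⟨x, rfl⟩ := (periodic γ N M).cls_surjective r p n x
  rw [FilteredComplex.cls_eq_zero_iff]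
  -- For `p < 0` the steps `p` and `p + 1` of the filtration are both everything, so no correction
  -- `w` is needed.
  refine mem_periodic_B_of_sub γ N M (w := 0) x.2 (zero_mem _) ?_ ?_
  · rw [map_zero]
    exact zero_mem _
  · rw [filX_eq_top N M (by omega)]
    trivial

end SerreTate

namespace SerreTate

/-! ### Multiplication by the square of the outer periodicity class vanishes -/

section Shift

variable {R G : Type u} [CommRing R] [CommGroup G] [Fintype G] (γ : G)
  (N : Subgroup G) (M : Rep.{u} R G)

/-- The shift `K^{p,q} → K^{p+2,q-2}`. -/
def shift : (ℕ →₀ Inner N M) →ₗ[R] (ℕ →₀ Inner N M) :=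
  Finsupp.lmapDomain (Inner N M) R (· + 2)

omit [Fintype G] in
lemma shift_single (p : ℕ) (a : Inner N M) :
    shift N M (Finsupp.single p a) = Finsupp.single (p + 2) a :=
  Finsupp.mapDomain_single

omit [Fintype G] in
lemma shift_injective : Function.Injective (shift N M) :=
  Finsupp.mapDomain_injective (add_left_injective 2)

omit [Fintype G] in
lemma shift_mem_filX {p p' : ℤ} (h : p' = p + 2) {x : ℕ →₀ Inner N M} (hx : x ∈ filX N M p) :
    shift N M x ∈ filX N M p' := by
  intro i hi
  rcases i with _ | _ | i
  · exact Finsupp.mapDomain_of_notMem_range _ _ (by simp)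
  · exact Finsupp.mapDomain_of_notMem_range _ _ (by simp)
  · exact (Finsupp.mapDomain_apply (add_left_injective 2) x i).trans
      (hx i (by push_cast at hi; omega))

omit [Fintype G] in
lemma exists_shift_eq {p p' : ℤ} (h : p' = p + 2) (hp : 0 ≤ p) {x : ℕ →₀ Inner N M}
    (hx : x ∈ filX N M p') : ∃ y ∈ filX N M p, shift N M y = x := by
  refine ⟨x.comapDomain (· + 2) (add_left_injective 2).injOn, fun i hi => ?_, ?_⟩
  · exact hx (i + 2) (by push_cast; omega)
  · refine Finsupp.mapDomain_comapDomain _ (add_left_injective 2) x fun i hi => ?_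
    have : p' ≤ i := not_lt.1 fun h => Finsupp.mem_support_iff.1 hi (hx i h)
    exact ⟨i - 2, by simp only; omega⟩

omit [Fintype G] in
lemma dH_two (p : ℕ) : dH γ N M (p + 2) = dH γ N M p := by
  simp only [dH, Nat.even_add, even_two, iff_true]

/-- Both differentials are 2-periodic, and moving by two columns changes neither the total degree
nor the sign. -/
lemma D_shift (n : ℤ) (x : ℕ →₀ Inner N M) :
    D γ N M n (shift N M x) = shift N M (D γ N M n x) := by
  induction x using Finsupp.induction_linear with
  | zero => simp
  | add x y hx hy => simp only [map_add, hx, hy]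
  | single p a =>
    have e : dV γ N M (n - p) = dV γ N M (n - (p + 2 : ℕ)) := by
      rw [← dV_periodic γ N M (n - (p + 2 : ℕ)) 1]
      congr 1
      push_cast
      ring
    rw [shift_single, D_single, D_single, dH_two, map_add, map_zsmul, shift_single, shift_single,
      pow_add, e, add_right_comm]
    simp

lemma dV_of_even {n : ℤ} (hn : Even n) : dV γ N M n = translate N M γ - LinearMap.id := if_pos hn

lemma dV_of_odd {n : ℤ} (hn : Odd n) : dV γ N M n = ∑ g : G, translate N M g :=
  if_neg (Int.not_even_iff_odd.2 hn)

variable [Fintype N] (hγ : ∀ x, x ∈ Subgroup.zpowers γ)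

/-- The norm of `N` on `M`. -/
abbrev normN : M.V →ₗ[R] M.V := (Rep.res N.subtype M).ρ.norm

omit [Fintype G] in
lemma normN_apply (m : M.V) : normN N M m = ∑ n : N, M.ρ n m :=
  LinearMap.sum_apply _ _ _

omit [Fintype G] in
lemma rho_normN (g : G) (m : M.V) : M.ρ g (normN N M m) = normN N M (M.ρ g m) :=
  (Rep.norm_comm_apply (Rep.resMap N.subtype (M.applyAsHom g)) m).symm

lemma dC_normN (n : ℤ) (m : M.V) : dC M γ n (normN N M m) = normN N M (dC M γ n m) := by
  unfold dC
  split_ifs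
  · rw [LinearMap.sub_apply, LinearMap.sub_apply, map_sub, rho_normN]
    rfl
  · rw [Representation.norm, LinearMap.sum_apply, LinearMap.sum_apply, map_sum]
    exact Finset.sum_congr rfl fun g _ => rho_normN N M g m

lemma dC_of_even {n : ℤ} (hn : Even n) : dC M γ n = M.ρ γ - LinearMap.id := if_pos hn

lemma dC_of_odd {n : ℤ} (hn : Odd n) : dC M γ n = M.ρ.norm :=
  if_neg (Int.not_even_iff_odd.2 hn)

omit [Fintype N] in
include hγ in
lemma forall_rho_eq {n : ℤ} (hn : Even n) {m : M.V} (hm : dC M γ n m = 0) (g : G) :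
    M.ρ g m = m := by
  rw [dC_of_even γ M hn] at hm
  exact (Representation.mem_invariants_iff_of_forall_mem_zpowers M.ρ γ hγ m).2
    (sub_eq_zero.1 hm) g

include hγ in
-- Preparation for `exists_D_eq_shift_sub`. The cochain `delta N M m` in column `1` has horizontal
-- differential `iota N M m` in column `2`; `g` cancels its vertical differential in column `1`, and
-- the vertical differential of `g` is what is left in column `0`.
lemma exists_primitive_delta (n : ℤ) (m : M.V) (hm : dC M γ n m = 0) :
    ∃ (g : Inner N M) (m' : M.V), conj N M γ g - g = dV γ N M n (delta N M m) ∧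
      dV γ N M (n - 1) g = iota N M (dC M γ (n - 1) m' - normN N M m) := by
  have := Fintype.ofFinite (G ⧸ N)
  rcases Int.even_or_odd n with hn | hn
  · have hinv := forall_rho_eq γ M hγ hn hm
    -- For `n` even `m` is `G`-invariant, so conjugation by `γ` undoes translation by `γ` on `delta
    -- N M m`, and `g` is explicit.
    refine ⟨-translate N M γ (delta N M m), 0, ?_, ?_⟩
    · have e : conj N M γ (translate N M γ (delta N M m)) = delta N M m := by
        have e1 := LinearMap.congr_fun (conj_translate N M γ γ) (delta N M m)
        rw [LinearMap.comp_apply, LinearMap.comp_apply, conj_delta, hinv] at e1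
        rw [e1]
        ext x
        simp
      rw [map_neg, e, dV_of_even γ N M hn, LinearMap.sub_apply]
      exact neg_sub_neg _ _
    · have e : dV γ N M (n - 1) (translate N M γ (delta N M m)) = iota N M (normN N M m) := by
        rw [dV_of_odd γ N M (hn.sub_odd odd_one), sum_translate]
        ext x
        rw [sum_translate_delta, iota_apply, rho_normN]
        rw [hinv]
      rw [map_neg, e, map_zero, zero_sub, map_neg]
  -- For `n` odd `g` comes from exactness of the row: the row norm of `dV (delta m)` is `iota (dC m)
  -- = 0`.
  · have h0 : (conjRep N M).norm (dV γ N M n (delta N M m)) = 0 := by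
      rw [Representation.norm, LinearMap.sum_apply]
      have e1 : ∀ c, conjRep N M c (dV γ N M n (delta N M m)) =
          dV γ N M n (conjRep N M c (delta N M m)) := fun c =>
        LinearMap.congr_fun (conjRep_dV N M γ n c) _
      rw [Finset.sum_congr rfl fun c _ => e1 c, ← map_sum, ← LinearMap.sum_apply,
        ← Representation.norm, norm_conjRep_delta, dV_iota, hm, map_zero]
    obtain ⟨g, hg⟩ := exists_of_norm_eq_zero N M γ hγ h0
    have hγg : conj N M γ (dV γ N M (n - 1) g) = dV γ N M (n - 1) g := by
      have e1 := LinearMap.congr_fun (conj_dV N M γ γ (n - 1)) g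
      have e2 := LinearMap.congr_fun (dV_dV γ N M n) (delta N M m)
      have e3 : dV γ N M (n + 1) = dV γ N M (n - 1) := by
        rw [← dV_two N M γ (n - 1)]
        congr 1
        ring
      rw [LinearMap.comp_apply, LinearMap.comp_apply, eq_add_of_sub_eq hg, map_add] at e1
      rw [e3, LinearMap.comp_apply, LinearMap.zero_apply] at e2
      rw [e1, e2, zero_add]
    -- The vertical differential of `g` is fixed by conjugation, so it is `iota` of its value at
    -- `1`. Evaluating the equation for `g` at `γ` expresses that value by `dC` of `g(1)` and the
    -- norm of `N`.
    refine ⟨g, g.1 1, hg, ?_⟩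
    rw [eq_iota N M γ hγ hγg]
    congr 1
    have e4 : M.ρ γ (g.1 1) - g.1 γ = normN N M m := by
      have := congrArg (fun f : Inner N M => f.1 γ) hg
      rw [dV_of_odd γ N M hn] at this
      rw [← sum_translate_delta N M m γ, ← this]
      change _ = M.ρ γ (g.1 (γ⁻¹ * γ)) - g.1 γ
      rw [inv_mul_cancel]
    rw [dC_of_even γ M (hn.sub_odd odd_one), dV_of_even γ N M (hn.sub_odd odd_one), ← e4]
    change g.1 (γ * 1) - g.1 1 = M.ρ γ (g.1 1) - g.1 1 - (M.ρ γ (g.1 1) - g.1 γ)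
    rw [mul_one]
    abel

include hγ in
-- On total cohomology `shift` is the norm of `N`: the explicit primitive is `delta m` in column `1`
-- together with the correction from `exists_primitive_delta` in column `0`.
lemma exists_D_eq_shift_sub (n : ℤ) (m : M.V) (hm : dC M γ n m = 0) :
    ∃ u, D γ N M (n - 1) u = shift N M (Finsupp.single 0 (iota N M m)) -
      Finsupp.single 0 (iota N M (normN N M m)) := by
  have := Fintype.ofFinite (G ⧸ N)
  obtain ⟨g, m', hg, hg'⟩ := exists_primitive_delta γ N M hγ n m hm
  refine ⟨Finsupp.single 1 (delta N M m) + Finsupp.single 0 (g - iota N M m'), ?_⟩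
  have e1 : dV γ N M (n - 1 - (1 : ℕ)) = dV γ N M n := by
    rw [← dV_two N M γ]
    congr 1
    push_cast
    ring
  rw [map_add, D_single, D_single, e1, dH_of_odd N M γ hγ odd_one, norm_conjRep_delta,
    dH_of_even N M γ Even.zero, LinearMap.sub_apply, LinearMap.id_apply, map_sub, conj_iota,
    sub_sub_sub_cancel_right, hg, shift_single, Nat.cast_zero, sub_zero, map_sub, hg', dV_iota,
    map_sub, sub_sub_cancel_left]
  simp only [pow_one, neg_smul, one_smul, pow_zero, Finsupp.single_neg]
  abel

omit [Fintype N] in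
include hγ in
lemma sub_mem_range (g : G) (m : M.V) :
    M.ρ g m - m ∈ LinearMap.range (M.ρ γ - LinearMap.id) := by
  rw [← Representation.FiniteCyclicGroup.coinvariantsKer_eq_range _ γ hγ]
  exact Representation.Coinvariants.sub_mem_ker _ _

include hγ in
lemma normN_sub_mem_range (m : M.V) :
    normN N M m - Fintype.card N • m ∈ LinearMap.range (M.ρ γ - LinearMap.id) := by
  have e : normN N M m - Fintype.card N • m = ∑ n : N, (M.ρ n m - m) := by
    rw [Finset.sum_sub_distrib, Finset.sum_const, Finset.card_univ, normN_apply]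
  rw [e]
  exact Submodule.sum_mem _ fun n _ => sub_mem_range γ M hγ n m

omit [Fintype N] in
include hγ in
lemma norm_sub_mem_range (m : M.V) :
    M.ρ.norm m - Fintype.card G • m ∈ LinearMap.range (M.ρ γ - LinearMap.id) := by
  have e : M.ρ.norm m - Fintype.card G • m = ∑ g : G, (M.ρ g m - m) := by
    rw [Finset.sum_sub_distrib, Finset.sum_const, Finset.card_univ, Representation.norm,
      LinearMap.sum_apply]
  rw [e]
  exact Submodule.sum_mem _ fun g _ => sub_mem_range γ M hγ g m

variable (hN : Fintype.card N * Fintype.card N = Fintype.card G)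

include hγ hN in
-- For `n` even `m` is invariant and both the double norm of `N` and the norm of `G` multiply it by
-- `|N|² = |G|`. For `n` odd the same holds modulo the image of `γ - 1`, and there the norm of `G`
-- kills `m`.
lemma normN_normN_mem_range (n : ℤ) (m : M.V) (hm : dC M γ n m = 0) :
    normN N M (normN N M m) ∈ LinearMap.range (dC M γ (n - 1)) := by
  rcases Int.even_or_odd n with hn | hn
  · have hinv := forall_rho_eq γ M hγ hn hm
    rw [dC_of_odd γ M (hn.sub_odd odd_one)]
    have e : normN N M m = Fintype.card N • m := by
      rw [normN_apply, Finset.sum_congr rfl fun (n : N) _ => hinv n, Finset.sum_const,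
        Finset.card_univ]
    refine ⟨m, ?_⟩
    rw [e, map_nsmul, e, smul_smul, hN, Representation.norm, LinearMap.sum_apply,
      Finset.sum_congr rfl fun g _ => hinv g, Finset.sum_const, Finset.card_univ]
  · rw [dC_of_odd γ M hn] at hm
    rw [dC_of_even γ M (hn.sub_odd odd_one)]
    have h1 := normN_sub_mem_range γ N M hγ (normN N M m)
    have h2 := normN_sub_mem_range γ N M hγ (Fintype.card N • m)
    have h2' := Submodule.smul_mem _ (Fintype.card N : R) (normN_sub_mem_range γ N M hγ m)
    have h3 := norm_sub_mem_range γ M hγ m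
    rw [hm, ← hN, mul_smul] at h3
    rw [Nat.cast_smul_eq_nsmul, smul_sub] at h2'
    have h4 := Submodule.sub_mem _ (Submodule.add_mem _ h1 h2') h3
    convert h4 using 1
    abel

include hγ hN in
lemma exists_D_eq_single_four (n : ℤ) (m : M.V) (hm : dC M γ n m = 0) :
    ∃ u, D γ N M (n - 1) u = shift N M (shift N M (Finsupp.single 0 (iota N M m))) := by
  obtain ⟨u₁, hu₁⟩ := exists_D_eq_shift_sub γ N M hγ n m hm
  obtain ⟨u₂, hu₂⟩ := exists_D_eq_shift_sub γ N M hγ n (normN N M m) (by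
    rw [dC_normN, hm, map_zero])
  obtain ⟨m', hm'⟩ := normN_normN_mem_range γ N M hγ hN n m hm
  -- The two homotopies telescope, and `m'` accounts for the remaining double norm of `m`.
  refine ⟨shift N M u₁ + u₂ + Finsupp.single 0 (iota N M m'), ?_⟩
  rw [map_add, map_add, D_shift, hu₁, hu₂, D_single_iota, hm', map_sub]
  abel

include hγ hN in
/-- Cocycles of high filtration are coboundaries of cochains of high filtration. -/
lemma exists_primitive (n : ℤ) (j : ℕ) (v : ℕ →₀ Inner N M)
    (hv : v ∈ filX N M (2 * j + 4)) (hD : D γ N M n v = 0) :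
    ∃ u ∈ filX N M (2 * j), D γ N M (n - 1) u = v := by
  induction j generalizing v with
  | zero =>
    -- Filtration `4` is what allows two shifts to be stripped off; the cocycle underneath is some
    -- `iota m` plus a coboundary, and both become coboundaries after the double shift.
    obtain ⟨v₁, hv₁, rfl⟩ := exists_shift_eq N M (p := 2) (by simp) (by simp) hv
    obtain ⟨v₂, -, rfl⟩ := exists_shift_eq N M (p := 0) (by simp) (by simp) hv₁
    rw [D_shift, D_shift] at hD
    have hD' : D γ N M n v₂ = 0 := shift_injective N M (shift_injective N M (by simpa using hD))
    obtain ⟨m, w, hm, rfl⟩ := exists_eq_iota_add_D N M γ hγ n v₂ hD'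
    obtain ⟨u, hu⟩ := exists_D_eq_single_four γ N M hγ hN n m hm
    refine ⟨u + shift N M (shift N M w), ?_, ?_⟩
    · rw [filX_eq_top N M (by simp)]
      trivial
    · rw [map_add, hu, D_shift, D_shift, map_add, map_add]
  | succ j ih =>
    -- Filtration control comes from undoing one shift, finding a primitive there and shifting it
    -- back.
    obtain ⟨v₁, hv₁, rfl⟩ := exists_shift_eq N M (p := 2 * j + 4) (by push_cast; ring) (by omega) hv
    rw [D_shift] at hD
    obtain ⟨u, hu, hu'⟩ := ih v₁ hv₁ (shift_injective N M (by simpa using hD))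
    exact ⟨shift N M u, shift_mem_filX N M (by push_cast; ring) hu, by rw [D_shift, hu']⟩

include hγ hN in
lemma exists_primitive_of_four_le (n p : ℤ) (hp : 4 ≤ p) (v : ℕ →₀ Inner N M)
    (hv : v ∈ filX N M p) (hD : D γ N M n v = 0) :
    ∃ u ∈ filX N M (p - 5), D γ N M (n - 1) u = v := by
  -- With `j = ⌊(p - 4) / 2⌋` one has `2 j + 4 ≤ p` and `2 j ≥ p - 5`; the fifth step lost is due to
  -- parity.
  obtain ⟨u, hu, hu'⟩ := exists_primitive γ N M hγ hN n ((p - 4) / 2).toNat v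
    (filX_anti N M (by omega) hv) hD
  exact ⟨u, filX_anti N M (by omega) hu, hu'⟩

end Shift

end SerreTate

/-- A linear map factors through a surjective map with smaller kernel. -/
lemma LinearMap.exists_comp_eq_of_ker_le {R V W₁ W₂ : Type*} [CommRing R] [AddCommGroup V]
    [Module R V] [AddCommGroup W₁] [Module R W₁] [AddCommGroup W₂] [Module R W₂]
    (s₁ : V →ₗ[R] W₁) (s₂ : V →ₗ[R] W₂) (h₁ : Function.Surjective s₁)
    (h : ∀ x, s₁ x = 0 → s₂ x = 0) : ∃ ε : W₁ →ₗ[R] W₂, ∀ x, ε (s₁ x) = s₂ x := by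
  refine ⟨(LinearMap.ker s₁).liftQ s₂ h ∘ₗ
    (s₁.quotKerEquivOfSurjective h₁).symm.toLinearMap, fun x => ?_⟩
  have e : (s₁.quotKerEquivOfSurjective h₁).symm (s₁ x) = (LinearMap.ker s₁).mkQ x := by
    rw [LinearEquiv.symm_apply_eq]
    rfl
  exact congrArg ((LinearMap.ker s₁).liftQ s₂ h) e

namespace SerreTate

/-! ### Convergence -/

section Convergence

variable {R G : Type u} [CommRing R] [CommGroup G] [Fintype G] (γ : G)
  (N : Subgroup G) (M : Rep.{u} R G)

/-- The cocycles of the periodic complex of filtration `≥ p`. -/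
def filCocycles (p n : ℤ) : Submodule R (LinearMap.ker (D γ N M n)) :=
  (filX N M p).comap (LinearMap.ker (D γ N M n)).subtype

/-- Cocycles of filtration `≥ p` define elements of `Z_r^p`. -/
def filCocyclesToZ (r p n : ℤ) : filCocycles γ N M p n →ₗ[R] (periodic γ N M).Z r p n :=
  LinearMap.codRestrict _ (show filCocycles γ N M p n →ₗ[R] (ℕ →₀ Inner N M) from
    (LinearMap.ker (D γ N M n)).subtype ∘ₗ (filCocycles γ N M p n).subtype) fun x =>
      (mem_periodic_Z γ N M).2 ⟨x.2, by
        change D γ N M n x.1.1 ∈ _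
        rw [LinearMap.mem_ker.1 x.1.2]
        exact zero_mem _⟩

variable {γ N M} {hγ : ∀ x, x ∈ Subgroup.zpowers γ}
  (ψ : ∀ n, TotH N M γ n ≃ₗ[R] tateCohomology M n)
  (hψ : ∀ n (x : TotH N M γ n), ψ (n + 1 + 1) (totPeriod N M γ n x) =
    periodicity M γ hγ n (ψ n x))

/-- By finite support every cocycle of the periodic complex is some `b⁻ᵏ x` with `x` a Serre cocycle
of the same filtration, so the union over `k` is a single image. -/
lemma abutment_fil (p n : ℤ) : (abutment hγ ψ hψ).fil p n =
    (filCocycles γ N M p n).map ((ψ n).toLinearMap ∘ₗ HomologyMod.mk _ _) := by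
  apply le_antisymm
  · refine iSup_le fun k => ?_
    rintro _ ⟨x, hx, rfl⟩
    exact ⟨inclCocycles N M γ n (n + 2 * k) k rfl x, hx, rfl⟩
  · rintro _ ⟨v, hv, rfl⟩
    obtain ⟨m₀, hm₀⟩ := exists_forall_mem_totX N M v.1
    let k : ℕ := (m₀ - n).toNat
    let x : totX N M (n + 2 * k) := ⟨v.1, hm₀ _ (by omega)⟩
    have hx : x ∈ (serre γ N M).cocycles (n + 2 * k) := by
      refine (mem_cocycles_iff N M γ _).2 ?_
      rw [D_periodic]
      exact v.2
    exact Submodule.mem_iSup_of_mem k ⟨⟨x, hx⟩, hv, rfl⟩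

lemma abutment_fil_zero (n : ℤ) : (abutment hγ ψ hψ).fil 0 n = ⊤ := by
  rw [abutment_fil, eq_top_iff]
  rintro y -
  obtain ⟨v, hv⟩ := HomologyMod.mk_surjective _ _ ((ψ n).symm y)
  refine ⟨v, ?_, (congrArg (ψ n) hv).trans ((ψ n).apply_symm_apply y)⟩
  change v.1 ∈ filX N M 0
  rw [filX_eq_top N M le_rfl]
  trivial

variable [Fintype N] (hN : Fintype.card N * Fintype.card N = Fintype.card G)

include hN in
lemma abutment_fil_four (n : ℤ) : (abutment hγ ψ hψ).fil 4 n = ⊥ := by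
  rw [abutment_fil, eq_bot_iff]
  rintro _ ⟨v, hv, rfl⟩
  obtain ⟨u, -, hu⟩ := exists_primitive_of_four_le γ N M hγ hN n 4 le_rfl v.1 hv v.2
  rw [Submodule.mem_bot]
  exact (congrArg (ψ n) ((HomologyMod.mk_eq_zero_iff v).2 ⟨u, hu⟩)).trans (map_zero _)

include hγ hN in
-- The cocycle `D z` has filtration so high that it has a primitive `u` of filtration above `p`.
-- Then `z - u` is an honest cocycle with the same leading term as `z`.
lemma exists_D_eq_D {r p n : ℤ} (hr : 7 ≤ r) {z : ℕ →₀ Inner N M}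
    (hD : D γ N M n z ∈ filX N M (p + r)) :
    ∃ u ∈ filX N M (p + 1), D γ N M n u = D γ N M n z := by
  by_cases hp : p < 0
  · refine ⟨z, ?_, rfl⟩
    rw [filX_eq_top N M (by omega)]
    trivial
  · obtain ⟨u, hu, hu'⟩ := exists_primitive_of_four_le γ N M hγ hN (n + 1) (p + r) (by omega)
      _ hD (LinearMap.congr_fun (D_D γ N M n) z)
    rw [add_sub_cancel_right] at hu'
    exact ⟨u, filX_anti N M (by omega) hu, hu'⟩

include hγ hN in
lemma pageD_eq_zero {r p n p' n' : ℤ} (hr : 7 ≤ r) (hp : p' = p + r) (hn : n' = n + 1) :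
    (periodic γ N M).pageD r p n p' n' hp hn = 0 := by
  subst hp hn
  refine LinearMap.ext fun x => ?_
  obtain ⟨z, rfl⟩ := (periodic γ N M).cls_surjective r p n x
  obtain ⟨hz, hD⟩ := (mem_periodic_Z γ N M).1 z.2
  obtain ⟨u, hu, hu'⟩ := exists_D_eq_D (γ := γ) (hγ := hγ) hN hr hD
  refine ((periodic γ N M).cls_eq_zero_iff
    ((periodic γ N M).dZ r p n (p + r) (n + 1) rfl rfl z)).2 ?_
  refine (mem_periodic_B γ N M).2 ⟨0, u, ⟨zero_mem _, ?_⟩, ⟨?_, ?_⟩, ?_⟩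
  · rw [map_zero]
    exact zero_mem _
  · rwa [add_sub_cancel_right]
  · rw [add_sub_cancel_right, hu']
    exact hD
  · rw [add_sub_cancel_right, hu', zero_add]
    exact LinearMap.congr_fun (periodicTot_d γ N M n (n + 1) rfl) z.1

include hγ hN in
lemma cls_filCocyclesToZ_surjective {r p n : ℤ} (hr : 7 ≤ r) :
    Function.Surjective ((periodic γ N M).cls r p n ∘ₗ filCocyclesToZ γ N M r p n) := by
  intro x
  obtain ⟨z, rfl⟩ := (periodic γ N M).cls_surjective r p n x
  obtain ⟨hz, hD⟩ := (mem_periodic_Z γ N M).1 z.2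
  obtain ⟨u, hu, hu'⟩ := exists_D_eq_D (γ := γ) (hγ := hγ) hN hr hD
  let z₀ : ℕ →₀ Inner N M := z.1
  have hv : D γ N M n (z₀ - u) = 0 := by rw [map_sub, hu', sub_self]
  have hv' : z₀ - u ∈ filX N M p := Submodule.sub_mem _ hz (filX_anti N M (by omega) hu)
  refine ⟨⟨⟨z₀ - u, hv⟩, hv'⟩, ?_⟩
  refine ((periodic γ N M).cls_eq_cls_iff _ _).2 ?_
  refine (mem_periodic_B γ N M).2 ⟨-u, 0, ⟨neg_mem hu, ?_⟩, ⟨zero_mem _, ?_⟩, ?_⟩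
  · rw [map_neg, hu']
    exact neg_mem hD
  · rw [map_zero]
    exact zero_mem _
  · rw [map_zero, add_zero]
    exact sub_sub_cancel_left z₀ u

include hγ hN in
-- A boundary must be shown to have a primitive of filtration at least `p - r + 1`. This is no
-- condition when `p < r`; otherwise the given primitive is replaced by one that loses at most `5`.
lemma cls_eq_zero_of_boundary {r p n : ℤ} (hr : 7 ≤ r) (v : filCocycles γ N M p n)
    (h : ∃ w, D γ N M (n - 1) w = v.1.1) :
    (periodic γ N M).cls r p n (filCocyclesToZ γ N M r p n v) = 0 := by
  have key : ∃ w ∈ filX N M (p - r + 1), D γ N M (n - 1) w = v.1.1 := by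
    by_cases hp : p < r
    · obtain ⟨w, hw⟩ := h
      refine ⟨w, ?_, hw⟩
      rw [filX_eq_top N M (by omega)]
      trivial
    · obtain ⟨u, hu, hu'⟩ :=
        exists_primitive_of_four_le γ N M hγ hN n p (by omega) v.1.1 v.2 v.1.2
      exact ⟨u, filX_anti N M (by omega) hu, hu'⟩
  obtain ⟨w, hw, hw'⟩ := key
  refine ((periodic γ N M).cls_eq_zero_iff _).2 ?_
  refine (mem_periodic_B γ N M).2 ⟨0, w, ⟨zero_mem _, ?_⟩, ⟨hw, ?_⟩, ?_⟩
  · rw [map_zero]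
    exact zero_mem _
  · rw [hw']
    exact v.2
  · rw [hw', zero_add]
    rfl

omit [Fintype N] in
-- If `v = y + D w` as in `B_r`, then `y` is a cocycle of filtration `p + 1` cohomologous to `v`.
lemma mk_mem_map_of_cls_eq_zero {r p n : ℤ} (v : filCocycles γ N M p n)
    (h : (periodic γ N M).cls r p n (filCocyclesToZ γ N M r p n v) = 0) :
    ∃ v' ∈ filCocycles γ N M (p + 1) n, HomologyMod.mk (D γ N M (n - 1)) (D γ N M n) v' =
      HomologyMod.mk _ _ v.1 := by
  obtain ⟨y, w, hy, -, e⟩ := (mem_periodic_B γ N M).1 (((periodic γ N M).cls_eq_zero_iff _).1 h)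
  have e' : v.1.1 = y + D γ N M (n - 1) w := e
  have hDy : D γ N M n y = 0 := by
    have := LinearMap.mem_ker.1 v.1.2
    rwa [e', map_add, D_comp_D, add_zero] at this
  refine ⟨⟨y, hDy⟩, hy.1, (HomologyMod.mk_eq_mk_iff _ _).2 ⟨-w, ?_⟩⟩
  rw [e', map_neg]
  exact (sub_add_cancel_left _ _).symm

omit [Fintype N] in
lemma cls_eq_zero_of_mem {r p n : ℤ} (v : filCocycles γ N M p n) (h : v.1.1 ∈ filX N M (p + 1)) :
    (periodic γ N M).cls r p n (filCocyclesToZ γ N M r p n v) = 0 := by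
  refine ((periodic γ N M).cls_eq_zero_iff _).2 ?_
  refine (mem_periodic_B γ N M).2 ⟨v.1.1, 0, ⟨h, ?_⟩, ⟨zero_mem _, ?_⟩, ?_⟩
  · rw [LinearMap.mem_ker.1 v.1.2]
    exact zero_mem _
  · rw [map_zero]
    exact zero_mem _
  · rw [map_zero, add_zero]
    rfl

include hN in
/-- The map `b⁻ᵏ [x] ↦ b⁻ᵏ [x]` from `F^p Ĥ^n` to a late page. -/
lemma exists_fil_to_page {r p n : ℤ} (hr : 7 ≤ r) :
    ∃ ε : (abutment hγ ψ hψ).fil p n →ₗ[R] (periodic γ N M).Page r p n,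
      Function.Surjective ε ∧
      LinearMap.ker ε = ((abutment hγ ψ hψ).fil (p + 1) n).submoduleOf
        ((abutment hγ ψ hψ).fil p n) ∧
      ∀ (v : filCocycles γ N M p n) (y : (abutment hγ ψ hψ).fil p n),
        y.1 = ψ n (HomologyMod.mk _ _ v.1) →
          ε y = (periodic γ N M).cls r p n (filCocyclesToZ γ N M r p n v) := by
  let s₀ : LinearMap.ker (D γ N M n) →ₗ[R] tateCohomology M n :=
    (ψ n).toLinearMap ∘ₗ HomologyMod.mk _ _
  have hs₀ (v) : s₀ v = ψ n (HomologyMod.mk _ _ v) := rfl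
  let s₁ : filCocycles γ N M p n →ₗ[R] (abutment hγ ψ hψ).fil p n :=
    LinearMap.codRestrict _ (s₀ ∘ₗ (filCocycles γ N M p n).subtype) fun v => by
      rw [abutment_fil]
      exact ⟨v.1, v.2, rfl⟩
  have hs₁ (v) : (s₁ v).1 = ψ n (HomologyMod.mk _ _ v.1) := rfl
  have h₁ : Function.Surjective s₁ := by
    intro y
    obtain ⟨v, hv, e⟩ : y.1 ∈ (filCocycles γ N M p n).map s₀ := by
      rw [← abutment_fil ψ hψ]
      exact y.2
    exact ⟨⟨v, hv⟩, Subtype.ext e⟩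
  have hker (v : filCocycles γ N M p n) (hv : s₁ v = 0) :
      (periodic γ N M).cls r p n (filCocyclesToZ γ N M r p n v) = 0 := by
    have e : ψ n (HomologyMod.mk _ _ v.1) = 0 := (hs₁ v).symm.trans (congrArg Subtype.val hv)
    exact cls_eq_zero_of_boundary (hγ := hγ) hN hr v
      ((HomologyMod.mk_eq_zero_iff v.1).1 ((map_eq_zero_iff (ψ n) (ψ n).injective).1 e))
  obtain ⟨ε, hε⟩ := LinearMap.exists_comp_eq_of_ker_le (R := R)
    (V := filCocycles γ N M p n) (W₁ := (abutment hγ ψ hψ).fil p n)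
    (W₂ := (periodic γ N M).Page r p n) s₁
    ((periodic γ N M).cls r p n ∘ₗ filCocyclesToZ γ N M r p n) h₁ hker
  refine ⟨ε, fun x => ?_, ?_, fun v y hy => ?_⟩
  · obtain ⟨v, rfl⟩ := cls_filCocyclesToZ_surjective (γ := γ) (hγ := hγ) hN hr x
    exact ⟨s₁ v, hε v⟩
  · ext y
    obtain ⟨v, rfl⟩ := h₁ y
    rw [LinearMap.mem_ker, hε]
    change _ ↔ (s₁ v).1 ∈ (abutment hγ ψ hψ).fil (p + 1) n
    rw [abutment_fil ψ hψ (p + 1) n, hs₁]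
    constructor
    · intro h
      obtain ⟨v', hv', e⟩ := mk_mem_map_of_cls_eq_zero v h
      exact ⟨v', hv', congrArg (ψ n) e⟩
    · rintro ⟨v', hv', e⟩
      have e' : s₁ ⟨v', filX_anti N M (by omega) hv'⟩ = s₁ v := Subtype.ext e
      have e2 := congrArg ε e'
      rw [hε, hε] at e2
      rw [← e2]
      exact cls_eq_zero_of_mem _ hv'
  · have e : y = s₁ v := Subtype.ext hy
    rw [e, hε]
    rfl

include hN in
lemma converges : Converges (localization γ N M) (abutment hγ ψ hψ) where
  fil_eq_top n := ⟨0, abutment_fil_zero ψ hψ n⟩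
  fil_eq_bot n := ⟨4, abutment_fil_four ψ hψ hN n⟩
  degenerates := by
    -- Primitives lose at most `5` steps of filtration, so differentials of length `r ≥ 6` are
    -- already under control; `7` leaves a margin.
    refine ⟨7, fun r hr h7 => ⟨fun i j => ?_, fun p q => ?_⟩⟩
    · by_cases hij : (ComplexShape.up' (⟨r, 1 - r⟩ : ℤ × ℤ)).Rel i j
      · refine ModuleCat.hom_ext (((periodic γ N M).pageComplex_d r i j hij).trans ?_)
        exact pageD_eq_zero (hγ := hγ) hN h7 _ _
      · exact ((periodic γ N M).pageComplex r).shape i j hij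
    · obtain ⟨ε, h1, h2, h3⟩ := exists_fil_to_page ψ hψ hN (p := p) (n := p + q) h7
      refine ⟨ε, h1, h2, fun n k hn x z y hz hy => ?_⟩
      have hx : inclCocycles N M γ (p + q) n k hn x ∈ filCocycles γ N M p (p + q) := by
        change (show totX N M n from x.1).1 ∈ filX N M p
        rw [← hz]
        exact ((mem_serre_Z γ N M z.1).1 z.2).1
      refine (h3 ⟨_, hx⟩ y hy).trans ?_
      refine congrArg ((periodic γ N M).cls r p (p + q)) (Subtype.ext ?_)
      exact congrArg (fun y : totX N M n => y.1) hz.symm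

end Convergence

end SerreTate

/-! ### The main theorem -/

theorem mainTheorem7 {R G : Type u} [CommRing R] [CommGroup G] [Fintype G]
    (γ : G) (hγ : ∀ x, x ∈ Subgroup.zpowers γ) (hG : Fintype.card G = 9)
    (N : Subgroup G) [Fintype N] (σ : N) (hσ : ∀ x, x ∈ Subgroup.zpowers σ)
    (hσγ : (σ : G) = γ ^ 3) (M : Rep.{u} R G) :
    -- the action of `G ⧸ N` on `Ĥ^q(N; M)` induced by that of `G` on `M`
    ∃ ρ : ∀ q : ℤ, Representation R (G ⧸ N) (tateCohomology (Rep.res N.subtype M) q),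
      (∀ (q : ℤ) (g : G), ρ q (g : G ⧸ N) =
        ((tateCohomologyFunctor q).map (Rep.resMap N.subtype (M.applyAsHom g))).hom) ∧
    -- the spectral sequence, obtained from the Serre spectral sequence by inverting `b`
    ∃ (E : E₂CohomologicalSpectralSequence (ModuleCat.{u} R))
      (L : SerreTate.Localization γ N M E) (A : SerreTate.Abutment γ N M hγ),
      -- `E_2^{p,q} = H^p(G ⧸ N; Ĥ^q(N; M))`, where `b` acts by the periodicity of `Ĥ^*(N; M)`
      (∃ φ : ∀ (p : ℕ) (q : ℤ),
          (E.page 2 le_rfl).X ((p : ℤ), q) ≅ groupCohomology (Rep.of (ρ q)) p,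
        ∀ q : ℤ, ∃ β : Rep.of (ρ q) ⟶ Rep.of (ρ (q + 1 + 1)),
          (∀ x, β.hom x = SerreTate.periodicity (Rep.res N.subtype M) σ hσ q x) ∧
          ∀ (p : ℕ) (n : ℤ) (k : ℕ) (hn : n = p + q + 2 * ((k + 1 : ℕ) : ℤ))
            (hn' : n = p + (q + 1 + 1) + 2 * k)
            (x : (SerreTate.serre γ N M).Page 2 (p : ℤ) n),
            (φ p (q + 1 + 1)).hom.hom (L.frac 2 le_rfl p (q + 1 + 1) n k hn' x) =
              ((groupCohomology.functor R (G ⧸ N) p).map β).hom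
                ((φ p q).hom.hom (L.frac 2 le_rfl p q n (k + 1) hn x))) ∧
      (∀ p q : ℤ, p < 0 → Limits.IsZero ((E.page 2 le_rfl).X (p, q))) ∧
      -- convergence
      ((∃ (r : ℤ) (hr : 2 ≤ r) (a c : ℤ), ∀ p q : ℤ, p < a ∨ c < p →
          Limits.IsZero ((E.page r hr).X (p, q))) →
        SerreTate.Converges L A) := by
  have := Fintype.ofFinite (G ⧸ N)
  have hoγ : orderOf γ = 9 := by
    rw [← hG, ← Nat.card_eq_fintype_card, orderOf_eq_card_of_forall_mem_zpowers hγ]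
  have hcard : Fintype.card N = 3 := by
    rw [← Nat.card_eq_fintype_card, ← orderOf_eq_card_of_forall_mem_zpowers hσ,
      ← Subgroup.orderOf_coe, hσγ, orderOf_pow, hoγ]
    rfl
  obtain ⟨ψ, hψ⟩ := SerreTate.exists_colTateEquiv N M γ hγ σ hσ
  obtain ⟨χ, hχ⟩ := SerreTate.exists_totEquiv M γ hγ (N := N)
  refine ⟨fun q => SerreTate.tateRho (ψ q), fun q g => SerreTate.tateRho_mk (ψ q) g,
    (SerreTate.periodic γ N M).spectralSequence, SerreTate.localization γ N M,
    SerreTate.abutment hγ χ hχ,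
    ⟨fun p q => SerreTate.secondPageIso hγ (ψ q) p, fun q =>
      ⟨SerreTate.tatePeriodHom (ψ q) (ψ (q + 1 + 1)) (hψ q), fun x => rfl,
        fun p n k hn hn' x => SerreTate.secondPageIso_period hγ (ψ q) (ψ (q + 1 + 1)) (hψ q)
          p n k hn hn' x⟩⟩, fun p q hp => ?_, fun _ => ?_⟩
  · have := SerreTate.subsingleton_page γ N M (r := 2) (n := p + q) hp
    exact ModuleCat.isZero_of_subsingleton
      (ModuleCat.of R ((SerreTate.periodic γ N M).Page 2 p (p + q)))
  -- The only numerical input to convergence: `|N|² = 3 * 3 = 9 = |G|`.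
  · exact SerreTate.converges χ hχ (by rw [hcard, hG])
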